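/- All vector spaces are over $\mathbb C$. For a vector space $W$ put $\mathcal E(W)=\mathrm{Hom}(W,W((x)))$, and let $1_W\in\mathcal E(W)$ be the identity operator. As usual, $W((x_1,\dots,x_r))=W[[x_1,\dots,x_r]][x_1^{-1},\dots,x_r^{-1}]$, $\delta(z)=\sum_{n\in\mathbb Z}z^n$, and powers of a binomial $(y\pm z)^n$, $n\in\mathbb Z$, are expanded in nonnegative powers of the second variable $z$; $\iota_{y,z}$ denotes expansion in $\mathbb C((y))((z))$. **$\mathcal S$-local subsets.** A subset $S\subset\mathcal E(W)$ is $\mathcal S$-local if for all $a(x),b(x)\in S$ there are $k\in\mathbb N$ and finitely many $\psi_i(x)\in\mathbb C((x))$, $u_i(x),v_i(x)\in S$ with $$(x_1-x_2)^k a(x_1)b(x_2)=\sum_{i=1}^r (x_1-x_2)^k\,\iota_{x_2,x_1}(\psi_i(x_2-x_1))\,u_i(x_2)v_i(x_1).$$ **The subspace $\langle S\rangle$.** A finite sequence $(a_1,\dots,a_r)$ in $\mathcal E(W)$ is quasi compatible if there is a nonzero polynomial $p(x,y)$ with $\big(\prod_{i<j}p(x_i,x_j)\big)a_1(x_1)\cdots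 a_r(x_r)\in\mathrm{Hom}(W,W((x_1,\dots,x_r)))$; a subset of $\mathcal E(W)$ is quasi compatible if each finite sequence in it is. For a quasi compatible pair $(a,b)$ and a nonzero polynomial $p$ with $p(x_1,x_2)a(x_1)b(x_2)\in \mathrm{Hom}(W,W((x_1,x_2)))$, the products $a(x)_nb(x)\in\mathcal E(W)$, $n\in\mathbb Z$, are defined by $$Y_{\mathcal E}(a(x),x_0)b(x)=\sum_{n\in\mathbb Z}a(x)_nb(x)\,x_0^{-n-1}=\iota_{x,x_0}\big(p(x+x_0,x)^{-1}\big)\,\big(p(x_1,x)a(x_1)b(x)\big)\big|_{x_1=x+x_0}$$ (independently of $p$). A quasi compatible subspace is closed if it contains $a(x)_nb(x)$ for all its elements $a(x),b(x)$ and all $n\in\mathbb Z$. $\langle S\rangle$ denotes the smallest closed quasi compatible subspace of $\mathcal E(W)$ that contains $S\cup\{1_W\}$. **Algebras and modules.** Consider a vector space $V$ with a linear map $Y:V\to\mathcal E(V)$, $v\mapsto Y(v,x)$, and a vector $\mathbf 1\in V$ such that $Y(\mathbf 1,x)=1_V$, and $Y(v,x)\mathbf 1\in V[[x]]$ with $\lim_{x\to0}Y(v,x)\mathbf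 1=v$ for all $v\in V$. * $(V,Y,\mathbf 1)$ is a nonlocal vertex algebra if for all $u,v,w\in V$ there is $l\in\mathbb N$ with $(x_0+x_2)^lY(u,x_0+x_2)Y(v,x_2)w=(x_0+x_2)^lY(Y(u,x_0)v,x_2)w$. * $(V,Y,\mathbf 1)$ is a weak quantum vertex algebra if for all $u,v\in V$ there are finitely many $v^{(i)},u^{(i)}\in V$, $f_i(x)\in\mathbb C((x))$ with $$x_0^{-1}\delta\Big(\tfrac{x_1-x_2}{x_0}\Big)Y(u,x_1)Y(v,x_2)-x_0^{-1}\delta\Big(\tfrac{x_2-x_1}{-x_0}\Big)\sum_{i=1}^r f_i(-x_0)Y(v^{(i)},x_2)Y(u^{(i)},x_1)=x_2^{-1}\delta\Big(\tfrac{x_1-x_0}{x_2}\Big)Y(Y(u,x_0)v,x_2).$$ * A module for a nonlocal vertex algebra $V$ is a vector space $W$ with a linear map $Y_W:V\to\mathcal E(W)$ such that $Y_W(\mathbf 1,x)=1_W$ and for all $u,v\in V$, $w\in W$ there is $l\in\mathbb N$ with $(x_0+x_2)^lY_W(u,x_0+x_2)Y_W(v,x_2)w=(x_0+x_2)^lY_W(Y(u,x_0)v,x_2)w$.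 It is faithful if $Y_W$ is injective. **Theorem.** Let $W$ be any vector space and let $S$ be any $\mathcal S$-local subset of $\mathcal E(W)$. Then the smallest closed quasi compatible subspace $\langle S\rangle$ containing $S\cup\{1_W\}$ exists, $(\langle S\rangle,Y_{\mathcal E},1_W)$ is a nonlocal vertex algebra and a weak quantum vertex algebra, and $W$ is a faithful $\langle S\rangle$-module (not merely a quasi module) with $Y_W(\alpha(x),x_0)=\alpha(x_0)$ for $\alpha(x)\in\langle S\rangle$. -/

import Mathlib

open MvPolynomial

noncomputable section

namespace Vtx

/-! ## Formal calculus

A formal series `∑ F(e) x^e`, with `e` running over all integer exponents of the variables indexed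
by `ι`, is its coefficient function `F : (ι → ℤ) → V`. -/

/-- `V[[x_i^{±1} : i ∈ ι]]`. -/
abbrev FSeries (ι V : Type*) := (ι → ℤ) → V

section FormalCalculus

variable {ι V : Type*} [AddCommGroup V] [Module ℂ V]

/-- The product of a polynomial and a formal series. -/
def polyMul (p : MvPolynomial ι ℂ) (F : FSeries ι V) : FSeries ι V :=
  fun e => ∑ d ∈ p.support, p.coeff d • F (fun i => e i - (d i : ℤ))

/-- The product of a scalar formal series and a formal series. It is used only where the product
exists, that is, where each coefficient is given by a finite sum. -/
def seriesMul (g : FSeries ι ℂ) (F : FSeries ι V) : FSeries ι V :=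
  fun e => ∑ᶠ d : ι → ℤ, g d • F (e - d)

/-- `F` lies in `V((x_i : i ∈ ι)) = V[[x_i]][x_i⁻¹]`: the exponents of all variables are jointly
bounded below. -/
def IsLaurent (F : FSeries ι V) : Prop :=
  ∃ N : ℤ, ∀ e : ι → ℤ, (∃ i, e i < N) → F e = 0

end FormalCalculus

/-- The coefficient of `y ^ (m - i) * z ^ i` in the expansion of `(y + z) ^ m` in nonnegative
powers of `z`, for integers `m`, `i`. -/
def ibinom (m i : ℤ) : ℤ := if 0 ≤ i then Ring.choose m i.toNat else 0

/-- `ι_{x₂,x₁} f(x₂ - x₁)`: the series `f(x₂ - x₁)` expanded in nonnegative powers of `x₁`.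
Variables: `0` is `x₁`, `1` is `x₂`. -/
def expandDiff (f : LaurentSeries ℂ) : FSeries (Fin 2) ℂ :=
  fun e => f.coeff (e 0 + e 1) * ((ibinom (e 0 + e 1) (e 0) : ℤ) : ℂ) * (-1) ^ (e 0)

/-- `f(-x₀)` as a series in `x₀, x₁, x₂`. -/
def evalNeg (f : LaurentSeries ℂ) : FSeries (Fin 3) ℂ :=
  fun e => if e 1 = 0 ∧ e 2 = 0 then f.coeff (e 0) * (-1) ^ (e 0) else 0

/-- `x⁻¹ δ((y + ε z) / (σ x)) = ∑ₙ x⁻¹ (σ x)⁻ⁿ (y + ε z)ⁿ`, where `(y + ε z)ⁿ` is expanded in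
nonnegative powers of `z`, and `x, y, z` are the three variables in some order. -/
def delta (x y z : Fin 3) (σ ε : ℂ) : FSeries (Fin 3) ℂ :=
  fun e => if e x + e y + e z = -1 then
    σ ^ (-(e y + e z)) * ((ibinom (e y + e z) (e z) : ℤ) : ℂ) * ε ^ (e z) else 0

section Fields

variable {W : Type*} [AddCommGroup W] [Module ℂ W]

/-- The identity operator, as an element of `Hom(W, W((x)))`. -/
def idField (W : Type*) [AddCommGroup W] [Module ℂ W] : VertexOperator ℂ W :=
  VertexOperator.of_coeff (fun n => if n = 0 then 1 else 0) (by
    intro x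
    refine ⟨0, fun m hm => ?_⟩
    by_contra h
    exact hm (by simp [(not_le.mp h).ne]))

/-- The series `a₁(x₁) a₂(x₂) ⋯ a_r(x_r) w`. -/
def prodSeries {r : ℕ} (a : Fin r → VertexOperator ℂ W) (w : W) : FSeries (Fin r) W :=
  fun e => (List.ofFn fun i => (HVertexOperator.coeff (a i) (e i) : Module.End ℂ W)).prod w

/-- The series `a(x₁) b(x₂) w`. Variables: `0` is `x₁`, `1` is `x₂`. -/
def pairSeries (a b : VertexOperator ℂ W) (w : W) : FSeries (Fin 2) W :=
  fun e => HVertexOperator.coeff a (e 0) (HVertexOperator.coeff b (e 1) w)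

/-- The series `a(x₂) b(x₁) w`. Variables: `0` is `x₁`, `1` is `x₂`. -/
def pairSeriesSwap (a b : VertexOperator ℂ W) (w : W) : FSeries (Fin 2) W :=
  fun e => HVertexOperator.coeff a (e 1) (HVertexOperator.coeff b (e 0) w)

/-- `𝒮`-local subsets of `Hom(W, W((x)))`. -/
def IsSLocal (U : Set (VertexOperator ℂ W)) : Prop :=
  ∀ a ∈ U, ∀ b ∈ U, ∃ (k r : ℕ) (ψ : Fin r → LaurentSeries ℂ) (u v : Fin r → VertexOperator ℂ W),
    (∀ i, u i ∈ U ∧ v i ∈ U) ∧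
    ∀ w : W, polyMul ((X 0 - X 1) ^ k) (pairSeries a b w) =
      ∑ i, polyMul ((X 0 - X 1) ^ k) (seriesMul (expandDiff (ψ i)) (pairSeriesSwap (u i) (v i) w))

/-- Quasi compatible finite sequences: for some nonzero polynomial `p(x, y)`,
`(∏_{i<j} p(x_i, x_j)) a₁(x₁) ⋯ a_r(x_r) ∈ Hom(W, W((x₁, …, x_r)))`. -/
def QuasiCompatible {r : ℕ} (a : Fin r → VertexOperator ℂ W) : Prop :=
  ∃ p : MvPolynomial (Fin 2) ℂ, p ≠ 0 ∧ ∀ w : W, IsLaurent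
    (polyMul (∏ q : Fin r × Fin r with q.1 < q.2, rename ![q.1, q.2] p) (prodSeries a w))

/-- A set is quasi compatible if each finite sequence in it is. -/
def IsQuasiCompatible (U : Set (VertexOperator ℂ W)) : Prop :=
  ∀ (r : ℕ) (a : Fin r → VertexOperator ℂ W), (∀ i, a i ∈ U) → QuasiCompatible a

/-! ### The products `a(x)ₙ b(x)` -/

/-- `p(x₁, x₂) a(x₁) b(x₂) ∈ Hom(W, W((x₁, x₂)))` with `p ≠ 0`. -/
def PairCompat (p : MvPolynomial (Fin 2) ℂ) (a b : VertexOperator ℂ W) : Prop :=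
  p ≠ 0 ∧ ∀ w : W, IsLaurent (polyMul p (pairSeries a b w))

/-- The field `ℂ((x))`. (A definition rather than an abbreviation, so that the field structure on
Laurent series over it is found without unfolding.) -/
def LaurentC : Type := LaurentSeries ℂ

instance : Field LaurentC := inferInstanceAs (Field (LaurentSeries ℂ))

/-- The coefficients of an element of `ℂ((x))`. -/
def LaurentC.coeff (f : LaurentC) (j : ℤ) : ℂ := HahnSeries.coeff (Γ := ℤ) (R := ℂ) f j

/-- The constants `ℂ → ℂ((x))`. -/
def LaurentC.const : ℂ →+* LaurentC := (HahnSeries.C : ℂ →+* LaurentSeries ℂ)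

/-- The variable `x` of `ℂ((x))`. -/
def LaurentC.var : LaurentC := (HahnSeries.single 1 1 : LaurentSeries ℂ)

/-- The field `ℂ((x))((x₀))`. -/
abbrev LaurentCC : Type := LaurentSeries LaurentC

/-- `p(x + x₀, x)` as an element of the field `ℂ((x))((x₀))`. Its inverse there is
`ι_{x,x₀} (1 / p(x + x₀, x))`. -/
def shiftPoly (p : MvPolynomial (Fin 2) ℂ) : LaurentCC :=
  eval₂ ((HahnSeries.C : LaurentC →+* LaurentCC).comp LaurentC.const)
    ![HahnSeries.C LaurentC.var + HahnSeries.single 1 1, HahnSeries.C LaurentC.var] p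

/-- The coefficient of `x₀ ^ i * x ^ j` in `F(x + x₀, x)`, where the powers of `x + x₀` are
expanded in nonnegative powers of `x₀`. -/
def shiftCoeff (F : FSeries (Fin 2) W) (i j : ℤ) : W :=
  ∑ᶠ m : ℤ, ibinom m i • F ![m, i + j - m]

/-- `F(x + x₀, x)` for `F ∈ W((x₁, x₂))`. Variables: `0` is `x₀`, `1` is `x`. -/
def shiftSeries (F : FSeries (Fin 2) W) : FSeries (Fin 2) W :=
  fun e => shiftCoeff F (e 0) (e 1)

/-- The coefficient function of an element of `ℂ((x))((x₀))`. Variables: `0` is `x₀`, `1` is `x`. -/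
def iterCoeff (g : LaurentCC) : FSeries (Fin 2) ℂ :=
  fun e => (g.coeff (e 0)).coeff (e 1)

/-- `(Y_ℰ(a(x), x₀) b(x)) w = ι_{x,x₀}(1 / p(x + x₀, x)) · (p(x₁, x) a(x₁) b(x) w)|_{x₁ = x + x₀}`.
Variables: `0` is `x₀`, `1` is `x`. -/
def opeSeries (p : MvPolynomial (Fin 2) ℂ) (a b : VertexOperator ℂ W) (w : W) : FSeries (Fin 2) W :=
  seriesMul (iterCoeff (shiftPoly p)⁻¹) (shiftSeries (polyMul p (pairSeries a b w)))

theorem laurent_bound (f : LaurentC) : ∃ K : ℤ, ∀ j < K, f.coeff j = 0 :=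
  ⟨HahnSeries.order (Γ := ℤ) (R := ℂ) f,
    fun _ hj => HahnSeries.coeff_eq_zero_of_lt_order (Γ := ℤ) (R := ℂ) hj⟩

theorem laurent_coeff_zero (j : ℤ) : (0 : LaurentC).coeff j = 0 :=
  HahnSeries.coeff_zero (Γ := ℤ) (R := ℂ)

theorem shiftSeries_bound {F : FSeries (Fin 2) W} (hF : IsLaurent F) :
    ∃ C : ℤ, ∀ e, (e 0 < 0 ∨ e 0 + e 1 < C) → shiftSeries F e = 0 := by
  obtain ⟨N, hN⟩ := hF
  refine ⟨2 * N, fun e he => ?_⟩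
  unfold shiftSeries shiftCoeff
  refine finsum_eq_zero_of_forall_eq_zero fun m => ?_
  rcases he with he | he
  · simp [ibinom, not_le.mpr he]
  · rw [hN, smul_zero]
    by_cases h : m < N
    · exact ⟨0, by simpa using h⟩
    · exact ⟨1, by simp; omega⟩

/-- Finiteness of the sums that define the coefficients of the product of an element of
`ℂ((x))((x₀))` and `F(x + x₀, x)`. -/
theorem mul_support (g : LaurentCC) {F : FSeries (Fin 2) W}
    (hF : IsLaurent F) (i : ℤ) : ∃ M K C : ℤ, ∀ j : ℤ,
      (Function.support fun d : Fin 2 → ℤ => iterCoeff g d • shiftSeries F (![i, j] - d)) ⊆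
        Set.Icc ![M, K] ![i, j + C] := by
  obtain ⟨C, hC⟩ := shiftSeries_bound hF
  choose k hk using fun m : ℤ => laurent_bound (g.coeff m)
  obtain ⟨K, hK⟩ := ((Set.finite_Icc g.order i).image k).bddBelow
  refine ⟨g.order, K, i - C - g.order, fun j d hd => ?_⟩
  have h1 : g.order ≤ d 0 := by
    by_contra h
    exact hd (by simp [iterCoeff, HahnSeries.coeff_eq_zero_of_lt_order (not_le.mp h), laurent_coeff_zero])
  have h2 : d 0 ≤ i := by
    by_contra h
    exact hd (by beta_reduce; rw [hC _ (Or.inl (by simp; omega)), smul_zero])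
  have h3 : K ≤ d 1 := by
    refine (hK ⟨d 0, ⟨h1, h2⟩, rfl⟩).trans ?_
    by_contra h
    exact hd (by simp [iterCoeff, hk _ _ (not_le.mp h)])
  have h4 : d 1 ≤ j + (i - C - g.order) := by
    by_contra h
    exact hd (by beta_reduce; rw [hC _ (Or.inr (by simp; omega)), smul_zero])
  constructor <;> intro q <;> fin_cases q <;> simpa

theorem mul_finite (g : LaurentCC) {F : FSeries (Fin 2) W}
    (hF : IsLaurent F) (i j : ℤ) :
    (Function.support fun d : Fin 2 → ℤ => iterCoeff g d • shiftSeries F (![i, j] - d)).Finite := by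
  obtain ⟨M, K, C, h⟩ := mul_support g hF i
  exact (Set.finite_Icc _ _).subset (h j)

theorem mul_bddBelow (g : LaurentCC) {F : FSeries (Fin 2) W}
    (hF : IsLaurent F) (i : ℤ) :
    BddBelow (Function.support fun j : ℤ => seriesMul (iterCoeff g) (shiftSeries F) ![i, j]) := by
  obtain ⟨M, K, C, h⟩ := mul_support g hF i
  refine ⟨K - C, fun j hj => ?_⟩
  by_contra hlt
  apply hj
  have h' := h j
  rw [Set.Icc_eq_empty (fun hle => by have := hle 1; simp at this; omega),
    Set.subset_empty_iff, Function.support_eq_empty_iff] at h'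
  exact finsum_eq_zero_of_forall_eq_zero fun d => congrFun h' d

theorem shiftSeries_add {F G : FSeries (Fin 2) W} (hF : IsLaurent F) (hG : IsLaurent G) :
    shiftSeries (F + G) = shiftSeries F + shiftSeries G := by
  have key : ∀ {H : FSeries (Fin 2) W}, IsLaurent H → ∀ i j : ℤ,
      (Function.support fun m : ℤ => ibinom m i • H ![m, i + j - m]).Finite := by
    rintro H ⟨N, hN⟩ i j
    refine (Set.finite_Icc N (i + j - N)).subset fun m hm => ?_
    by_contra h
    refine hm ?_
    simp only [Set.mem_Icc, not_and_or, not_le] at h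
    change ibinom m i • H _ = 0
    rw [hN, smul_zero]
    rcases h with h | h
    · exact ⟨0, by simpa using h⟩
    · exact ⟨1, by simp; omega⟩
  funext e
  simp only [shiftSeries, shiftCoeff, Pi.add_apply, smul_add]
  exact finsum_add_distrib (key hF _ _) (key hG _ _)

theorem shiftSeries_smul (c : ℂ) (F : FSeries (Fin 2) W) :
    shiftSeries (c • F) = c • shiftSeries F := by
  funext e
  simp only [shiftSeries, shiftCoeff, Pi.smul_apply, smul_finsum]
  exact finsum_congr fun m => smul_comm _ _ _

theorem polyMul_pairSeries_add (p : MvPolynomial (Fin 2) ℂ) (a b : VertexOperator ℂ W) (w w' : W) :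
    polyMul p (pairSeries a b (w + w')) =
      polyMul p (pairSeries a b w) + polyMul p (pairSeries a b w') := by
  funext e
  simp only [polyMul, pairSeries, Pi.add_apply, map_add, smul_add, Finset.sum_add_distrib]

theorem polyMul_pairSeries_smul (p : MvPolynomial (Fin 2) ℂ) (a b : VertexOperator ℂ W) (c : ℂ)
    (w : W) : polyMul p (pairSeries a b (c • w)) = c • polyMul p (pairSeries a b w) := by
  funext e
  simp only [polyMul, pairSeries, Pi.smul_apply, map_smul, Finset.smul_sum, smul_comm c]

/-- The `n`-th product computed with a given polynomial `p`: the coefficient of `x₀ ^ (-n - 1)` in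
`Y_ℰ(a(x), x₀) b(x)`, an element of `Hom(W, W((x)))`. -/
def opeCoeff (p : MvPolynomial (Fin 2) ℂ) (a b : VertexOperator ℂ W) (h : PairCompat p a b)
    (n : ℤ) : VertexOperator ℂ W :=
  VertexOperator.of_coeff
    (fun j =>
      { toFun := fun w => opeSeries p a b w ![-n - 1, j]
        map_add' := fun w w' => by
          simp only [opeSeries, seriesMul, polyMul_pairSeries_add,
            shiftSeries_add (h.2 w) (h.2 w'), Pi.add_apply, smul_add]
          exact finsum_add_distrib (mul_finite _ (h.2 w) _ _) (mul_finite _ (h.2 w') _ _)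
        map_smul' := fun c w => by
          simp only [opeSeries, seriesMul, polyMul_pairSeries_smul, shiftSeries_smul,
            Pi.smul_apply, RingHom.id_apply, smul_finsum]
          exact finsum_congr fun d => smul_comm _ _ _ })
    (fun w => mul_bddBelow _ (h.2 w) _)

open Classical in
/-- `a(x)ₙ b(x)` for a quasi compatible pair `(a(x), b(x))`; the value does not depend on the
polynomial. (Set to `0` for other pairs.) -/
def nthProd (a b : VertexOperator ℂ W) (n : ℤ) : VertexOperator ℂ W :=
  if h : ∃ p, PairCompat p a b then opeCoeff h.choose a b h.choose_spec n else 0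

/-- A closed quasi compatible subspace of `Hom(W, W((x)))`. -/
def IsClosedQC (U : Submodule ℂ (VertexOperator ℂ W)) : Prop :=
  IsQuasiCompatible (U : Set (VertexOperator ℂ W)) ∧ ∀ a ∈ U, ∀ b ∈ U, ∀ n : ℤ, nthProd a b n ∈ U

/-- The closed quasi compatible subspaces that contain `S` and `1_W`. -/
def closedQCContaining (S : Set (VertexOperator ℂ W)) : Set (Submodule ℂ (VertexOperator ℂ W)) :=
  {U | IsClosedQC U ∧ S ⊆ (U : Set (VertexOperator ℂ W)) ∧ idField W ∈ U}

/-- `⟨S⟩`: the intersection of all closed quasi compatible subspaces that contain `S` and `1_W`. -/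
def generated (S : Set (VertexOperator ℂ W)) : Submodule ℂ (VertexOperator ℂ W) :=
  sInf (closedQCContaining S)

end Fields

section Algebras

variable {V W : Type*} [AddCommGroup V] [Module ℂ V] [AddCommGroup W] [Module ℂ W]

/-- Weak associativity of the triple `(u, v, w)`: for some `l ≥ 0`,
`(x₀ + x₂)^l Y_W(u, x₀ + x₂) Y_W(v, x₂) w = (x₀ + x₂)^l Y_W(Y(u, x₀) v, x₂) w`,
where powers of `x₀ + x₂` inside `Y_W(u, x₀ + x₂)` are expanded in nonnegative powers of `x₂`.
Variables: `0` is `x₀`, `1` is `x₂`. -/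
def WeakAssoc (Y : V →ₗ[ℂ] VertexOperator ℂ V) (YW : V →ₗ[ℂ] VertexOperator ℂ W)
    (u v : V) (w : W) : Prop :=
  ∃ l : ℕ,
    polyMul ((X 0 + X 1) ^ l) (fun e : Fin 2 → ℤ =>
      ∑ᶠ t : ℤ, ibinom (e 0 + t) t • pairSeries (YW u) (YW v) w ![e 0 + t, e 1 - t]) =
    polyMul ((X 0 + X 1) ^ l) (fun e : Fin 2 → ℤ =>
      HVertexOperator.coeff (YW (HVertexOperator.coeff (Y u) (e 0) v)) (e 1) w)

/-- The vacuum property `Y(𝟏, x) = 1` and the creation property `Y(v, x)𝟏 ∈ V[[x]]`,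
`lim_{x → 0} Y(v, x)𝟏 = v`. -/
structure HasVacuum (Y : V →ₗ[ℂ] VertexOperator ℂ V) (vac : V) : Prop where
  vacuum : Y vac = idField V
  creation_regular : ∀ (v : V) (n : ℤ), n < 0 → HVertexOperator.coeff (Y v) n vac = 0
  creation : ∀ v : V, HVertexOperator.coeff (Y v) 0 vac = v

/-- `(V, Y, 𝟏)` is a nonlocal vertex algebra. -/
structure IsNonlocalVA (Y : V →ₗ[ℂ] VertexOperator ℂ V) (vac : V) : Prop
    extends HasVacuum Y vac where
  weakAssoc : ∀ u v w : V, WeakAssoc Y Y u v w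

/-- `(W, Y_W)` is a module for the nonlocal vertex algebra `(V, Y, 𝟏)`. -/
structure IsVAModule (Y : V →ₗ[ℂ] VertexOperator ℂ V) (vac : V)
    (YW : V →ₗ[ℂ] VertexOperator ℂ W) : Prop where
  vacuum : YW vac = idField W
  weakAssoc : ∀ (u v : V) (w : W), WeakAssoc Y YW u v w

/-- `(V, Y, 𝟏)` is a weak quantum vertex algebra: vacuum, creation, and for all `u, v` there are
finitely many `v⁽ⁱ⁾, u⁽ⁱ⁾ ∈ V`, `fᵢ ∈ ℂ((x))` with
`x₀⁻¹δ((x₁-x₂)/x₀) Y(u,x₁)Y(v,x₂) - x₀⁻¹δ((x₂-x₁)/(-x₀)) ∑ᵢ fᵢ(-x₀) Y(v⁽ⁱ⁾,x₂)Y(u⁽ⁱ⁾,x₁)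
  = x₂⁻¹δ((x₁-x₀)/x₂) Y(Y(u,x₀)v,x₂)`.
Variables: `0, 1, 2` are `x₀, x₁, x₂`. -/
structure IsWeakQVA (Y : V →ₗ[ℂ] VertexOperator ℂ V) (vac : V) : Prop
    extends HasVacuum Y vac where
  jacobi : ∀ u v : V, ∃ (r : ℕ) (v' u' : Fin r → V) (f : Fin r → LaurentSeries ℂ), ∀ w : V,
    seriesMul (delta 0 1 2 1 (-1))
        (fun e : Fin 3 → ℤ => if e 0 = 0 then
          HVertexOperator.coeff (Y u) (e 1) (HVertexOperator.coeff (Y v) (e 2) w) else 0) -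
      seriesMul (delta 0 2 1 (-1) (-1))
        (∑ i, seriesMul (evalNeg (f i)) (fun e : Fin 3 → ℤ => if e 0 = 0 then
          HVertexOperator.coeff (Y (v' i)) (e 2) (HVertexOperator.coeff (Y (u' i)) (e 1) w)
          else 0)) =
    seriesMul (delta 2 1 0 1 (-1))
        (fun e : Fin 3 → ℤ => if e 1 = 0 then
          HVertexOperator.coeff (Y (HVertexOperator.coeff (Y u) (e 0) v)) (e 2) w else 0)

end Algebras

end Vtx

end

open MvPolynomial

noncomputable section

/-! The proof works with a form of 𝒮-locality for subspaces, `MutuallyLocal`. A power of x₁ - x₂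
carries a(x₁)b(x₂) into the span of the series φ(x₂ - x₁)(x₂ - x₁)ⁿu(x₂)v(x₁), where φ is a power
series and (x₂ - x₁)ⁿu(x₂)v(x₁)w lies in W((x₁, x₂)). In this form every infinite sum is finite in
each coefficient, because x₂ - x₁ is homogeneous of degree one and Laurent series have total degrees
bounded below. An 𝒮-local set and 1_W span such a subspace (`IsSLocal.mutuallyLocal`), since a high
power of x₂ - x₁ turns the Laurent series ψᵢ into power series.

Locality moves the first factor of a product to the right, one field at a time. This bounds the
powers of its variable, so ∏(xᵢ - xⱼ)ⁿ clears all poles and the subspace is quasi compatible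
(`MutuallyLocal.isQuasiCompatible`). As only powers of x₁ - x₂ are needed, the products aₙb are
characterized by the relation `IsOpe`, whatever polynomial was chosen to define them
(`isOpe_prodOpe`).

Closure under products is an analogue of Dong's lemma (`MutuallyLocal.nthProd_left`,
`MutuallyLocal.nthProd_right`). In a(x₀)b(x₁)c(x₂) the field c is moved to the front and x₀ is
replaced by x₀ + x₁. Then a(x₀)b(x₁) becomes the generating series of the products on both sides,
φ(x₂ - x₁ - x₀) is expanded by Taylor's formula, and the linear clearing factors are divided out by
recursion on the power of x₀. Adjoining products repeatedly gives an ascending chain whose union is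
⟨S⟩ (`IsSLocal.generated_eq`).

On ⟨S⟩, both Y(a, x₀)Y(b, x₁)c and Y(Y(a, x₀)b, x₁)c arise by substitution from a(x₀)b(x₁)c(x₂). The
factors x₀ - x₂ and x₁ - x₂ turn into monomials in the first case, while x₀ - x₁ is unchanged.
Comparing the substitutions (`substVar_braid`) shows that the second series is the operator product
expansion of the first (`isOpe_vertexMap`), and weak associativity follows. For the module W the
corresponding expansion is the definition of the products, which is why W is a module and not merely
a quasi module.

The locality relation between a and b involves only x₁ - x₀, so it survives a common translation by
x₂ and holds for Y(a, x₀) and Y(b, x₁) (`pairSeries_vertexMap_relation`). Finally, locality together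
with the expansion gives the Jacobi identity (`jacobi_of_relation`): its terms are the two
expansions of a power of x₁ - x₂, applied to one Laurent series, and their difference. -/

namespace Vtx

/-! ### Multiplication of formal series by polynomials, and bounds on exponents -/

section PolynomialAction

variable {ι κ V V' : Type*} [AddCommGroup V] [Module ℂ V] [AddCommGroup V'] [Module ℂ V']

/-- The exponent vector of the variable `x_i`. -/
def bv [DecidableEq ι] (i : ι) : ι → ℤ := Pi.single i 1

@[simp] theorem bv_self [DecidableEq ι] (i : ι) : bv i i = 1 := by simp [bv]

theorem bv_ne [DecidableEq ι] {i j : ι} (h : j ≠ i) : bv i j = 0 := by simp [bv, h]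

theorem bv_apply [DecidableEq ι] (i j : ι) : bv i j = if j = i then 1 else 0 := by
  simp [bv, Pi.single_apply]

/-- The integer exponent vector of a monomial. -/
def toExp (d : ι →₀ ℕ) : ι → ℤ := fun i => (d i : ℤ)

theorem toExp_add (d d' : ι →₀ ℕ) : toExp (d + d') = toExp d + toExp d' := by
  funext i; simp [toExp]

theorem polyMul_eq_sum (p : MvPolynomial ι ℂ) (F : FSeries ι V) (e : ι → ℤ) :
    polyMul p F e = ∑ d ∈ p.support, p.coeff d • F (e - toExp d) := rfl

theorem polyMul_eq_sum_of_subset (p : MvPolynomial ι ℂ) (F : FSeries ι V) (e : ι → ℤ)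
    {s : Finset (ι →₀ ℕ)} (hs : p.support ⊆ s) :
    polyMul p F e = ∑ d ∈ s, p.coeff d • F (e - toExp d) := by
  rw [polyMul_eq_sum]
  refine Finset.sum_subset hs fun d _ hd => ?_
  rw [notMem_support_iff.mp hd, zero_smul]

theorem polyMul_add_left (p q : MvPolynomial ι ℂ) (F : FSeries ι V) :
    polyMul (p + q) F = polyMul p F + polyMul q F := by
  classical
  funext e
  rw [Pi.add_apply, polyMul_eq_sum_of_subset (p + q) F e support_add,
    polyMul_eq_sum_of_subset p F e Finset.subset_union_left,
    polyMul_eq_sum_of_subset q F e Finset.subset_union_right, ← Finset.sum_add_distrib]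
  exact Finset.sum_congr rfl fun d _ => by rw [coeff_add, add_smul]

@[simp] theorem polyMul_zero_left (F : FSeries ι V) : polyMul 0 F = 0 := by
  funext e; simp [polyMul]

theorem polyMul_monomial (d : ι →₀ ℕ) (c : ℂ) (F : FSeries ι V) (e : ι → ℤ) :
    polyMul (monomial d c) F e = c • F (e - toExp d) := by
  classical
  rw [polyMul_eq_sum_of_subset _ F e support_monomial_subset]
  simp

/-- Multiplication of formal series by a fixed polynomial. -/
def polyMulHom (p : MvPolynomial ι ℂ) : FSeries ι V →ₗ[ℂ] FSeries ι V where
  toFun := polyMul p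
  map_add' F G := by
    funext e
    simp [polyMul, Finset.sum_add_distrib]
  map_smul' c F := by
    funext e
    simp [polyMul, Finset.smul_sum, smul_comm c]

theorem polyMul_add (p : MvPolynomial ι ℂ) (F G : FSeries ι V) :
    polyMul p (F + G) = polyMul p F + polyMul p G := (polyMulHom p).map_add F G

theorem polyMul_smul (p : MvPolynomial ι ℂ) (c : ℂ) (F : FSeries ι V) :
    polyMul p (c • F) = c • polyMul p F := (polyMulHom p).map_smul c F

@[simp] theorem polyMul_zero (p : MvPolynomial ι ℂ) : polyMul p (0 : FSeries ι V) = 0 :=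
  (polyMulHom p).map_zero

theorem polyMul_sum {s : Type*} (t : Finset s) (p : MvPolynomial ι ℂ) (F : s → FSeries ι V) :
    polyMul p (∑ i ∈ t, F i) = ∑ i ∈ t, polyMul p (F i) := map_sum (polyMulHom p) F t

theorem polyMul_mul (p q : MvPolynomial ι ℂ) (F : FSeries ι V) :
    polyMul (p * q) F = polyMul p (polyMul q F) := by
  induction p using MvPolynomial.induction_on' with
  | add p p' hp hp' => rw [add_mul, polyMul_add_left, hp, hp', polyMul_add_left]
  | monomial d c =>
    induction q using MvPolynomial.induction_on' with
    | add q q' hq hq' => rw [mul_add, polyMul_add_left, hq, hq', polyMul_add_left, polyMul_add]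
    | monomial d' c' =>
      funext e
      rw [monomial_mul, polyMul_monomial, polyMul_monomial, polyMul_monomial, toExp_add, mul_smul,
        sub_sub]

theorem polyMul_comm (p q : MvPolynomial ι ℂ) (F : FSeries ι V) :
    polyMul p (polyMul q F) = polyMul q (polyMul p F) := by
  rw [← polyMul_mul, mul_comm, polyMul_mul]

theorem polyMul_C (c : ℂ) (F : FSeries ι V) : polyMul (C c) F = c • F := by
  funext e
  rw [← monomial_zero', polyMul_monomial]
  rw [show toExp (0 : ι →₀ ℕ) = 0 from rfl, sub_zero, Pi.smul_apply]

@[simp] theorem polyMul_one (F : FSeries ι V) : polyMul 1 F = F := by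
  rw [← C_1, polyMul_C, one_smul]

theorem polyMul_C_mul (c : ℂ) (p : MvPolynomial ι ℂ) (F : FSeries ι V) :
    polyMul (C c * p) F = c • polyMul p F := by
  rw [polyMul_mul, polyMul_C]

theorem polyMul_neg_left (p : MvPolynomial ι ℂ) (F : FSeries ι V) :
    polyMul (-p) F = - polyMul p F := by
  have : -p = C (-1) * p := by simp
  rw [this, polyMul_C_mul, neg_one_smul]

theorem polyMul_sub_left (p q : MvPolynomial ι ℂ) (F : FSeries ι V) :
    polyMul (p - q) F = polyMul p F - polyMul q F := by
  rw [sub_eq_add_neg, polyMul_add_left, polyMul_neg_left, sub_eq_add_neg]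

theorem polyMul_sum_left {s : Type*} (t : Finset s) (p : s → MvPolynomial ι ℂ)
    (F : FSeries ι V) : polyMul (∑ i ∈ t, p i) F = ∑ i ∈ t, polyMul (p i) F := by
  classical
  induction t using Finset.induction_on with
  | empty => simp
  | insert a t ha ih => rw [Finset.sum_insert ha, Finset.sum_insert ha, polyMul_add_left, ih]

theorem toExp_single [DecidableEq ι] (i : ι) : toExp (Finsupp.single i 1) = bv i := by
  funext j
  simp only [toExp, bv, Finsupp.single_apply, Pi.single_apply]
  split_ifs <;> simp_all

theorem polyMul_X [DecidableEq ι] (i : ι) (F : FSeries ι V) (e : ι → ℤ) :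
    polyMul (X i) F e = F (e - bv i) := by
  rw [X, polyMul_monomial, one_smul, toExp_single]

theorem polyMul_X_pow [DecidableEq ι] (i : ι) (n : ℕ) (F : FSeries ι V) (e : ι → ℤ) :
    polyMul (X i ^ n) F e = F (e - (n : ℤ) • bv i) := by
  induction n generalizing e with
  | zero => simp
  | succ n ih =>
    rw [pow_succ', polyMul_mul, polyMul_X, ih]
    congr 1
    push_cast
    rw [add_smul, one_smul]; abel

/-- A monomial only shifts exponents. This is the cancellation that removes clearing factors once a
substitution has made them monomial. -/
theorem polyMul_X_pow_injective [DecidableEq ι] (i : ι) (n : ℕ) {F G : FSeries ι V}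
    (h : polyMul (X i ^ n) F = polyMul (X i ^ n) G) : F = G := by
  funext e
  have := congrFun h (e + (n : ℤ) • bv i)
  simpa [polyMul_X_pow] using this

theorem polyMul_map (L : V →ₗ[ℂ] V') (p : MvPolynomial ι ℂ) (F : FSeries ι V) (e : ι → ℤ) :
    polyMul p (fun e => L (F e)) e = L (polyMul p F e) := by
  simp [polyMul, map_sum]

/-- Vanishing of a series on exponents outside a set that is stable under subtraction of
exponents. -/
theorem polyMul_eq_zero {p : MvPolynomial ι ℂ} {F : FSeries ι V} {e : ι → ℤ}
    (h : ∀ d ∈ p.support, F (e - toExp d) = 0) : polyMul p F e = 0 := by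
  rw [polyMul_eq_sum]
  exact Finset.sum_eq_zero fun d hd => by rw [h d hd, smul_zero]

theorem polyMul_congr {p : MvPolynomial ι ℂ} {F G : FSeries ι V} {e : ι → ℤ}
    (h : ∀ d ∈ p.support, F (e - toExp d) = G (e - toExp d)) : polyMul p F e = polyMul p G e := by
  rw [polyMul_eq_sum, polyMul_eq_sum]
  exact Finset.sum_congr rfl fun d hd => by rw [h d hd]

/-- Pulling back series along a map of exponents that is compatible with a map of variables. -/
theorem polyMul_comp [DecidableEq ι] [DecidableEq κ] (f : κ → ι) (θ : (κ → ℤ) → (ι → ℤ))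
    (hθ : ∀ e i, θ (e - bv i) = θ e - bv (f i)) (p : MvPolynomial κ ℂ) (F : FSeries ι V) :
    (fun e => polyMul (rename f p) F (θ e)) = polyMul p (fun e => F (θ e)) := by
  induction p using MvPolynomial.induction_on generalizing F with
  | C c => funext e; simp [polyMul_C]
  | add p q hp hq =>
    rw [map_add, polyMul_add_left, polyMul_add_left, ← hp, ← hq]; rfl
  | mul_X p i hp =>
    rw [map_mul, rename_X, polyMul_mul, polyMul_mul, hp]
    congr 1
    funext e
    rw [polyMul_X, polyMul_X, hθ]

/-! ### Bounds on exponents -/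

/-- The exponents of `x_i` in `F` are at least `N`. -/
def BddAt (i : ι) (N : ℤ) (F : FSeries ι V) : Prop := ∀ e : ι → ℤ, e i < N → F e = 0

omit [Module ℂ V] in
theorem BddAt.mono {i : ι} {N M : ℤ} {F : FSeries ι V} (h : BddAt i N F) (hM : M ≤ N) :
    BddAt i M F := fun e he => h e (by omega)

theorem BddAt.polyMul {i : ι} {N : ℤ} {F : FSeries ι V} (h : BddAt i N F)
    (p : MvPolynomial ι ℂ) : BddAt i N (polyMul p F) := fun e he =>
  polyMul_eq_zero fun d _ => h _ (by simp [toExp]; omega)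

omit [Module ℂ V] in
theorem isLaurent_iff [Finite ι] {F : FSeries ι V} :
    IsLaurent F ↔ ∀ i, ∃ N, BddAt i N F := by
  classical
  cases nonempty_fintype ι
  refine ⟨fun ⟨N, hN⟩ i => ⟨N, fun e he => hN e ⟨i, he⟩⟩, fun h => ?_⟩
  choose N hN using h
  obtain ⟨M, hM⟩ := (Set.finite_range N).bddBelow
  exact ⟨M, fun e ⟨i, hi⟩ => hN i e (lt_of_lt_of_le hi (hM ⟨i, rfl⟩))⟩

theorem IsLaurent.polyMul {F : FSeries ι V} (h : IsLaurent F) (p : MvPolynomial ι ℂ) :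
    IsLaurent (polyMul p F) := by
  obtain ⟨N, hN⟩ := h
  exact ⟨N, fun e ⟨i, hi⟩ =>
    BddAt.polyMul (i := i) (N := N) (fun e he => hN e ⟨i, he⟩) p e hi⟩

omit [Module ℂ V] in
theorem IsLaurent.add {F G : FSeries ι V} (hF : IsLaurent F) (hG : IsLaurent G) :
    IsLaurent (F + G) := by
  obtain ⟨N, hN⟩ := hF
  obtain ⟨M, hM⟩ := hG
  refine ⟨min N M, fun e ⟨i, hi⟩ => ?_⟩
  rw [Pi.add_apply, hN e ⟨i, by omega⟩, hM e ⟨i, by omega⟩, add_zero]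

omit [Module ℂ V] in
theorem isLaurent_zero : IsLaurent (0 : FSeries ι V) := ⟨0, fun _ _ => rfl⟩

theorem IsLaurent.smul {F : FSeries ι V} (h : IsLaurent F) (c : ℂ) : IsLaurent (c • F) := by
  obtain ⟨N, hN⟩ := h
  exact ⟨N, fun e he => by rw [Pi.smul_apply, hN e he, smul_zero]⟩

/-- The total degree of an exponent. -/
def deg [Fintype ι] (e : ι → ℤ) : ℤ := ∑ i, e i

theorem deg_add [Fintype ι] (e e' : ι → ℤ) : deg (e + e') = deg e + deg e' := by
  simp [deg, Finset.sum_add_distrib]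

theorem deg_sub [Fintype ι] (e e' : ι → ℤ) : deg (e - e') = deg e - deg e' := by
  simp [deg]

theorem deg_smul [Fintype ι] (c : ℤ) (e : ι → ℤ) : deg (c • e) = c * deg e := by
  simp [deg, Finset.mul_sum]

@[simp] theorem deg_bv [Fintype ι] [DecidableEq ι] (i : ι) : deg (bv i) = 1 := by
  simp [deg, bv]

/-- The total degrees in `F` are at least `N`. -/
def DegBdd [Fintype ι] (N : ℤ) (F : FSeries ι V) : Prop := ∀ e : ι → ℤ, deg e < N → F e = 0

omit [Module ℂ V] in
theorem IsLaurent.degBdd [Fintype ι] {F : FSeries ι V} (h : IsLaurent F) : ∃ N, DegBdd N F := by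
  obtain ⟨N, hN⟩ := h
  refine ⟨Fintype.card ι * N, fun e he => hN e ?_⟩
  by_contra hc
  push Not at hc
  have : ∑ _i : ι, N ≤ ∑ i, e i := Finset.sum_le_sum fun i _ => hc i
  simp at this
  unfold deg at he
  omega

theorem toExp_deg [Fintype ι] (d : ι →₀ ℕ) : deg (toExp d) = (d.degree : ℤ) := by
  simp [deg, toExp, Finsupp.degree_eq_sum]

/-- The bound grows with the degree of the polynomial. Hence high powers of a linear form do not
contribute to a given coefficient. -/
theorem DegBdd.polyMul_of_isHomogeneous [Fintype ι] {F : FSeries ι V} {N : ℤ} (h : DegBdd N F)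
    {p : MvPolynomial ι ℂ} {n : ℕ} (hp : p.IsHomogeneous n) : DegBdd (N + n) (polyMul p F) := by
  intro e he
  refine polyMul_eq_zero fun d hd => h _ ?_
  have := hp (mem_support_iff.mp hd)
  rw [deg_sub, toExp_deg]
  have hw := DFunLike.congr_fun (Finsupp.degree_eq_weight_one (R := ℕ) (σ := ι)) d
  change d.degree = Finsupp.weight 1 d at hw
  omega

theorem DegBdd.polyMul [Fintype ι] {F : FSeries ι V} {N : ℤ} (h : DegBdd N F)
    (p : MvPolynomial ι ℂ) : DegBdd N (polyMul p F) := fun e he =>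
  polyMul_eq_zero fun d _ => h _ (by rw [deg_sub, toExp_deg]; omega)

end PolynomialAction

/-! ### Multiplication of formal series by power series in a linear form -/

section PowerSeriesAction

variable {ι κ V V' : Type*} [AddCommGroup V] [Module ℂ V] [AddCommGroup V'] [Module ℂ V']

/-- The product of `φ(δ)` and a formal series, for a power series `φ` and a polynomial `δ`. -/
def psMul (φ : PowerSeries ℂ) (δ : MvPolynomial ι ℂ) (F : FSeries ι V) : FSeries ι V :=
  fun e => ∑ᶠ n : ℕ, PowerSeries.coeff n φ • polyMul (δ ^ n) F e

/-- Each coefficient of `F` is affected by finitely many powers of `δ` only. -/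
def PSFinite (δ : MvPolynomial ι ℂ) (F : FSeries ι V) : Prop :=
  ∀ e, ∃ J : ℕ, ∀ n ≥ J, polyMul (δ ^ n) F e = 0

theorem psMul_eq_sum (φ : PowerSeries ℂ) {δ : MvPolynomial ι ℂ} {F : FSeries ι V} {e : ι → ℤ}
    {J : ℕ} (h : ∀ n ≥ J, polyMul (δ ^ n) F e = 0) :
    psMul φ δ F e = ∑ n ∈ Finset.range J, PowerSeries.coeff n φ • polyMul (δ ^ n) F e := by
  refine finsum_eq_sum_of_support_subset _ fun n hn => ?_
  by_contra hc
  exact hn (by simp only [Finset.coe_range, Set.mem_Iio, not_lt] at hc; simp [h n hc])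

/-- The value at `δ` of the truncation of a power series. -/
def truncAt (J : ℕ) (φ : PowerSeries ℂ) (δ : MvPolynomial ι ℂ) : MvPolynomial ι ℂ :=
  Polynomial.aeval δ (PowerSeries.trunc J φ)

theorem truncAt_eq_sum (J : ℕ) (φ : PowerSeries ℂ) (δ : MvPolynomial ι ℂ) :
    truncAt J φ δ = ∑ n ∈ Finset.range J, C (PowerSeries.coeff n φ) * δ ^ n := by
  rw [truncAt, Polynomial.aeval_def, PowerSeries.eval₂_trunc_eq_sum_range]
  rfl

/-- For one coefficient a truncation suffices. The rules for φ(δ) are reduced to those for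
polynomials in this way. -/
theorem psMul_eq_polyMul (φ : PowerSeries ℂ) {δ : MvPolynomial ι ℂ} {F : FSeries ι V} {e : ι → ℤ}
    {J : ℕ} (h : ∀ n ≥ J, polyMul (δ ^ n) F e = 0) :
    psMul φ δ F e = polyMul (truncAt J φ δ) F e := by
  rw [psMul_eq_sum φ h, truncAt_eq_sum, polyMul_sum_left, Finset.sum_apply]
  exact Finset.sum_congr rfl fun n _ => by rw [polyMul_C_mul, Pi.smul_apply]

theorem exists_bound_of_finset {α : Type*} (s : Finset α) (P : α → ℕ → Prop)
    (h : ∀ a ∈ s, ∃ J, ∀ n ≥ J, P a n) : ∃ J, ∀ a ∈ s, ∀ n ≥ J, P a n := by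
  classical
  induction s using Finset.induction_on with
  | empty => exact ⟨0, by simp⟩
  | insert a s ha ih =>
    obtain ⟨J, hJ⟩ := ih fun b hb => h b (Finset.mem_insert_of_mem hb)
    obtain ⟨K, hK⟩ := h a (Finset.mem_insert_self a s)
    refine ⟨max J K, fun b hb n hn => ?_⟩
    rcases Finset.mem_insert.mp hb with rfl | hb
    · exact hK n (le_trans (le_max_right _ _) hn)
    · exact hJ b hb n (le_trans (le_max_left _ _) hn)

theorem polyMul_psMul (φ : PowerSeries ℂ) {δ : MvPolynomial ι ℂ} {F : FSeries ι V}
    (h : PSFinite δ F) (p : MvPolynomial ι ℂ) :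
    polyMul p (psMul φ δ F) = psMul φ δ (polyMul p F) := by
  funext e
  -- The polynomial mixes finitely many coefficients, so one truncation order serves all of them.
  obtain ⟨J, hJ⟩ := exists_bound_of_finset p.support
    (fun d n => Vtx.polyMul (δ ^ n) F (e - toExp d) = 0) fun d _ => h _
  have h1 : ∀ n ≥ J, Vtx.polyMul (δ ^ n) (Vtx.polyMul p F) e = 0 := fun n hn => by
    rw [polyMul_comm]
    exact polyMul_eq_zero fun d hd => hJ d hd n hn
  rw [psMul_eq_polyMul φ h1, polyMul_comm]
  exact polyMul_congr fun d hd => psMul_eq_polyMul φ fun n hn => hJ d hd n hn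

theorem psMul_add (φ : PowerSeries ℂ) {δ : MvPolynomial ι ℂ} {F G : FSeries ι V}
    (hF : PSFinite δ F) (hG : PSFinite δ G) :
    psMul φ δ (F + G) = psMul φ δ F + psMul φ δ G := by
  funext e
  obtain ⟨J, hJ⟩ := hF e
  obtain ⟨K, hK⟩ := hG e
  have h1 : ∀ n ≥ max J K, polyMul (δ ^ n) F e = 0 := fun n hn => hJ n (by omega)
  have h2 : ∀ n ≥ max J K, polyMul (δ ^ n) G e = 0 := fun n hn => hK n (by omega)
  have h3 : ∀ n ≥ max J K, polyMul (δ ^ n) (F + G) e = 0 := fun n hn => by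
    rw [polyMul_add, Pi.add_apply, h1 n hn, h2 n hn, add_zero]
  rw [psMul_eq_polyMul φ h3, Pi.add_apply, psMul_eq_polyMul φ h1, psMul_eq_polyMul φ h2,
    polyMul_add, Pi.add_apply]

theorem psMul_smul (φ : PowerSeries ℂ) (δ : MvPolynomial ι ℂ) (c : ℂ) (F : FSeries ι V) :
    psMul φ δ (c • F) = c • psMul φ δ F := by
  funext e
  simp only [psMul, Pi.smul_apply, polyMul_smul, smul_finsum]
  exact finsum_congr fun n => smul_comm _ _ _

@[simp] theorem psMul_zero (φ : PowerSeries ℂ) (δ : MvPolynomial ι ℂ) :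
    psMul φ δ (0 : FSeries ι V) = 0 := by
  funext e; simp [psMul]

theorem psMul_C (c : ℂ) (δ : MvPolynomial ι ℂ) (F : FSeries ι V) :
    psMul (PowerSeries.C c) δ F = c • F := by
  funext e
  rw [psMul, finsum_eq_single _ 0]
  · simp
  · intro n hn
    simp [PowerSeries.coeff_C, hn]

theorem psMul_one (δ : MvPolynomial ι ℂ) (F : FSeries ι V) : psMul 1 δ F = F := by
  have := psMul_C 1 δ F
  simpa using this

theorem smul_psMul (c : ℂ) (φ : PowerSeries ℂ) (δ : MvPolynomial ι ℂ) (F : FSeries ι V) :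
    psMul (c • φ) δ F = c • psMul φ δ F := by
  funext e
  simp only [psMul, Pi.smul_apply, smul_finsum]
  exact finsum_congr fun n => by simp [mul_smul]

theorem BddAt.psMul {i : ι} {N : ℤ} {F : FSeries ι V} (h : BddAt i N F) (φ : PowerSeries ℂ)
    (δ : MvPolynomial ι ℂ) : BddAt i N (psMul φ δ F) := fun e he =>
  finsum_eq_zero_of_forall_eq_zero fun n => by rw [h.polyMul _ e he, smul_zero]

theorem IsLaurent.psMul {F : FSeries ι V} (h : IsLaurent F) (φ : PowerSeries ℂ)
    (δ : MvPolynomial ι ℂ) : IsLaurent (psMul φ δ F) := by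
  obtain ⟨N, hN⟩ := h
  exact ⟨N, fun e ⟨i, hi⟩ =>
    BddAt.psMul (i := i) (N := N) (fun e he => hN e ⟨i, he⟩) φ δ e hi⟩

section Homogeneous

variable [Fintype ι]

theorem DegBdd.polyMul_pow_eq_zero {δ : MvPolynomial ι ℂ} (hδ : δ.IsHomogeneous 1)
    {F : FSeries ι V} {N : ℤ} (h : DegBdd N F) {e : ι → ℤ} {n : ℕ} (hn : deg e - N < n) :
    Vtx.polyMul (δ ^ n) F e = 0 := by
  have h1 : (δ ^ n).IsHomogeneous n := by simpa using hδ.pow n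
  exact h.polyMul_of_isHomogeneous h1 e (by omega)

theorem DegBdd.psFinite {δ : MvPolynomial ι ℂ} (hδ : δ.IsHomogeneous 1)
    {F : FSeries ι V} {N : ℤ} (h : DegBdd N F) : PSFinite δ F := fun e =>
  ⟨(deg e - N).toNat + 1, fun n hn => h.polyMul_pow_eq_zero hδ (by omega)⟩

theorem IsLaurent.psFinite {δ : MvPolynomial ι ℂ} (hδ : δ.IsHomogeneous 1)
    {F : FSeries ι V} (h : IsLaurent F) : PSFinite δ F := by
  obtain ⟨N, hN⟩ := h.degBdd
  exact hN.psFinite hδ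

theorem DegBdd.psMul {F : FSeries ι V} {N : ℤ} (h : DegBdd N F) (φ : PowerSeries ℂ)
    (δ : MvPolynomial ι ℂ) : DegBdd N (psMul φ δ F) := fun e he =>
  finsum_eq_zero_of_forall_eq_zero fun n => by rw [h.polyMul _ e he, smul_zero]

/-- The product of the truncations and the truncation of the product agree modulo δ ^ J, and δ ^ J
annihilates all coefficients of total degree at most `deg e`. -/
theorem psMul_mul {δ : MvPolynomial ι ℂ} (hδ : δ.IsHomogeneous 1) {F : FSeries ι V} {N : ℤ}
    (h : DegBdd N F) (φ χ : PowerSeries ℂ) :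
    psMul (φ * χ) δ F = psMul φ δ (psMul χ δ F) := by
  funext e
  set J := (deg e - N).toNat + 1 with hJ
  have key : ∀ e' : ι → ℤ, deg e' ≤ deg e → ∀ n ≥ J, Vtx.polyMul (δ ^ n) F e' = 0 :=
    fun e' he' n hn => h.polyMul_pow_eq_zero hδ (by omega)
  rw [psMul_eq_polyMul (φ * χ) (key e le_rfl), psMul_eq_polyMul φ (J := J)
    (fun n hn => (h.psMul χ δ).polyMul_pow_eq_zero hδ (by omega)),
    polyMul_congr (G := polyMul (truncAt J χ δ) F)
      (fun d _ => psMul_eq_polyMul χ (key _ (by rw [deg_sub, toExp_deg]; omega))), ← polyMul_mul]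
  obtain ⟨q, hq⟩ : (Polynomial.X : Polynomial ℂ) ^ J ∣
      PowerSeries.trunc J φ * PowerSeries.trunc J χ - PowerSeries.trunc J (φ * χ) := by
    rw [Polynomial.X_pow_dvd_iff]
    intro n hn
    have h1 := congrArg (fun p => Polynomial.coeff p n)
      (PowerSeries.trunc_trunc_mul_trunc (n := J) φ χ)
    simp only [PowerSeries.coeff_trunc, hn, if_true] at h1
    rw [Polynomial.coeff_sub, PowerSeries.coeff_trunc, if_pos hn, ← h1, ← Polynomial.coe_mul,
      Polynomial.coeff_coe, sub_self]
  have h2 : truncAt J φ δ * truncAt J χ δ =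
      truncAt J (φ * χ) δ + Polynomial.aeval δ q * δ ^ J := by
    have h3 := congrArg (Polynomial.aeval δ) hq
    simp only [map_sub, map_mul, map_pow, Polynomial.aeval_X] at h3
    simp only [truncAt]
    linear_combination h3
  have h4 : Vtx.polyMul (δ ^ J) F = fun e' => Vtx.polyMul (δ ^ J) F e' := rfl
  rw [h2, polyMul_add_left, Pi.add_apply, polyMul_mul (Polynomial.aeval δ q),
    polyMul_eq_zero (p := Polynomial.aeval δ q), add_zero]
  exact fun d _ => key _ (by rw [deg_sub, toExp_deg]; omega) J le_rfl

end Homogeneous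

end PowerSeriesAction

/-! ### The substitution x_i ↦ x_i + x_j in formal series -/

section Substitution

variable {ι κ V V' : Type*} [AddCommGroup V] [Module ℂ V] [AddCommGroup V'] [Module ℂ V']
variable [DecidableEq ι] [DecidableEq κ]

/-- The substitution `x_i ↦ x_i + x_j`, expanded by the rule
`(x_i + x_j) ^ m = ∑ c, b m c x_i ^ c x_j ^ (m - c)`. -/
def substVar (b : ℤ → ℤ → ℤ) (i j : ι) (F : FSeries ι V) : FSeries ι V :=
  fun e => ∑ᶠ m : ℤ, b m (e i) • F (e + (m - e i) • (bv i - bv j))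

/-- The Pascal recursion. -/
def IsPascal (b : ℤ → ℤ → ℤ) : Prop := ∀ m c, b (m + 1) c = b m c + b m (c - 1)

/-- Finiteness of the sums that define `substVar`. -/
def SubstFinite (b : ℤ → ℤ → ℤ) (i j : ι) (F : FSeries ι V) : Prop :=
  ∀ e c, {m : ℤ | b m c ≠ 0 ∧ F (e + m • (bv i - bv j)) ≠ 0}.Finite

omit [Module ℂ V] in
theorem SubstFinite.support {b : ℤ → ℤ → ℤ} {i j : ι} {F : FSeries ι V} (h : SubstFinite b i j F)
    (e : ι → ℤ) (c k : ℤ) :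
    (Function.support fun m : ℤ => b m c • F (e + (m - k) • (bv i - bv j))).Finite := by
  refine (h (e - k • (bv i - bv j)) c).subset fun m hm => ?_
  rw [Function.mem_support] at hm
  refine ⟨fun h0 => hm (by rw [h0, zero_smul]), fun h0 => hm ?_⟩
  rw [show e + (m - k) • (bv i - bv j) = e - k • (bv i - bv j) + m • (bv i - bv j) by
    rw [sub_smul]; abel, h0, smul_zero]

theorem SubstFinite.polyMul {b : ℤ → ℤ → ℤ} {i j : ι} {F : FSeries ι V} (h : SubstFinite b i j F)
    (p : MvPolynomial ι ℂ) : SubstFinite b i j (polyMul p F) := by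
  intro e c
  refine (p.support.finite_toSet.biUnion fun d _ => h (e - toExp d) c).subset fun m hm => ?_
  simp only [Set.mem_iUnion]
  by_contra hc
  push Not at hc
  refine hm.2 (polyMul_eq_zero fun d hd => ?_)
  by_contra h0
  exact hc d hd ⟨hm.1, by rwa [show e - toExp d + m • (bv i - bv j) =
    e + m • (bv i - bv j) - toExp d by abel]⟩

omit [Module ℂ V] in
theorem substVar_add {b : ℤ → ℤ → ℤ} {i j : ι} {F G : FSeries ι V} (hF : SubstFinite b i j F)
    (hG : SubstFinite b i j G) :
    substVar b i j (F + G) = substVar b i j F + substVar b i j G := by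
  funext e
  simp only [substVar, Pi.add_apply, smul_add]
  exact finsum_add_distrib (hF.support e _ _) (hG.support e _ _)

theorem substVar_smul (b : ℤ → ℤ → ℤ) (i j : ι) (c : ℂ) (F : FSeries ι V) :
    substVar b i j (c • F) = c • substVar b i j F := by
  funext e
  simp only [substVar, Pi.smul_apply, smul_finsum]
  exact finsum_congr fun m => smul_comm _ _ _

/-- The substitution `x_i ↦ x_i + x_j` in polynomials. -/
def substPoly (i j : ι) : MvPolynomial ι ℂ →ₐ[ℂ] MvPolynomial ι ℂ :=
  bind₁ fun l => if l = i then X i + X j else X l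

@[simp] theorem substPoly_C (i j : ι) (c : ℂ) : substPoly i j (C c) = C c := by
  simp [substPoly]

theorem substPoly_X_self (i j : ι) : substPoly i j (X i) = X i + X j := by
  simp [substPoly]

theorem substPoly_X_of_ne {i j l : ι} (h : l ≠ i) : substPoly i j (X l) = X l := by
  simp [substPoly, h]

/-- Only (x_i + x_j)^(m+1) = (x_i + x_j)(x_i + x_j)^m is used, which is the Pascal recursion. The
statement therefore covers the expansions in either direction. -/
theorem substVar_polyMul {b : ℤ → ℤ → ℤ} (hb : IsPascal b) {i j : ι} (hij : i ≠ j)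
    {F : FSeries ι V} (hF : SubstFinite b i j F) (p : MvPolynomial ι ℂ) :
    substVar b i j (polyMul p F) = polyMul (substPoly i j p) (substVar b i j F) := by
  induction p using MvPolynomial.induction_on generalizing F with
  | C c => rw [substPoly_C, polyMul_C, polyMul_C, substVar_smul]
  | add p q hp hq =>
    rw [map_add, polyMul_add_left, polyMul_add_left, substVar_add (hF.polyMul p) (hF.polyMul q),
      hp hF, hq hF]
  | mul_X p l hp =>
    rw [polyMul_mul, hp (hF.polyMul _), map_mul, polyMul_mul]
    congr 1
    by_cases hl : l = i
    · subst hl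
      rw [substPoly_X_self, polyMul_add_left]
      funext e
      rw [Pi.add_apply, polyMul_X, polyMul_X]
      simp only [substVar, polyMul_X, Pi.sub_apply, bv_self, bv_ne hij, sub_zero]
      -- Both sums are written over the same line of exponents, so that the recursion can be applied
      -- termwise.
      have e1 : (∑ᶠ m : ℤ, b m (e l) • F (e + (m - e l) • (bv l - bv j) - bv l)) =
          ∑ᶠ m : ℤ, b (m + 1) (e l) • F (e - bv j + (m - e l) • (bv l - bv j)) := by
        rw [← finsum_comp_equiv (Equiv.addRight (1 : ℤ))]
        refine finsum_congr fun m => ?_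
        simp only [Equiv.coe_addRight]
        congr 2
        rw [show m + 1 - e l = (m - e l) + 1 by ring, add_smul, one_smul]
        abel
      have e2 : (∑ᶠ m : ℤ, b m (e l - 1) • F (e - bv l + (m - (e l - 1)) • (bv l - bv j))) =
          ∑ᶠ m : ℤ, b m (e l - 1) • F (e - bv j + (m - e l) • (bv l - bv j)) := by
        refine finsum_congr fun m => ?_
        congr 2
        rw [show m - (e l - 1) = (m - e l) + 1 by ring, add_smul, one_smul]
        abel
      rw [e1, e2, ← finsum_add_distrib (hF.support _ _ _) (hF.support _ _ _)]
      refine finsum_congr fun m => ?_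
      rw [hb, add_smul, add_comm]
    · rw [substPoly_X_of_ne hl]
      funext e
      rw [polyMul_X]
      simp only [substVar, polyMul_X, Pi.sub_apply, bv_ne (Ne.symm hl), sub_zero]
      refine finsum_congr fun m => ?_
      congr 2
      abel

theorem deg_line [Fintype ι] (e : ι → ℤ) (m : ℤ) (i j : ι) :
    deg (e + m • (bv i - bv j)) = deg e := by
  rw [deg_add, deg_smul, deg_sub]; simp

/-- The substitution preserves total degree, so the same truncation of φ is valid at every exponent
that contributes to a given coefficient. -/
theorem substVar_psMul [Fintype ι] {b : ℤ → ℤ → ℤ} (hb : IsPascal b) {i j : ι} (hij : i ≠ j)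
    {F : FSeries ι V} (hF : SubstFinite b i j F) {N : ℤ} (hN : DegBdd N F)
    {δ : MvPolynomial ι ℂ} (hδ : δ.IsHomogeneous 1) (φ : PowerSeries ℂ) :
    substVar b i j (psMul φ δ F) = psMul φ (substPoly i j δ) (substVar b i j F) := by
  funext e
  set J := (deg e - N).toNat + 1 with hJ
  have key : ∀ e' : ι → ℤ, deg e' = deg e → ∀ n ≥ J, polyMul (δ ^ n) F e' = 0 :=
    fun e' he' n hn => hN.polyMul_pow_eq_zero hδ (by omega)
  have key2 : ∀ n ≥ J, polyMul (substPoly i j δ ^ n) (substVar b i j F) e = 0 := by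
    intro n hn
    rw [← map_pow, ← substVar_polyMul hb hij hF]
    exact finsum_eq_zero_of_forall_eq_zero fun m => by
      rw [key _ (deg_line _ _ _ _) n hn, smul_zero]
  rw [psMul_eq_polyMul φ key2]
  have h1 : truncAt J φ (substPoly i j δ) = substPoly i j (truncAt J φ δ) := by
    rw [truncAt_eq_sum, truncAt_eq_sum, map_sum]
    exact Finset.sum_congr rfl fun n _ => by simp
  rw [h1, ← substVar_polyMul hb hij hF]
  exact finsum_congr fun m => by rw [psMul_eq_polyMul φ (key _ (deg_line _ _ _ _))]

end Substitution

/-! ### Series in few variables as part of series in more variables -/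

section Lift

variable {ι κ γ V V' : Type*} [AddCommGroup V] [Module ℂ V] [AddCommGroup V'] [Module ℂ V']
variable [DecidableEq ι] [DecidableEq κ]

/-- The series in the variables `x_i`, `i ∈ ι`, that is given by a family of series in the
variables `x_{f k}`, `k ∈ κ`, indexed by the exponents `π e` of further variables. -/
def lift (f : κ → ι) (π : (ι → ℤ) → γ) (α : γ → V →ₗ[ℂ] V') (Q : γ → FSeries κ V) : FSeries ι V' :=
  fun e => α (π e) (Q (π e) (e ∘ f))

/-- The exponents `π e` do not involve the variables `x_{f k}`. -/
structure Indep (f : κ → ι) (π : (ι → ℤ) → γ) : Prop where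
  injective : Function.Injective f
  add_smul : ∀ e k (t : ℤ), π (e + t • bv (f k)) = π e

variable {f : κ → ι} {π : (ι → ℤ) → γ}

theorem bv_comp (hf : Function.Injective f) (k : κ) : bv (f k) ∘ f = bv k := by
  funext l
  simp [bv_apply, hf.eq_iff]

omit [DecidableEq κ] in
theorem Indep.sub (h : Indep f π) (e : ι → ℤ) (k : κ) : π (e - bv (f k)) = π e := by
  have := h.add_smul e k (-1)
  rwa [neg_one_smul, ← sub_eq_add_neg] at this

omit [DecidableEq κ] in
theorem Indep.line (h : Indep f π) (e : ι → ℤ) (i j : κ) (t : ℤ) :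
    π (e + t • (bv (f i) - bv (f j))) = π e := by
  rw [smul_sub, sub_eq_add_neg, ← add_assoc, ← neg_smul, h.add_smul, h.add_smul]

theorem line_comp (hf : Function.Injective f) (e : ι → ℤ) (i j : κ) (t : ℤ) :
    (e + t • (bv (f i) - bv (f j))) ∘ f = e ∘ f + t • (bv i - bv j) := by
  rw [← bv_comp hf, ← bv_comp hf]; rfl

theorem polyMul_lift (h : Indep f π) (α : γ → V →ₗ[ℂ] V')
    (Q : γ → FSeries κ V) (p : MvPolynomial κ ℂ) :
    polyMul (rename f p) (lift f π α Q) = lift f π α fun m => polyMul p (Q m) := by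
  induction p using MvPolynomial.induction_on generalizing Q with
  | C c => funext e; simp [polyMul_C, lift]
  | add p q hp hq =>
    rw [map_add, polyMul_add_left, hp, hq]
    funext e
    simp [lift, polyMul_add_left]
  | mul_X p k hp =>
    rw [map_mul, rename_X, polyMul_mul]
    have : polyMul (X (f k)) (lift f π α Q) = lift f π α fun m => polyMul (X k) (Q m) := by
      funext e
      simp only [polyMul_X, lift, h.sub]
      congr 2
      rw [← bv_comp h.injective]; rfl
    rw [this, hp]
    simp only [polyMul_mul]

theorem PSFinite.lift (h : Indep f π) (α : γ → V →ₗ[ℂ] V')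
    {Q : γ → FSeries κ V} {δ : MvPolynomial κ ℂ} (hQ : ∀ m, PSFinite δ (Q m)) :
    PSFinite (rename f δ) (lift f π α Q) := by
  intro e
  obtain ⟨J, hJ⟩ := hQ (π e) (e ∘ f)
  refine ⟨J, fun n hn => ?_⟩
  rw [← map_pow, polyMul_lift h]
  simp [Vtx.lift, hJ n hn]

theorem psMul_lift (h : Indep f π) (α : γ → V →ₗ[ℂ] V')
    {Q : γ → FSeries κ V} {δ : MvPolynomial κ ℂ} (hQ : ∀ m, PSFinite δ (Q m))
    (φ : PowerSeries ℂ) :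
    psMul φ (rename f δ) (lift f π α Q) = lift f π α fun m => psMul φ δ (Q m) := by
  funext e
  obtain ⟨J, hJ⟩ := hQ (π e) (e ∘ f)
  have h1 : ∀ n ≥ J, polyMul (rename f δ ^ n) (lift f π α Q) e = 0 := fun n hn => by
    rw [← map_pow, polyMul_lift h]
    simp [Vtx.lift, hJ n hn]
  rw [psMul_eq_sum φ h1, lift, psMul_eq_sum φ hJ, map_sum]
  refine Finset.sum_congr rfl fun n _ => ?_
  rw [← map_pow, polyMul_lift h, map_smul]
  rfl

theorem SubstFinite.lift (h : Indep f π) (α : γ → V →ₗ[ℂ] V')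
    {b : ℤ → ℤ → ℤ} {i j : κ} {Q : γ → FSeries κ V} (hQ : ∀ m, SubstFinite b i j (Q m)) :
    SubstFinite b (f i) (f j) (lift f π α Q) := by
  intro e c
  refine (hQ (π e) (e ∘ f) c).subset fun m hm => ⟨hm.1, fun h0 => hm.2 ?_⟩
  rw [Vtx.lift, h.line, line_comp h.injective, h0, map_zero]

theorem substVar_lift (h : Indep f π) (α : γ → V →ₗ[ℂ] V')
    {b : ℤ → ℤ → ℤ} {i j : κ} {Q : γ → FSeries κ V} (hQ : ∀ m, SubstFinite b i j (Q m)) :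
    substVar b (f i) (f j) (lift f π α Q) = lift f π α fun m => substVar b i j (Q m) := by
  funext e
  simp only [substVar, lift]
  rw [← LinearMap.toAddMonoidHom_coe, AddMonoidHom.map_finsum _ ((hQ (π e)).support _ _ _)]
  refine finsum_congr fun m => ?_
  rw [map_zsmul, h.line, line_comp h.injective]
  rfl

omit [DecidableEq ι] [DecidableEq κ] in
theorem BddAt.lift_of_forall {α : γ → V →ₗ[ℂ] V'} {Q : γ → FSeries κ V} {k : κ} {N : ℤ}
    (hQ : ∀ m, BddAt k N (Q m)) : BddAt (f k) N (lift f π α Q) := fun e he => by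
  rw [lift, hQ _ _ he, map_zero]

omit [DecidableEq ι] [DecidableEq κ] in
theorem lift_add (α : γ → V →ₗ[ℂ] V') (Q Q' : γ → FSeries κ V) :
    lift f π α (fun m => Q m + Q' m) = lift f π α Q + lift f π α Q' := by
  funext e; simp [lift]

omit [DecidableEq ι] [DecidableEq κ] in
theorem lift_smul (α : γ → V →ₗ[ℂ] V') (c : ℂ) (Q : γ → FSeries κ V) :
    lift f π α (fun m => c • Q m) = c • lift f π α Q := by
  funext e; simp [lift]

omit [DecidableEq ι] [DecidableEq κ] in
theorem lift_zero (α : γ → V →ₗ[ℂ] V') : lift f π α (fun _ => (0 : FSeries κ V)) = 0 := by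
  funext e; simp [lift]

end Lift

/-! ### Binomial coefficients -/

theorem ibinom_of_neg (m : ℤ) {c : ℤ} (hc : c < 0) : ibinom m c = 0 := if_neg (by omega)

theorem ibinom_natCast (m : ℤ) (n : ℕ) : ibinom m n = Ring.choose m n := by
  simp [ibinom]

@[simp] theorem ibinom_zero (m : ℤ) : ibinom m 0 = 1 := by
  rw [show (0 : ℤ) = ((0 : ℕ) : ℤ) from rfl, ibinom_natCast, Ring.choose_zero_right]

theorem isPascal_ibinom : IsPascal ibinom := by
  intro m c
  rcases lt_trichotomy c 0 with hc | hc | hc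
  · rw [ibinom_of_neg _ hc, ibinom_of_neg _ hc, ibinom_of_neg _ (by omega), add_zero]
  · subst hc
    rw [ibinom_zero, ibinom_zero, ibinom_of_neg _ (by omega), add_zero]
  · obtain ⟨n, rfl⟩ : ∃ n : ℕ, c = n + 1 := ⟨(c - 1).toNat, by omega⟩
    rw [show (n : ℤ) + 1 - 1 = n by ring, show (n : ℤ) + 1 = ((n + 1 : ℕ) : ℤ) by push_cast; rfl,
      ibinom_natCast, ibinom_natCast, ibinom_natCast, Ring.choose_succ_succ, add_comm]

/-- These are the coefficients of the opposite expansion of (x_i + x_j)^m, in nonnegative powers of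
x_j. -/
theorem isPascal_ibinom_sub : IsPascal fun m c => ibinom m (m - c) := by
  intro m c
  have := isPascal_ibinom m (m + 1 - c)
  simp only [this]
  rw [add_comm]
  congr 2 <;> ring

theorem ibinom_natCast_natCast (m n : ℕ) : ibinom m n = (m.choose n : ℤ) := by
  rw [ibinom_natCast, Ring.choose_natCast]

/-- For nonnegative exponents the two expansions of a binomial power coincide. Weak associativity
rests on this. -/
theorem ibinom_symm {m : ℤ} (hm : 0 ≤ m) (c : ℤ) : ibinom m (m - c) = ibinom m c := by
  obtain ⟨n, rfl⟩ := Int.eq_ofNat_of_zero_le hm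
  rcases lt_or_ge c 0 with hc | hc
  · rw [ibinom_of_neg _ hc]
    obtain ⟨k, hk⟩ := Int.eq_ofNat_of_zero_le (show 0 ≤ (n : ℤ) - c by omega)
    rw [hk, ibinom_natCast_natCast, Nat.choose_eq_zero_of_lt (by omega)]; rfl
  · obtain ⟨l, rfl⟩ := Int.eq_ofNat_of_zero_le hc
    rcases le_or_gt l n with h | h
    · rw [show (n : ℤ) - l = ((n - l : ℕ) : ℤ) by omega, ibinom_natCast_natCast,
        ibinom_natCast_natCast, Nat.choose_symm h]
    · rw [ibinom_of_neg _ (by omega), ibinom_natCast_natCast, Nat.choose_eq_zero_of_lt h]; rfl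

/-! ### The substitution `x₁ = x + x₀` and operator product expansions -/

section Expansion

variable {ι V V' : Type*} [AddCommGroup V] [Module ℂ V] [AddCommGroup V'] [Module ℂ V']

omit [Module ℂ V] in
theorem substFinite_of_bound [DecidableEq ι] (b : ℤ → ℤ → ℤ) {i j : ι}
    {F : FSeries ι V}
    (h : ∀ e, ∃ A B : ℤ, ∀ m : ℤ, (m < A ∨ B < m) → F (e + m • (bv i - bv j)) = 0) :
    SubstFinite b i j F := by
  intro e c
  obtain ⟨A, B, hAB⟩ := h e
  refine (Set.finite_Icc A B).subset fun m hm => ?_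
  by_contra hc
  simp only [Set.mem_Icc, not_and_or, not_le] at hc
  exact hm.2 (hAB m hc)

theorem line_apply_left [DecidableEq ι] {i j : ι} (hij : i ≠ j) (e : ι → ℤ) (m : ℤ) :
    (e + m • (bv i - bv j)) i = e i + m := by simp [bv_ne hij]

theorem line_apply_right [DecidableEq ι] {i j : ι} (hij : i ≠ j) (e : ι → ℤ) (m : ℤ) :
    (e + m • (bv i - bv j)) j = e j - m := by simp [bv_ne hij.symm]; ring

theorem line_apply_other [DecidableEq ι] {i j l : ι} (hi : l ≠ i) (hj : l ≠ j) (e : ι → ℤ) (m : ℤ) :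
    (e + m • (bv i - bv j)) l = e l := by simp [bv_ne hi, bv_ne hj]

omit [Module ℂ V] in
theorem IsLaurent.substFinite [DecidableEq ι] (b : ℤ → ℤ → ℤ) {i j : ι} (hij : i ≠ j)
    {F : FSeries ι V} (hF : IsLaurent F) : SubstFinite b i j F := by
  obtain ⟨N, hN⟩ := hF
  refine substFinite_of_bound b fun e => ⟨N - e i, e j - N, fun m hm => ?_⟩
  rcases hm with hm | hm
  · exact hN _ ⟨i, by rw [line_apply_left hij]; omega⟩
  · exact hN _ ⟨j, by rw [line_apply_right hij]; omega⟩

omit [Module ℂ V] in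
theorem shiftSeries_eq_substVar (F : FSeries (Fin 2) V) :
    shiftSeries F = substVar ibinom 0 1 F := by
  funext e
  simp only [shiftSeries, shiftCoeff, substVar]
  refine finsum_congr fun m => ?_
  congr 2
  funext l
  fin_cases l
  · simp [bv_apply]
  · simp [bv_apply]; ring

omit [Module ℂ V] in
theorem bddAt_substVar_ibinom [DecidableEq ι] (i j : ι) (F : FSeries ι V) :
    BddAt i 0 (substVar ibinom i j F) := fun e he =>
  finsum_eq_zero_of_forall_eq_zero fun m => by rw [ibinom_of_neg _ he, zero_smul]

theorem substPoly_sub [DecidableEq ι] {i j : ι} (hij : i ≠ j) :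
    substPoly i j (X i - X j) = X i := by
  rw [map_sub, substPoly_X_self, substPoly_X_of_ne hij.symm]; ring

/-- `E(x₀, x)` is the expansion of `F(x + x₀, x)`, for a series `F(x₁, x₂)` that becomes an element
of `V((x₁, x₂))` after multiplication by a power of `x₁ - x₂`. -/
def IsOpe (F E : FSeries (Fin 2) V) : Prop :=
  ∃ N : ℕ, IsLaurent (polyMul ((X 0 - X 1) ^ N) F) ∧
    substVar ibinom 0 1 (polyMul ((X 0 - X 1) ^ N) F) = polyMul (X 0 ^ N) E

theorem substVar_diff_pow {F : FSeries (Fin 2) V} (hF : IsLaurent F) (n : ℕ) :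
    substVar ibinom 0 1 (polyMul ((X 0 - X 1) ^ n) F) =
      polyMul (X 0 ^ n) (substVar ibinom 0 1 F) := by
  rw [substVar_polyMul isPascal_ibinom (by decide) (hF.substFinite _ (by decide)), map_pow,
    substPoly_sub (by decide)]

theorem IsOpe.of_le {F E : FSeries (Fin 2) V} {N : ℕ}
    (h1 : IsLaurent (polyMul ((X 0 - X 1) ^ N) F))
    (h2 : substVar ibinom 0 1 (polyMul ((X 0 - X 1) ^ N) F) = polyMul (X 0 ^ N) E) {M : ℕ}
    (hM : N ≤ M) : IsLaurent (polyMul ((X 0 - X 1) ^ M) F) ∧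
    substVar ibinom 0 1 (polyMul ((X 0 - X 1) ^ M) F) = polyMul (X 0 ^ M) E := by
  obtain ⟨k, rfl⟩ := Nat.exists_eq_add_of_le' hM
  rw [pow_add, polyMul_mul]
  refine ⟨h1.polyMul _, ?_⟩
  rw [substVar_diff_pow h1, h2, ← polyMul_mul, pow_add]

/-- The expansion can be computed with each power of `x₁ - x₂` that clears the poles. -/
theorem IsOpe.eq_of_isLaurent {F E : FSeries (Fin 2) V} (h : IsOpe F E) {M : ℕ}
    (hM : IsLaurent (polyMul ((X 0 - X 1) ^ M) F)) :
    substVar ibinom 0 1 (polyMul ((X 0 - X 1) ^ M) F) = polyMul (X 0 ^ M) E := by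
  obtain ⟨N, h1, h2⟩ := h
  have h3 := (IsOpe.of_le h1 h2 (Nat.le_add_right N M)).2
  rw [pow_add, polyMul_mul, substVar_diff_pow hM, pow_add, polyMul_mul] at h3
  exact polyMul_X_pow_injective 0 N h3

theorem IsOpe.unique {F E E' : FSeries (Fin 2) V} (h : IsOpe F E) (h' : IsOpe F E') : E = E' := by
  obtain ⟨N, h1, h2⟩ := h
  exact polyMul_X_pow_injective 0 N (h2.symm.trans (h'.eq_of_isLaurent h1))

theorem IsOpe.add {F E F' E' : FSeries (Fin 2) V} (h : IsOpe F E) (h' : IsOpe F' E') :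
    IsOpe (F + F') (E + E') := by
  obtain ⟨N, h1, h2⟩ := h
  obtain ⟨M, h3, h4⟩ := h'
  obtain ⟨h5, h6⟩ := IsOpe.of_le h1 h2 (le_max_left N M)
  obtain ⟨h7, h8⟩ := IsOpe.of_le h3 h4 (le_max_right N M)
  refine ⟨max N M, ?_, ?_⟩
  · rw [polyMul_add]; exact h5.add h7
  · rw [polyMul_add, substVar_add (h5.substFinite _ (by decide)) (h7.substFinite _ (by decide)),
      h6, h8, polyMul_add]

theorem IsOpe.smul {F E : FSeries (Fin 2) V} (h : IsOpe F E) (c : ℂ) : IsOpe (c • F) (c • E) := by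
  obtain ⟨N, h1, h2⟩ := h
  refine ⟨N, ?_, ?_⟩
  · rw [polyMul_smul]; exact h1.smul c
  · rw [polyMul_smul, substVar_smul, h2, polyMul_smul]

theorem IsLaurent.isOpe {F : FSeries (Fin 2) V} (h : IsLaurent F) :
    IsOpe F (substVar ibinom 0 1 F) := ⟨0, by simpa using h, by simp⟩

theorem IsOpe.polyMul {F E : FSeries (Fin 2) V} (h : IsOpe F E) (p : MvPolynomial (Fin 2) ℂ) :
    IsOpe (polyMul p F) (polyMul (substPoly 0 1 p) E) := by
  obtain ⟨N, h1, h2⟩ := h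
  refine ⟨N, ?_, ?_⟩
  · rw [polyMul_comm]; exact h1.polyMul p
  · rw [polyMul_comm, substVar_polyMul isPascal_ibinom (by decide) (h1.substFinite _ (by decide)),
      h2, polyMul_comm]

theorem exists_isOpe {F : FSeries (Fin 2) V} {N : ℕ}
    (h : IsLaurent (polyMul ((X 0 - X 1) ^ N) F)) : ∃ E, IsOpe F E := by
  -- The shift of exponents is division by x₀ ^ N.
  refine ⟨fun e => substVar ibinom 0 1 (Vtx.polyMul ((X 0 - X 1) ^ N) F) (e + (N : ℤ) • bv 0),
    N, h, ?_⟩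
  funext e
  rw [polyMul_X_pow, sub_add_cancel]

theorem IsOpe.bound {F E : FSeries (Fin 2) V} (h : IsOpe F E) :
    ∃ N C : ℤ, ∀ e : Fin 2 → ℤ, (e 0 < N ∨ e 0 + e 1 < C) → E e = 0 := by
  obtain ⟨N, h1, h2⟩ := h
  obtain ⟨C, hC⟩ := shiftSeries_bound h1
  refine ⟨-N, C - N, fun e he => ?_⟩
  have h3 := congrFun h2 (e + (N : ℤ) • bv 0)
  rw [polyMul_X_pow, add_sub_cancel_right, ← shiftSeries_eq_substVar] at h3
  rw [← h3]
  refine hC _ ?_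
  simp [bv_apply]
  omega

end Expansion

/-! ### Multiplication by elements of `ℂ((x))((x₀))` -/

section Iterated

variable {V : Type*} [AddCommGroup V] [Module ℂ V]

/-- The series is an element of `V((x))((x₀))`. -/
def IsIterLaurent (E : FSeries (Fin 2) V) : Prop :=
  (∃ N, BddAt 0 N E) ∧ ∀ m : ℤ, ∃ K : ℤ, ∀ e : Fin 2 → ℤ, e 0 = m → e 1 < K → E e = 0

theorem IsIterLaurent.polyMul {E : FSeries (Fin 2) V} (h : IsIterLaurent E)
    (p : MvPolynomial (Fin 2) ℂ) : IsIterLaurent (polyMul p E) := by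
  obtain ⟨⟨N, hN⟩, h2⟩ := h
  refine ⟨⟨N, hN.polyMul p⟩, fun m => ?_⟩
  choose K hK using h2
  obtain ⟨B, hB⟩ := ((p.support.finite_toSet).image fun d => K (m - d 0) + d 1).bddBelow
  refine ⟨B, fun e he1 he2 => polyMul_eq_zero fun d hd => hK (m - d 0) _ ?_ ?_⟩
  · simp [toExp, he1]
  · have := hB ⟨d, hd, rfl⟩
    dsimp only at this
    simp [toExp]
    omega

theorem IsOpe.isIterLaurent {F E : FSeries (Fin 2) V} (h : IsOpe F E) : IsIterLaurent E := by
  obtain ⟨N, C, hb⟩ := h.bound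
  exact ⟨⟨N, fun e he => hb e (Or.inl he)⟩,
    fun m => ⟨C - m, fun e h1 h2 => hb e (Or.inr (by omega))⟩⟩

theorem iterCoeff_support_finite (h : LaurentCC) {E : FSeries (Fin 2) V} (hE : IsIterLaurent E)
    (e : Fin 2 → ℤ) : (Function.support fun d => iterCoeff h d • E (e - d)).Finite := by
  obtain ⟨⟨N, hN⟩, h2⟩ := hE
  choose K hK using h2
  choose k hk using fun m : ℤ => laurent_bound (h.coeff m)
  refine ((Set.finite_Icc h.order (e 0 - N)).biUnion fun a _ =>
    Set.finite_Icc ![a, k a] ![a, e 1 - K (e 0 - a)]).subset fun d hd => ?_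
  have h1 : h.order ≤ d 0 := by
    by_contra hc
    exact hd (by
      simp [iterCoeff, HahnSeries.coeff_eq_zero_of_lt_order (not_le.mp hc), laurent_coeff_zero])
  have h2 : d 0 ≤ e 0 - N := by
    by_contra hc
    exact hd (by beta_reduce; rw [hN _ (by simp; omega), smul_zero])
  have h3 : k (d 0) ≤ d 1 := by
    by_contra hc
    exact hd (by simp [iterCoeff, hk _ _ (not_le.mp hc)])
  have h4 : d 1 ≤ e 1 - K (e 0 - d 0) := by
    by_contra hc
    exact hd (by beta_reduce; rw [hK (e 0 - d 0) _ (by simp) (by simp; omega), smul_zero])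
  simp only [Set.mem_iUnion]
  refine ⟨d 0, ⟨h1, h2⟩, ?_⟩
  constructor <;> intro q <;> fin_cases q <;> first | exact le_rfl | simpa

theorem iterCoeff_add (g h : LaurentCC) : iterCoeff (g + h) = iterCoeff g + iterCoeff h := by
  funext e
  rfl

theorem iterCoeff_mul_single (h : LaurentCC) (d : Fin 2 → ℤ) :
    iterCoeff (h * HahnSeries.single 1 1) (d + bv 0) = iterCoeff h d := by
  simp only [iterCoeff]
  have : (d + bv 0 : Fin 2 → ℤ) 0 = d 0 + 1 := by simp
  rw [this, HahnSeries.coeff_mul_single_add, mul_one]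
  simp [bv_apply]

theorem iterCoeff_mul_C (h : LaurentCC) (f : LaurentC) (d : Fin 2 → ℤ) :
    iterCoeff (h * HahnSeries.C f) d = (h.coeff (d 0) * f).coeff (d 1) := by
  simp only [iterCoeff]
  rw [mul_comm, HahnSeries.C_mul_eq_smul, HahnSeries.coeff_smul, smul_eq_mul, mul_comm]

theorem LaurentC.coeff_mul_var (f : LaurentC) (j : ℤ) : (f * LaurentC.var).coeff (j + 1) = f.coeff j := by
  have := HahnSeries.coeff_mul_single_add (Γ := ℤ) (R := ℂ) (r := 1) (x := f) (a := j) (b := 1)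
  rw [mul_one] at this
  exact this

theorem LaurentC.coeff_mul_const (f : LaurentC) (c : ℂ) (j : ℤ) :
    (f * LaurentC.const c).coeff j = c * f.coeff j := by
  rw [mul_comm]
  have := congrArg (fun g => HahnSeries.coeff g j)
    (HahnSeries.C_mul_eq_smul (Γ := ℤ) (R := ℂ) (r := c) (x := f))
  exact this

theorem seriesMul_iterCoeff_add (g h : LaurentCC) {E : FSeries (Fin 2) V} (hE : IsIterLaurent E) :
    seriesMul (iterCoeff (g + h)) E = seriesMul (iterCoeff g) E + seriesMul (iterCoeff h) E := by
  funext e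
  simp only [seriesMul, iterCoeff_add, Pi.add_apply, add_smul]
  exact finsum_add_distrib (iterCoeff_support_finite g hE e) (iterCoeff_support_finite h hE e)

theorem seriesMul_iterCoeff_add_right (g : LaurentCC) {E E' : FSeries (Fin 2) V}
    (hE : IsIterLaurent E) (hE' : IsIterLaurent E') :
    seriesMul (iterCoeff g) (E + E') = seriesMul (iterCoeff g) E + seriesMul (iterCoeff g) E' := by
  funext e
  simp only [seriesMul, Pi.add_apply, smul_add]
  exact finsum_add_distrib (iterCoeff_support_finite g hE e) (iterCoeff_support_finite g hE' e)

theorem seriesMul_iterCoeff_X_zero (h : LaurentCC) (E : FSeries (Fin 2) V) :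
    seriesMul (iterCoeff h) (polyMul (X 0) E) =
      seriesMul (iterCoeff (h * HahnSeries.single 1 1)) E := by
  funext e
  simp only [seriesMul]
  rw [← finsum_comp_equiv (Equiv.addRight (bv (0 : Fin 2)))
    (f := fun d => iterCoeff (h * HahnSeries.single 1 1) d • E (e - d))]
  refine finsum_congr fun d => ?_
  rw [polyMul_X, Equiv.coe_addRight, iterCoeff_mul_single, sub_sub]

theorem seriesMul_iterCoeff_X_one (h : LaurentCC) (E : FSeries (Fin 2) V) :
    seriesMul (iterCoeff h) (polyMul (X 1) E) =
      seriesMul (iterCoeff (h * HahnSeries.C LaurentC.var)) E := by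
  funext e
  simp only [seriesMul]
  rw [← finsum_comp_equiv (Equiv.addRight (bv (1 : Fin 2)))
    (f := fun d => iterCoeff (h * HahnSeries.C LaurentC.var) d • E (e - d))]
  refine finsum_congr fun d => ?_
  rw [polyMul_X, Equiv.coe_addRight, iterCoeff_mul_C, sub_sub]
  beta_reduce
  have h0 : (d + bv 1 : Fin 2 → ℤ) 0 = d 0 := by simp [bv_apply]
  have h1 : (d + bv 1 : Fin 2 → ℤ) 1 = d 1 + 1 := by simp
  rw [h0, h1, LaurentC.coeff_mul_var]
  rfl

theorem seriesMul_iterCoeff_C (h : LaurentCC) (c : ℂ) (E : FSeries (Fin 2) V) :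
    seriesMul (iterCoeff h) (polyMul (C c) E) =
      seriesMul (iterCoeff (h * HahnSeries.C (LaurentC.const c))) E := by
  funext e
  simp only [seriesMul]
  refine finsum_congr fun d => ?_
  rw [polyMul_C, iterCoeff_mul_C, LaurentC.coeff_mul_const, Pi.smul_apply, smul_smul, mul_comm]
  rfl

theorem shiftPoly_mul (p q : MvPolynomial (Fin 2) ℂ) :
    shiftPoly (p * q) = shiftPoly p * shiftPoly q := eval₂_mul _ _

theorem shiftPoly_add (p q : MvPolynomial (Fin 2) ℂ) :
    shiftPoly (p + q) = shiftPoly p + shiftPoly q := eval₂_add _ _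

/-- This identifies two forms of p(x + x₀, x), as a polynomial acting on series and as an element of
the field ℂ((x))((x₀)). It lets the inverse in that field cancel the polynomial. -/
theorem seriesMul_iterCoeff_substPoly (p : MvPolynomial (Fin 2) ℂ) (h : LaurentCC)
    {E : FSeries (Fin 2) V} (hE : IsIterLaurent E) :
    seriesMul (iterCoeff h) (polyMul (substPoly 0 1 p) E) =
      seriesMul (iterCoeff (h * shiftPoly p)) E := by
  induction p using MvPolynomial.induction_on generalizing E with
  | C c => rw [substPoly_C, seriesMul_iterCoeff_C]; simp [shiftPoly]
  | add p q hp hq =>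
    rw [map_add, polyMul_add_left, seriesMul_iterCoeff_add_right _ (hE.polyMul _) (hE.polyMul _),
      hp hE, hq hE, shiftPoly_add, mul_add, seriesMul_iterCoeff_add _ _ hE]
  | mul_X p i hp =>
    rw [map_mul, polyMul_mul, hp (hE.polyMul _), shiftPoly_mul, ← mul_assoc]
    generalize h * shiftPoly p = h'
    have h01 : (1 : Fin 2) ≠ 0 := by decide
    fin_cases i
    · change seriesMul _ (polyMul (substPoly 0 1 (X 0)) E) =
        seriesMul (iterCoeff (h' * shiftPoly (X 0))) E
      rw [substPoly_X_self, polyMul_add_left,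
        seriesMul_iterCoeff_add_right _ (hE.polyMul _) (hE.polyMul _), seriesMul_iterCoeff_X_zero,
        seriesMul_iterCoeff_X_one, ← seriesMul_iterCoeff_add _ _ hE, ← mul_add]
      simp [shiftPoly, add_comm]
    · change seriesMul _ (polyMul (substPoly 0 1 (X 1)) E) =
        seriesMul (iterCoeff (h' * shiftPoly (X 1))) E
      rw [substPoly_X_of_ne h01, seriesMul_iterCoeff_X_one]
      simp [shiftPoly]

theorem iterCoeff_one (d : Fin 2 → ℤ) : iterCoeff 1 d = if d = 0 then 1 else 0 := by
  have h1 : ∀ j : ℤ, (1 : LaurentC).coeff j = if j = 0 then 1 else 0 := fun j => by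
    convert HahnSeries.coeff_one (Γ := ℤ) (R := ℂ) (a := j)
    rfl
  simp only [iterCoeff, HahnSeries.coeff_one]
  by_cases h0 : d 0 = 0
  · rw [if_pos h0, h1]
    refine if_congr ⟨fun h => ?_, fun h => by rw [h]; rfl⟩ rfl rfl
    funext l; fin_cases l <;> assumption
  · rw [if_neg h0, laurent_coeff_zero, if_neg fun h => h0 (by rw [h]; rfl)]

theorem seriesMul_iterCoeff_one (E : FSeries (Fin 2) V) : seriesMul (iterCoeff 1) E = E := by
  funext e
  rw [seriesMul, finsum_eq_single _ 0]
  · simp [iterCoeff_one]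
  · intro d hd
    simp [iterCoeff_one, hd]

theorem substPoly_injective : Function.Injective (substPoly (0 : Fin 2) 1) := by
  have h : ((bind₁ ![X 0 - X 1, X 1]).comp (substPoly (0 : Fin 2) 1)) =
      AlgHom.id ℂ (MvPolynomial (Fin 2) ℂ) := by
    refine MvPolynomial.algHom_ext fun i => ?_
    fin_cases i <;> simp [substPoly]
  intro p q hpq
  have h1 := DFunLike.congr_fun h p
  rw [AlgHom.comp_apply, hpq] at h1
  exact h1.symm.trans (DFunLike.congr_fun h q)

/-- Multiplying the series 1 by p(x + x₀, x) recovers the coefficients of this polynomial, and p ↦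
p(x + x₀, x) is injective. -/
theorem shiftPoly_ne_zero {p : MvPolynomial (Fin 2) ℂ} (hp : p ≠ 0) : shiftPoly p ≠ 0 := by
  intro h0
  apply hp
  apply substPoly_injective
  rw [map_zero]
  let E : FSeries (Fin 2) ℂ := fun e => if e = 0 then 1 else 0
  have hE : IsIterLaurent E :=
    ⟨⟨0, fun e he => if_neg fun h => by simp [h] at he⟩,
      fun m => ⟨0, fun e _ he => if_neg fun h => by simp [h] at he⟩⟩
  have h1 := seriesMul_iterCoeff_substPoly p 1 hE
  have h3 : seriesMul (iterCoeff 0) E = 0 := by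
    funext e
    refine finsum_eq_zero_of_forall_eq_zero fun d => ?_
    rw [show iterCoeff 0 d = 0 from laurent_coeff_zero _, zero_smul]
  rw [seriesMul_iterCoeff_one, one_mul, h0, h3] at h1
  ext d
  have h2 := congrFun h1 (toExp d)
  rw [polyMul_eq_sum_of_subset _ _ _ (Finset.subset_insert d _),
    Finset.sum_eq_single_of_mem d (Finset.mem_insert_self _ _)] at h2
  · simpa [E] using h2
  · intro d' _ hd'
    have : toExp d - toExp d' ≠ 0 := by
      intro hc
      apply hd'
      ext l
      have := congrFun hc l
      simp [toExp] at this
      omega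
    simp [E, this]

end Iterated

/-! ### The products of fields as coefficients of an operator product expansion -/

section Products

variable {W : Type*} [AddCommGroup W] [Module ℂ W]

/-- Independence of the polynomial: by uniqueness of expansions the substituted series is p(x + x₀,
x)E, and multiplication by the inverse of p(x + x₀, x) returns E. -/
theorem opeSeries_eq_of_isOpe {p : MvPolynomial (Fin 2) ℂ} {a b : VertexOperator ℂ W}
    (hp : PairCompat p a b) {w : W} {E : FSeries (Fin 2) W} (hE : IsOpe (pairSeries a b w) E) :
    opeSeries p a b w = E := by
  have h1 : substVar ibinom 0 1 (polyMul p (pairSeries a b w)) = polyMul (substPoly 0 1 p) E :=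
    (hp.2 w).isOpe.unique (hE.polyMul p)
  rw [opeSeries, shiftSeries_eq_substVar, h1, seriesMul_iterCoeff_substPoly _ _ hE.isIterLaurent,
    inv_mul_cancel₀ (shiftPoly_ne_zero hp.1), seriesMul_iterCoeff_one]

/-- The series `∑ₙ (aₙ b)(x) w x₀ ^ (-n-1)`. Variables: `0` is `x₀`, `1` is `x`. -/
def prodOpe (a b : VertexOperator ℂ W) (w : W) : FSeries (Fin 2) W :=
  fun e => HVertexOperator.coeff (nthProd a b (-e 0 - 1)) (e 1) w

/-- Some power of `x₁ - x₂` clears the poles of `a(x₁) b(x₂)`. -/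
def DiagCompat (a b : VertexOperator ℂ W) : Prop :=
  ∃ N : ℕ, ∀ w, IsLaurent (polyMul ((X 0 - X 1) ^ N) (pairSeries a b w))

theorem diff_ne_zero : (X 0 - X 1 : MvPolynomial (Fin 2) ℂ) ≠ 0 := by
  intro h
  have := X_injective (R := ℂ) (sub_eq_zero.mp h)
  exact absurd this (by decide)

theorem isOpe_prodOpe {a b : VertexOperator ℂ W} (h : DiagCompat a b) (w : W) :
    IsOpe (pairSeries a b w) (prodOpe a b w) := by
  obtain ⟨N, hN⟩ := h
  -- The definition of the products may choose another polynomial; the result is E in any case.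
  have hex : ∃ p, PairCompat p a b := ⟨(X 0 - X 1) ^ N, pow_ne_zero N diff_ne_zero, hN⟩
  obtain ⟨E, hE⟩ := exists_isOpe (hN w)
  have h1 := opeSeries_eq_of_isOpe hex.choose_spec hE
  have h2 : prodOpe a b w = E := by
    rw [← h1]
    funext e
    simp only [prodOpe, nthProd, dif_pos hex]
    change opeSeries hex.choose a b w ![-(-e 0 - 1) - 1, e 1] = _
    congr 1
    funext l
    fin_cases l <;> simp
  rw [h2]
  exact hE

end Products

/-! ### Families of formal series depending on a vector -/

section Families

variable {ι κ W V : Type*} [AddCommGroup V] [Module ℂ V]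

/-- Termwise multiplication of a family of series by a polynomial. -/
def famMul (p : MvPolynomial ι ℂ) : (W → FSeries ι V) →ₗ[ℂ] (W → FSeries ι V) where
  toFun Q := fun w => polyMul p (Q w)
  map_add' Q Q' := by funext w; exact polyMul_add _ _ _
  map_smul' c Q := by funext w; exact polyMul_smul _ _ _

theorem famMul_apply (p : MvPolynomial ι ℂ) (Q : W → FSeries ι V) (w : W) :
    famMul p Q w = polyMul p (Q w) := rfl

theorem famMul_mul (p q : MvPolynomial ι ℂ) (Q : W → FSeries ι V) :
    famMul (p * q) Q = famMul p (famMul q Q) := by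
  funext w; exact polyMul_mul _ _ _

theorem famMul_comm (p q : MvPolynomial ι ℂ) (Q : W → FSeries ι V) :
    famMul p (famMul q Q) = famMul q (famMul p Q) := by
  rw [← famMul_mul, mul_comm, famMul_mul]

@[simp] theorem famMul_one (Q : W → FSeries ι V) : famMul 1 Q = Q := by
  funext w; exact polyMul_one _

/-- Termwise multiplication of a family of series by `φ(δ)`. -/
def famPs (φ : PowerSeries ℂ) (δ : MvPolynomial ι ℂ) (Q : W → FSeries ι V) : W → FSeries ι V :=
  fun w => psMul φ δ (Q w)

/-- All series in the family lie in `V((x_i : i ∈ ι))`. -/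
def FamLaurent (Q : W → FSeries ι V) : Prop := ∀ w, IsLaurent (Q w)

theorem FamLaurent.famMul {Q : W → FSeries ι V} (h : FamLaurent Q) (p : MvPolynomial ι ℂ) :
    FamLaurent (famMul p Q) := fun w => (h w).polyMul p

theorem FamLaurent.famPs {Q : W → FSeries ι V} (h : FamLaurent Q) (φ : PowerSeries ℂ)
    (δ : MvPolynomial ι ℂ) : FamLaurent (famPs φ δ Q) := fun w => (h w).psMul φ δ

/-- The families spanned by `φ(δ) Q`, with `Q` in a given space of families. -/
def psSpan (δ : MvPolynomial ι ℂ) (T : Submodule ℂ (W → FSeries ι V)) :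
    Submodule ℂ (W → FSeries ι V) :=
  Submodule.span ℂ {Q | ∃ φ, ∃ t ∈ T, Q = famPs φ δ t}

theorem famPs_mem_psSpan {δ : MvPolynomial ι ℂ} {T : Submodule ℂ (W → FSeries ι V)}
    (φ : PowerSeries ℂ) {t : W → FSeries ι V} (ht : t ∈ T) : famPs φ δ t ∈ psSpan δ T :=
  Submodule.subset_span ⟨φ, t, ht, rfl⟩

theorem le_psSpan (δ : MvPolynomial ι ℂ) (T : Submodule ℂ (W → FSeries ι V)) :
    T ≤ psSpan δ T := fun t ht => by
  have := famPs_mem_psSpan (δ := δ) 1 ht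
  rwa [show famPs 1 δ t = t from funext fun w => psMul_one _ _] at this

theorem psSpan_mono (δ : MvPolynomial ι ℂ) {T T' : Submodule ℂ (W → FSeries ι V)} (h : T ≤ T') :
    psSpan δ T ≤ psSpan δ T' :=
  Submodule.span_mono fun _ ⟨φ, t, ht, hQ⟩ => ⟨φ, t, h ht, hQ⟩

theorem famLaurent_of_mem_span {G : Set (W → FSeries ι V)} (hG : ∀ Q ∈ G, FamLaurent Q)
    {Q : W → FSeries ι V} (hQ : Q ∈ Submodule.span ℂ G) : FamLaurent Q := by
  induction hQ using Submodule.span_induction with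
  | mem Q h => exact hG Q h
  | zero => exact fun w => isLaurent_zero
  | add Q Q' _ _ h h' => exact fun w => (h w).add (h' w)
  | smul c Q _ h => exact fun w => (h w).smul c

theorem famLaurent_psSpan {δ : MvPolynomial ι ℂ} {T : Submodule ℂ (W → FSeries ι V)}
    (hT : ∀ t ∈ T, FamLaurent t) {Q : W → FSeries ι V} (hQ : Q ∈ psSpan δ T) : FamLaurent Q := by
  refine famLaurent_of_mem_span ?_ hQ
  rintro Q ⟨φ, t, ht, rfl⟩
  exact (hT t ht).famPs φ δ

section Homogeneous

variable [Fintype ι]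

theorem famPs_add {δ : MvPolynomial ι ℂ} (hδ : δ.IsHomogeneous 1) (φ : PowerSeries ℂ)
    {Q Q' : W → FSeries ι V} (h : FamLaurent Q) (h' : FamLaurent Q') :
    famPs φ δ (Q + Q') = famPs φ δ Q + famPs φ δ Q' :=
  funext fun w => psMul_add φ ((h w).psFinite hδ) ((h' w).psFinite hδ)

omit [Fintype ι] in
theorem famPs_smul (δ : MvPolynomial ι ℂ) (φ : PowerSeries ℂ) (c : ℂ) (Q : W → FSeries ι V) :
    famPs φ δ (c • Q) = c • famPs φ δ Q := funext fun w => psMul_smul φ δ c (Q w)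

theorem famMul_famPs {δ : MvPolynomial ι ℂ} (hδ : δ.IsHomogeneous 1) (φ : PowerSeries ℂ)
    {Q : W → FSeries ι V} (h : FamLaurent Q) (p : MvPolynomial ι ℂ) :
    famMul p (famPs φ δ Q) = famPs φ δ (famMul p Q) :=
  funext fun w => polyMul_psMul φ ((h w).psFinite hδ) p

theorem famPs_famPs {δ : MvPolynomial ι ℂ} (hδ : δ.IsHomogeneous 1) (φ χ : PowerSeries ℂ)
    {Q : W → FSeries ι V} (h : FamLaurent Q) :
    famPs φ δ (famPs χ δ Q) = famPs (φ * χ) δ Q := funext fun w => by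
  obtain ⟨N, hN⟩ := (h w).degBdd
  exact (psMul_mul hδ hN φ χ).symm

theorem famMul_mem_psSpan {δ : MvPolynomial ι ℂ} (hδ : δ.IsHomogeneous 1)
    {T : Submodule ℂ (W → FSeries ι V)} (hT : ∀ t ∈ T, FamLaurent t) {p : MvPolynomial ι ℂ}
    (hp : ∀ t ∈ T, famMul p t ∈ T) {Q : W → FSeries ι V} (hQ : Q ∈ psSpan δ T) :
    famMul p Q ∈ psSpan δ T := by
  induction hQ using Submodule.span_induction with
  | mem Q h =>
    obtain ⟨φ, t, ht, rfl⟩ := h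
    rw [famMul_famPs hδ φ (hT t ht)]
    exact famPs_mem_psSpan φ (hp t ht)
  | zero => rw [map_zero]; exact zero_mem _
  | add Q Q' _ _ h h' => rw [map_add]; exact add_mem h h'
  | smul c Q _ h => rw [map_smul]; exact Submodule.smul_mem _ c h

/-- To prove a statement about `φ(δ) Q` for all `Q` in a span of Laurent families, consider the
generators. -/
theorem famPs_mem_of_span {δ : MvPolynomial ι ℂ} (hδ : δ.IsHomogeneous 1) (φ : PowerSeries ℂ)
    {G : Set (W → FSeries ι V)} (hG : ∀ Q ∈ G, FamLaurent Q)
    {T : Submodule ℂ (W → FSeries ι V)} (h : ∀ Q ∈ G, famPs φ δ Q ∈ T) {Q : W → FSeries ι V}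
    (hQ : Q ∈ Submodule.span ℂ G) : famPs φ δ Q ∈ T := by
  induction hQ using Submodule.span_induction with
  | mem Q hQ => exact h Q hQ
  | zero =>
    rw [show famPs φ δ (0 : W → FSeries ι V) = 0 from funext fun w => psMul_zero _ _]
    exact zero_mem _
  | add Q Q' hQ hQ' h h' =>
    rw [famPs_add hδ φ (famLaurent_of_mem_span hG hQ) (famLaurent_of_mem_span hG hQ')]
    exact add_mem h h'
  | smul c Q _ h => rw [famPs_smul]; exact Submodule.smul_mem _ c h

theorem famPs_mem_psSpan_of_mem {δ : MvPolynomial ι ℂ} (hδ : δ.IsHomogeneous 1)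
    {T : Submodule ℂ (W → FSeries ι V)} (hT : ∀ t ∈ T, FamLaurent t) (χ : PowerSeries ℂ)
    {Q : W → FSeries ι V} (hQ : Q ∈ psSpan δ T) : famPs χ δ Q ∈ psSpan δ T := by
  refine famPs_mem_of_span hδ χ ?_ ?_ hQ
  · rintro Q ⟨φ, t, ht, rfl⟩
    exact (hT t ht).famPs φ δ
  · rintro Q ⟨φ, t, ht, rfl⟩
    rw [famPs_famPs hδ χ φ (hT t ht)]
    exact famPs_mem_psSpan _ ht

end Homogeneous

/-- The monoid generated by the differences `x_i - x_j`, `i ≠ j`. -/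
def diffMonoid (ι : Type*) : Submonoid (MvPolynomial ι ℂ) :=
  Submonoid.closure {p | ∃ i j, i ≠ j ∧ p = X i - X j}

theorem diff_mem {i j : ι} (h : i ≠ j) : (X i - X j : MvPolynomial ι ℂ) ∈ diffMonoid ι :=
  Submonoid.subset_closure ⟨i, j, h, rfl⟩

/-- The space of families is stable under multiplication by the differences of variables. -/
def DiffClosed (T : Submodule ℂ (W → FSeries ι V)) : Prop :=
  ∀ p ∈ diffMonoid ι, ∀ Q ∈ T, famMul p Q ∈ T

theorem diffClosed_span {G : Set (W → FSeries ι V)}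
    (h : ∀ p ∈ diffMonoid ι, ∀ Q ∈ G, famMul p Q ∈ Submodule.span ℂ G) :
    DiffClosed (Submodule.span ℂ G) := by
  intro p hp Q hQ
  induction hQ using Submodule.span_induction with
  | mem Q hQ => exact h p hp Q hQ
  | zero => rw [map_zero]; exact zero_mem _
  | add Q Q' _ _ h h' => rw [map_add]; exact add_mem h h'
  | smul c Q _ h => rw [map_smul]; exact Submodule.smul_mem _ c h

theorem DiffClosed.psSpan [Fintype ι] {δ : MvPolynomial ι ℂ} (hδ : δ.IsHomogeneous 1)
    {T : Submodule ℂ (W → FSeries ι V)} (hT : ∀ t ∈ T, FamLaurent t) (h : DiffClosed T) :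
    DiffClosed (psSpan δ T) := fun p hp _ hQ => famMul_mem_psSpan hδ hT (h p hp) hQ

theorem isHomogeneous_diff (i j : ι) : (X i - X j : MvPolynomial ι ℂ).IsHomogeneous 1 :=
  (isHomogeneous_X ℂ i).sub (isHomogeneous_X ℂ j)

/-- Families whose poles are cleared by a power of `x₁ - x₂`. -/
def diagFam (W V : Type*) [AddCommGroup V] [Module ℂ V] :
    Submodule ℂ (W → FSeries (Fin 2) V) where
  carrier := {Q | ∃ N : ℕ, FamLaurent (famMul ((X 0 - X 1) ^ N) Q)}
  zero_mem' := ⟨0, fun w => by simpa [famMul_apply] using isLaurent_zero⟩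
  add_mem' := by
    rintro Q Q' ⟨N, hN⟩ ⟨M, hM⟩
    refine ⟨N + M, fun w => ?_⟩
    rw [map_add]
    refine IsLaurent.add ?_ ?_
    · rw [add_comm, pow_add, famMul_mul]; exact hN.famMul _ w
    · rw [pow_add, famMul_mul]; exact hM.famMul _ w
  smul_mem' := by
    rintro c Q ⟨N, hN⟩
    exact ⟨N, fun w => by rw [map_smul]; exact (hN w).smul c⟩

/-- A space of families in two variables that is stable under multiplication and, as far as
possible, division by `x₁ - x₂`. -/
structure DiagStable (R : Submodule ℂ (W → FSeries (Fin 2) V)) : Prop where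
  mul : ∀ Q ∈ R, famMul (X 0 - X 1) Q ∈ R
  div : ∀ Q, famMul (X 0 - X 1) Q ∈ R → Q ∈ R

theorem diagStable_diagFam : DiagStable (diagFam W V) where
  mul := by
    rintro Q ⟨N, hN⟩
    exact ⟨N, by rw [famMul_comm]; exact hN.famMul _⟩
  div := by
    rintro Q ⟨N, hN⟩
    exact ⟨N + 1, by rw [pow_succ, famMul_mul]; exact hN⟩

end Families

/-! ### Locality of subspaces of fields -/

section Fields

variable {W : Type*} [AddCommGroup W] [Module ℂ W]

theorem coeff_lt_bound (a : VertexOperator ℂ W) (w : W) :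
    ∃ N : ℤ, ∀ n < N, HVertexOperator.coeff a n w = 0 :=
  ⟨_, fun n hn => VertexOperator.coeff_eq_zero_of_lt_order a n w hn⟩

theorem vertexOperator_ext {a b : VertexOperator ℂ W}
    (h : ∀ n w, HVertexOperator.coeff a n w = HVertexOperator.coeff b n w) : a = b :=
  HVertexOperator.coeff_inj (funext fun n => LinearMap.ext fun w => h n w)

theorem pairSeries_add_left (a a' b : VertexOperator ℂ W) :
    pairSeries (a + a') b = pairSeries a b + pairSeries a' b := by
  funext w e; simp [pairSeries]

theorem pairSeries_smul_left (c : ℂ) (a b : VertexOperator ℂ W) :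
    pairSeries (c • a) b = c • pairSeries a b := by
  funext w e; simp [pairSeries]

theorem pairSeries_zero_left (b : VertexOperator ℂ W) : pairSeries 0 b = 0 := by
  funext w e; simp [pairSeries]

theorem pairSeries_add_right (a b b' : VertexOperator ℂ W) :
    pairSeries a (b + b') = pairSeries a b + pairSeries a b' := by
  funext w e; simp [pairSeries]

theorem pairSeries_smul_right (c : ℂ) (a b : VertexOperator ℂ W) :
    pairSeries a (c • b) = c • pairSeries a b := by
  funext w e; simp [pairSeries]

theorem pairSeries_zero_right (a : VertexOperator ℂ W) : pairSeries a 0 = 0 := by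
  funext w e; simp [pairSeries]

theorem diagCompat_iff {a b : VertexOperator ℂ W} :
    DiagCompat a b ↔ pairSeries a b ∈ diagFam W W := Iff.rfl

variable (A B : Submodule ℂ (VertexOperator ℂ W))

/-- The span of the families `(x₂ - x₁)ⁿ u(x₂) v(x₁) w ∈ W((x₁, x₂))` with `u ∈ B`, `v ∈ A`. -/
def swapBase : Submodule ℂ (W → FSeries (Fin 2) W) :=
  Submodule.span ℂ {Q | ∃ n : ℕ, ∃ u ∈ B, ∃ v ∈ A,
    FamLaurent (famMul ((X 1 - X 0) ^ n) (pairSeriesSwap u v)) ∧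
    Q = famMul ((X 1 - X 0) ^ n) (pairSeriesSwap u v)}

/-- The span of the families `φ(x₂ - x₁) Q` with `Q` in `swapBase A B`. -/
def swapSpan : Submodule ℂ (W → FSeries (Fin 2) W) := psSpan (X 1 - X 0) (swapBase A B)

variable {A B}

theorem famLaurent_swapBase {Q : W → FSeries (Fin 2) W} (h : Q ∈ swapBase A B) : FamLaurent Q := by
  refine famLaurent_of_mem_span ?_ h
  rintro Q ⟨n, u, _, v, _, hL, rfl⟩
  exact hL

theorem famLaurent_swapSpan {Q : W → FSeries (Fin 2) W} (h : Q ∈ swapSpan A B) : FamLaurent Q :=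
  famLaurent_psSpan (fun _ => famLaurent_swapBase) h

theorem swapBase_mono {A' B' : Submodule ℂ (VertexOperator ℂ W)} (hA : A ≤ A') (hB : B ≤ B') :
    swapBase A B ≤ swapBase A' B' :=
  Submodule.span_mono fun _ ⟨n, u, hu, v, hv, h⟩ => ⟨n, u, hB hu, v, hA hv, h⟩

theorem swapSpan_mono {A' B' : Submodule ℂ (VertexOperator ℂ W)} (hA : A ≤ A') (hB : B ≤ B') :
    swapSpan A B ≤ swapSpan A' B' := psSpan_mono _ (swapBase_mono hA hB)

theorem famMul_swapBase {Q : W → FSeries (Fin 2) W} (h : Q ∈ swapBase A B) :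
    famMul (X 1 - X 0) Q ∈ swapBase A B := by
  induction h using Submodule.span_induction with
  | mem Q hQ =>
    obtain ⟨n, u, hu, v, hv, hL, rfl⟩ := hQ
    have h1 : famMul (X 1 - X 0) (famMul ((X 1 - X 0) ^ n) (pairSeriesSwap u v)) =
        famMul ((X 1 - X 0) ^ (n + 1)) (pairSeriesSwap u v) := by rw [pow_succ', famMul_mul]
    exact Submodule.subset_span ⟨n + 1, u, hu, v, hv, h1 ▸ hL.famMul _, h1⟩
  | zero => rw [map_zero]; exact zero_mem _
  | add Q Q' _ _ h h' => rw [map_add]; exact add_mem h h'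
  | smul c Q _ h => rw [map_smul]; exact Submodule.smul_mem _ c h

omit [AddCommGroup W] [Module ℂ W] in
theorem famMul_sub_comm {ι V : Type*} [AddCommGroup V] [Module ℂ V] (i j : ι)
    (Q : W → FSeries ι V) : famMul (X i - X j) Q = - famMul (X j - X i) Q := by
  funext w
  rw [famMul_apply, Pi.neg_apply, famMul_apply, ← polyMul_neg_left, neg_sub]

theorem famMul_swapSpan {Q : W → FSeries (Fin 2) W} (h : Q ∈ swapSpan A B) :
    famMul (X 0 - X 1) Q ∈ swapSpan A B := by
  rw [famMul_sub_comm]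
  exact neg_mem (famMul_mem_psSpan (isHomogeneous_diff _ _) (fun _ => famLaurent_swapBase)
    (fun _ => famMul_swapBase) h)

theorem famMul_pow_swapSpan {Q : W → FSeries (Fin 2) W} (h : Q ∈ swapSpan A B) (n : ℕ) :
    famMul ((X 0 - X 1) ^ n) Q ∈ swapSpan A B := by
  induction n with
  | zero => simpa using h
  | succ n ih => rw [pow_succ', famMul_mul]; exact famMul_swapSpan ih

variable (A B) in
/-- The families that lie in `swapSpan A B` after multiplication by a power of `x₁ - x₂`. -/
def swapFam : Submodule ℂ (W → FSeries (Fin 2) W) where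
  carrier := {Q | ∃ N : ℕ, famMul ((X 0 - X 1) ^ N) Q ∈ swapSpan A B}
  zero_mem' := ⟨0, by rw [map_zero]; exact zero_mem _⟩
  add_mem' := by
    rintro Q Q' ⟨N, hN⟩ ⟨M, hM⟩
    refine ⟨N + M, ?_⟩
    rw [map_add]
    refine add_mem ?_ ?_
    · rw [add_comm, pow_add, famMul_mul]; exact famMul_pow_swapSpan hN _
    · rw [pow_add, famMul_mul]; exact famMul_pow_swapSpan hM _
  smul_mem' := by
    rintro c Q ⟨N, hN⟩
    exact ⟨N, by rw [map_smul]; exact Submodule.smul_mem _ c hN⟩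

theorem swapFam_mono {A' B' : Submodule ℂ (VertexOperator ℂ W)} (hA : A ≤ A') (hB : B ≤ B') :
    swapFam A B ≤ swapFam A' B' := fun _ ⟨N, hN⟩ => ⟨N, swapSpan_mono hA hB hN⟩

theorem swapFam_le_diagFam : swapFam A B ≤ diagFam W W := fun _ ⟨N, hN⟩ =>
  ⟨N, famLaurent_swapSpan hN⟩

theorem diagStable_swapFam : DiagStable (swapFam A B) where
  mul := by
    rintro Q ⟨N, hN⟩
    exact ⟨N, by rw [famMul_comm]; exact famMul_swapSpan hN⟩
  div := by
    rintro Q ⟨N, hN⟩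
    exact ⟨N + 1, by rw [pow_succ, famMul_mul]; exact hN⟩

/-- The Laurent condition makes φ(x₂ - x₁)Q meaningful before the clearing factor is applied. This
stability absorbs Taylor coefficients in Dong's lemma. -/
theorem famPs_mem_swapFam {Q : W → FSeries (Fin 2) W} (hL : FamLaurent Q) (hQ : Q ∈ swapFam A B)
    (φ : PowerSeries ℂ) : famPs φ (X 1 - X 0) Q ∈ swapFam A B := by
  obtain ⟨N, hN⟩ := hQ
  refine ⟨N, ?_⟩
  rw [famMul_famPs (isHomogeneous_diff _ _) φ hL]
  exact famPs_mem_psSpan_of_mem (isHomogeneous_diff _ _) (fun _ => famLaurent_swapBase) φ hN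

theorem pairSeriesSwap_mem_swapFam {u v : VertexOperator ℂ W} (hu : u ∈ B) (hv : v ∈ A)
    (h : pairSeriesSwap u v ∈ diagFam W W) : pairSeriesSwap u v ∈ swapFam A B := by
  obtain ⟨N, hN⟩ := h
  refine ⟨N, ?_⟩
  have h1 : famMul ((X 0 - X 1) ^ N) (pairSeriesSwap u v) =
      (-1 : ℂ) ^ N • famMul ((X 1 - X 0) ^ N) (pairSeriesSwap u v) := by
    funext w
    rw [Pi.smul_apply, famMul_apply, famMul_apply, ← polyMul_C_mul, map_pow, ← mul_pow]
    congr 2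
    simp
  have h2 : famMul ((X 1 - X 0) ^ N) (pairSeriesSwap u v) =
      (-1 : ℂ) ^ N • famMul ((X 0 - X 1) ^ N) (pairSeriesSwap u v) := by
    rw [h1, smul_smul, ← mul_pow]; simp
  rw [h1]
  refine Submodule.smul_mem _ _ (le_psSpan _ _ (Submodule.subset_span ⟨N, u, hu, v, hv, ?_, rfl⟩))
  rw [h2]
  exact fun w => (hN w).smul _

/-- `𝒮`-locality of all pairs in `A × B`, with the swapped fields again in `B` and `A`. -/
def MutuallyLocal (A B : Submodule ℂ (VertexOperator ℂ W)) : Prop :=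
  ∀ a ∈ A, ∀ b ∈ B, pairSeries a b ∈ swapFam A B

theorem MutuallyLocal.diagCompat (h : MutuallyLocal A B) {a b : VertexOperator ℂ W} (ha : a ∈ A)
    (hb : b ∈ B) : DiagCompat a b := diagCompat_iff.mpr (swapFam_le_diagFam (h a ha b hb))

end Fields

/-! ### Quasi compatibility of products of arbitrarily many fields -/

section Sequences

variable {W : Type*} [AddCommGroup W] [Module ℂ W] {A B : Submodule ℂ (VertexOperator ℂ W)}

theorem prodSeries_cons {r : ℕ} (a : VertexOperator ℂ W) (b : Fin r → VertexOperator ℂ W) (w : W)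
    (e : Fin (r + 1) → ℤ) : prodSeries (Fin.cons a b : Fin (r + 1) → VertexOperator ℂ W) w e =
      HVertexOperator.coeff a (e 0) (prodSeries b w (e ∘ Fin.succ)) := by
  simp [prodSeries, List.ofFn_succ]

/-- The series `v(x₀) c₁(x₁) ⋯ c_r(x_r) w` has bounded poles in `x₀` after multiplication by a
power of `∏ᵢ (x₀ - xᵢ)`. -/
def ClearsFirst {r : ℕ} (v : VertexOperator ℂ W) (c : Fin r → VertexOperator ℂ W) : Prop :=
  ∃ n : ℕ, ∀ w, ∃ N, BddAt 0 N (polyMul (∏ i : Fin r, (X 0 - X i.succ) ^ n)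
    (prodSeries (Fin.cons v c : Fin (r + 1) → VertexOperator ℂ W) w))

theorem clearsFirst_zero (v : VertexOperator ℂ W) (c : Fin 0 → VertexOperator ℂ W) :
    ClearsFirst v c := by
  refine ⟨0, fun w => ?_⟩
  obtain ⟨N, hN⟩ := coeff_lt_bound v w
  refine ⟨N, fun e he => ?_⟩
  simp only [Finset.univ_eq_empty, Finset.prod_empty, polyMul_one, prodSeries_cons]
  have : prodSeries c w (e ∘ Fin.succ) = w := by simp [prodSeries]
  rw [this, hN _ he]

theorem indep_zero_one (r : ℕ) : Indep (![0, 1] : Fin 2 → Fin (r + 2))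
    (fun (e : Fin (r + 2) → ℤ) (i : Fin r) => e i.succ.succ) where
  injective := by
    intro i j; fin_cases i <;> fin_cases j <;> simp
  add_smul e k t := by
    funext i
    have : bv ((![0, 1] : Fin 2 → Fin (r + 2)) k) i.succ.succ = 0 := by
      refine bv_ne ?_
      fin_cases k
      · exact Fin.succ_ne_zero _
      · exact fun h => Fin.succ_ne_zero i (Fin.succ_injective _ h)
    simp [this]

theorem indep_succAbove {r : ℕ} (g : Fin (r + 1)) :
    Indep g.succAbove (fun e : Fin (r + 1) → ℤ => e g) where
  injective := Fin.succAbove_right_injective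
  add_smul e k t := by simp [bv_ne (Fin.succAbove_ne g k).symm]

/-- The induction step for `ClearsFirst`, with the power of `x₀ - x₁` under control. -/
theorem clearsFirst_step {r : ℕ} {c : Fin r → VertexOperator ℂ W}
    (hc : ∀ v ∈ A, ClearsFirst v c) {Q : W → FSeries (Fin 2) W} (hQ : Q ∈ swapSpan A B) :
    ∃ n : ℕ, ∀ w, ∃ N, BddAt 0 N (polyMul (∏ i : Fin r, (X 0 - X i.succ.succ) ^ n)
      (lift (![0, 1] : Fin 2 → Fin (r + 2)) (fun e i => e i.succ.succ) (fun _ => LinearMap.id)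
        fun m => Q (prodSeries c w m))) := by
  have hind := indep_zero_one r
  have hadd : ∀ Q Q' : W → FSeries (Fin 2) W,
      (∃ n : ℕ, ∀ w, ∃ N, BddAt 0 N (polyMul (∏ i : Fin r, (X 0 - X i.succ.succ) ^ n)
      (lift (![0, 1] : Fin 2 → Fin (r + 2)) (fun e i => e i.succ.succ) (fun _ => LinearMap.id)
        fun m => Q (prodSeries c w m)))) →
      (∃ n : ℕ, ∀ w, ∃ N, BddAt 0 N (polyMul (∏ i : Fin r, (X 0 - X i.succ.succ) ^ n)
      (lift (![0, 1] : Fin 2 → Fin (r + 2)) (fun e i => e i.succ.succ) (fun _ => LinearMap.id)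
        fun m => Q' (prodSeries c w m)))) →
      (∃ n : ℕ, ∀ w, ∃ N, BddAt 0 N (polyMul (∏ i : Fin r, (X 0 - X i.succ.succ) ^ n)
      (lift (![0, 1] : Fin 2 → Fin (r + 2)) (fun e i => e i.succ.succ) (fun _ => LinearMap.id)
        fun m => (Q + Q') (prodSeries c w m)))) := by
    rintro Q Q' ⟨n, hn⟩ ⟨n', hn'⟩
    refine ⟨n + n', fun w => ?_⟩
    obtain ⟨N, hN⟩ := hn w
    obtain ⟨N', hN'⟩ := hn' w
    refine ⟨min N N', ?_⟩
    simp only [Pi.add_apply]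
    rw [lift_add, polyMul_add]
    have h1 : (∏ i : Fin r, (X 0 - X i.succ.succ : MvPolynomial (Fin (r + 2)) ℂ) ^ (n + n')) =
        (∏ i : Fin r, (X 0 - X i.succ.succ) ^ n) * ∏ i : Fin r, (X 0 - X i.succ.succ) ^ n' := by
      rw [← Finset.prod_mul_distrib]
      exact Finset.prod_congr rfl fun i _ => pow_add _ _ _
    intro e he
    rw [Pi.add_apply, h1, polyMul_mul, polyMul_comm, hN.polyMul _ e (by omega), polyMul_mul,
      hN'.polyMul _ e (by omega), add_zero]
  have hsmul : ∀ (a : ℂ) (Q : W → FSeries (Fin 2) W),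
      (∃ n : ℕ, ∀ w, ∃ N, BddAt 0 N (polyMul (∏ i : Fin r, (X 0 - X i.succ.succ) ^ n)
      (lift (![0, 1] : Fin 2 → Fin (r + 2)) (fun e i => e i.succ.succ) (fun _ => LinearMap.id)
        fun m => Q (prodSeries c w m)))) →
      (∃ n : ℕ, ∀ w, ∃ N, BddAt 0 N (polyMul (∏ i : Fin r, (X 0 - X i.succ.succ) ^ n)
      (lift (![0, 1] : Fin 2 → Fin (r + 2)) (fun e i => e i.succ.succ) (fun _ => LinearMap.id)
        fun m => (a • Q) (prodSeries c w m)))) := by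
    rintro a Q ⟨n, hn⟩
    refine ⟨n, fun w => ?_⟩
    obtain ⟨N, hN⟩ := hn w
    refine ⟨N, fun e he => ?_⟩
    simp only [Pi.smul_apply]
    rw [lift_smul, polyMul_smul, Pi.smul_apply, hN e he, smul_zero]
  have hzero : ∃ n : ℕ, ∀ w, ∃ N, BddAt 0 N (polyMul (∏ i : Fin r, (X 0 - X i.succ.succ) ^ n)
      (lift (![0, 1] : Fin 2 → Fin (r + 2)) (fun e i => e i.succ.succ) (fun _ => LinearMap.id)
        fun m => (0 : W → FSeries (Fin 2) W) (prodSeries c w m))) :=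
    ⟨0, fun w => ⟨0, fun e _ => by simp only [Pi.zero_apply]; rw [lift_zero, polyMul_zero]; rfl⟩⟩
  have hbase : ∀ t ∈ swapBase A B, ∃ n : ℕ, ∀ w, ∃ N,
      BddAt 0 N (polyMul (∏ i : Fin r, (X 0 - X i.succ.succ) ^ n)
      (lift (![0, 1] : Fin 2 → Fin (r + 2)) (fun e i => e i.succ.succ) (fun _ => LinearMap.id)
        fun m => t (prodSeries c w m))) := by
    intro t ht
    induction ht using Submodule.span_induction with
    | zero => exact hzero
    | add Q Q' _ _ h h' => exact hadd Q Q' h h'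
    | smul a Q _ h => exact hsmul a Q h
    | mem t ht =>
      obtain ⟨k, u, hu, v, hv, -, rfl⟩ := ht
      obtain ⟨n, hn⟩ := hc v hv
      refine ⟨n, fun w => ?_⟩
      obtain ⟨N, hN⟩ := hn w
      refine ⟨N, ?_⟩
      simp only [famMul_apply]
      rw [← polyMul_lift hind, polyMul_comm]
      refine BddAt.polyMul ?_ _
      -- After the exchange, u(x₁) stands to the left of v(x₀)c₁(x₂)⋯. It acts on coefficients only,
      -- so the bound on the powers of x₀ known for v and c persists.
      have h1 : lift (![0, 1] : Fin 2 → Fin (r + 2)) (fun e i => e i.succ.succ)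
          (fun _ => LinearMap.id) (fun m => pairSeriesSwap u v (prodSeries c w m)) =
          lift (Fin.succAbove 1) (fun e => e 1) (fun m => HVertexOperator.coeff u m)
            fun _ => prodSeries (Fin.cons v c : Fin (r + 1) → VertexOperator ℂ W) w := by
        funext e
        simp only [lift, prodSeries_cons, pairSeriesSwap, LinearMap.id_apply]
        rfl
      have h2 : (∏ i : Fin r, (X 0 - X i.succ.succ : MvPolynomial (Fin (r + 2)) ℂ) ^ n) =
          rename (Fin.succAbove 1) (∏ i : Fin r, (X 0 - X i.succ) ^ n) := by
        simp only [map_prod, map_pow, map_sub, rename_X]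
        rfl
      rw [h1, h2, polyMul_lift (indep_succAbove 1)]
      exact BddAt.lift_of_forall (f := Fin.succAbove 1) (k := 0) fun _ => hN
  induction hQ using Submodule.span_induction with
  | zero => exact hzero
  | add Q Q' _ _ h h' => exact hadd Q Q' h h'
  | smul a Q _ h => exact hsmul a Q h
  | mem Q hQ =>
    obtain ⟨φ, t, ht, rfl⟩ := hQ
    obtain ⟨n, hn⟩ := hbase t ht
    refine ⟨n, fun w => ?_⟩
    obtain ⟨N, hN⟩ := hn w
    refine ⟨N, ?_⟩
    -- The factor φ(x₁ - x₀) involves only nonnegative powers of x₀, so it preserves the bound as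
    -- well.
    have hfin : ∀ m, PSFinite (X 1 - X 0) (t (prodSeries c w m)) := fun m =>
      (famLaurent_swapBase ht _).psFinite (isHomogeneous_diff _ _)
    simp only [famPs]
    rw [← psMul_lift hind _ hfin, polyMul_psMul _ (PSFinite.lift hind _ hfin)]
    exact hN.psMul _ _

/-- The exponent k of x₀ - x₁ comes from the pair (a, b) alone. This uniformity in the remaining
fields is used for the vertex operators Y(a, x). -/
theorem clearsFirst_cons {r : ℕ} {c : Fin r → VertexOperator ℂ W}
    (hc : ∀ v ∈ A, ClearsFirst v c) {a b : VertexOperator ℂ W} {k : ℕ}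
    (hab : famMul ((X 0 - X 1) ^ k) (pairSeries a b) ∈ swapSpan A B) :
    ∃ n : ℕ, ∀ w, ∃ N, BddAt 0 N (polyMul ((X 0 - X 1) ^ k * ∏ i : Fin r, (X 0 - X i.succ.succ) ^ n)
      (prodSeries (Fin.cons a (Fin.cons b c : Fin (r + 1) → VertexOperator ℂ W) :
        Fin (r + 2) → VertexOperator ℂ W) w)) := by
  obtain ⟨n, hn⟩ := clearsFirst_step hc hab
  refine ⟨n, fun w => ?_⟩
  obtain ⟨N, hN⟩ := hn w
  refine ⟨N, ?_⟩
  simp only [famMul_apply] at hN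
  rw [← polyMul_lift (indep_zero_one r)] at hN
  have h1 : lift (![0, 1] : Fin 2 → Fin (r + 2)) (fun e i => e i.succ.succ)
      (fun _ => LinearMap.id) (fun m => pairSeries a b (prodSeries c w m)) =
      prodSeries (Fin.cons a (Fin.cons b c : Fin (r + 1) → VertexOperator ℂ W) :
        Fin (r + 2) → VertexOperator ℂ W) w := by
    funext e
    simp only [lift, prodSeries_cons, pairSeries, LinearMap.id_apply]
    rfl
  rw [h1, ← polyMul_mul, mul_comm] at hN
  simpa using hN

theorem MutuallyLocal.clearsFirst_cons (hAB : MutuallyLocal A B) {r : ℕ}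
    {c : Fin r → VertexOperator ℂ W} (hc : ∀ v ∈ A, ClearsFirst v c) {a b : VertexOperator ℂ W}
    (ha : a ∈ A) (hb : b ∈ B) :
    ClearsFirst a (Fin.cons b c : Fin (r + 1) → VertexOperator ℂ W) := by
  obtain ⟨k, hk⟩ := hAB a ha b hb
  obtain ⟨n, hn⟩ := Vtx.clearsFirst_cons hc hk
  refine ⟨k + n, fun w => ?_⟩
  obtain ⟨N, hN⟩ := hn w
  refine ⟨N, ?_⟩
  have h1 : (∏ i : Fin (r + 1), (X 0 - X i.succ : MvPolynomial (Fin (r + 2)) ℂ) ^ (k + n)) =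
      ((X 0 - X 1) ^ n * ∏ i : Fin r, (X 0 - X i.succ.succ) ^ k) *
      ((X 0 - X 1) ^ k * ∏ i : Fin r, (X 0 - X i.succ.succ) ^ n) := by
    rw [Fin.prod_univ_succ, Fin.succ_zero_eq_one]
    simp only [pow_add, Finset.prod_mul_distrib]
    ring
  rw [h1, polyMul_mul]
  exact hN.polyMul _

/-- The induction runs over all first fields in A at once, because an exchange replaces the first
field by other elements of A. -/
theorem MutuallyLocal.clearsFirst (hA : MutuallyLocal A A) {r : ℕ} {c : Fin r → VertexOperator ℂ W}
    (hc : ∀ i, c i ∈ A) {v : VertexOperator ℂ W} (hv : v ∈ A) : ClearsFirst v c := by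
  induction r generalizing v with
  | zero => exact clearsFirst_zero v c
  | succ r ih =>
    rw [← Fin.cons_self_tail c]
    exact hA.clearsFirst_cons (fun v hv => ih (fun i => hc i.succ) hv) hv (hc 0)

/-- `∏_{i<j} (x_i - x_j)ⁿ`. -/
def diffProd (r n : ℕ) : MvPolynomial (Fin r) ℂ :=
  ∏ q : Fin r × Fin r with q.1 < q.2, rename ![q.1, q.2] ((X 0 - X 1) ^ n)

theorem diffProd_eq (r n : ℕ) :
    diffProd r n = ∏ i : Fin r, ∏ j : Fin r, if i < j then (X i - X j) ^ n else 1 := by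
  rw [diffProd, Finset.prod_filter, ← Finset.univ_product_univ, Finset.prod_product]
  simp

theorem diffProd_succ (r n : ℕ) : diffProd (r + 1) n =
    (∏ i : Fin r, (X 0 - X i.succ) ^ n) * rename Fin.succ (diffProd r n) := by
  rw [diffProd_eq, diffProd_eq, Fin.prod_univ_succ, Fin.prod_univ_succ]
  simp only [lt_self_iff_false, if_false, one_mul, Fin.succ_pos, if_true, Fin.prod_univ_succ,
    Fin.not_lt_zero, Fin.succ_lt_succ_iff, map_prod, apply_ite (rename Fin.succ), map_pow, map_sub,
    rename_X, map_one]

theorem diffProd_add (r n m : ℕ) : diffProd r (n + m) = diffProd r n * diffProd r m := by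
  simp only [diffProd, pow_add, map_mul, Finset.prod_mul_distrib]

/-- The first variable is controlled by `ClearsFirst`. For the other variables the bounds of the
shorter product persist, as the first field acts from the left. -/
theorem MutuallyLocal.exists_isLaurent (hA : MutuallyLocal A A) {r : ℕ}
    {a : Fin r → VertexOperator ℂ W} (ha : ∀ i, a i ∈ A) :
    ∃ n : ℕ, ∀ w, IsLaurent (polyMul (diffProd r n) (prodSeries a w)) := by
  induction r with
  | zero => exact ⟨0, fun w => ⟨0, fun e ⟨i, _⟩ => i.elim0⟩⟩
  | succ r ih =>
    obtain ⟨n, hn⟩ := ih fun i => ha i.succ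
    obtain ⟨m, hm⟩ := hA.clearsFirst (fun i => ha (Fin.succ i)) (ha 0)
    refine ⟨n + m, fun w => ?_⟩
    have e1 : (Fin.cons (a 0) (fun i => a i.succ) : Fin (r + 1) → VertexOperator ℂ W) = a :=
      Fin.cons_self_tail a
    rw [isLaurent_iff]
    intro i
    refine Fin.cases ?_ (fun i => ?_) i
    · obtain ⟨N, hN⟩ := hm w
      refine ⟨N, ?_⟩
      rw [e1] at hN
      rw [diffProd_add, polyMul_mul, diffProd_succ r m, mul_comm (∏ i : Fin r, _), polyMul_mul]
      exact (hN.polyMul _).polyMul _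
    · obtain ⟨N, hN⟩ := hn w
      refine ⟨N, ?_⟩
      have h1 : prodSeries a w = lift (Fin.succAbove 0) (fun e => e 0)
          (fun m => HVertexOperator.coeff (a 0) m) fun _ => prodSeries (fun i => a i.succ) w := by
        funext e
        conv_lhs => rw [← e1]
        rw [prodSeries_cons]
        simp only [lift]
        rfl
      rw [add_comm n m, diffProd_add, polyMul_mul, diffProd_succ r n, polyMul_mul, h1]
      refine BddAt.polyMul (BddAt.polyMul ?_ _) _
      have h2 : rename Fin.succ (diffProd r n) = rename (Fin.succAbove 0) (diffProd r n) := by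
        congr 1
      rw [h2, polyMul_lift (indep_succAbove 0)]
      exact BddAt.lift_of_forall (f := Fin.succAbove 0) (k := i) fun _ e he => hN e ⟨i, he⟩

theorem MutuallyLocal.isQuasiCompatible (hA : MutuallyLocal A A) :
    IsQuasiCompatible (A : Set (VertexOperator ℂ W)) := fun _ _ ha => by
  obtain ⟨n, hn⟩ := hA.exists_isLaurent ha
  exact ⟨(X 0 - X 1) ^ n, pow_ne_zero n diff_ne_zero, hn⟩

end Sequences

/-! ### Slices of series in three variables -/

section Slices

variable {V W : Type*} [AddCommGroup V] [Module ℂ V]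

/-- The coefficient of `x₀ ^ m` of a series in `x₀, x₁, x₂`. -/
def slice (m : ℤ) (F : FSeries (Fin 3) V) : FSeries (Fin 2) V := fun e => F ![m, e 0, e 1]

omit [Module ℂ V] in
theorem slice_add (m : ℤ) (F G : FSeries (Fin 3) V) : slice m (F + G) = slice m F + slice m G := rfl

theorem slice_smul (m : ℤ) (c : ℂ) (F : FSeries (Fin 3) V) : slice m (c • F) = c • slice m F := rfl

theorem slice_X_zero (m : ℤ) (F : FSeries (Fin 3) V) :
    slice m (polyMul (X 0) F) = slice (m - 1) F := by
  funext e
  simp only [slice, polyMul_X]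
  congr 1
  funext l; fin_cases l <;> simp [bv_apply]

theorem slice_rename (m : ℤ) (p : MvPolynomial (Fin 2) ℂ) (F : FSeries (Fin 3) V) :
    slice m (polyMul (rename ![1, 2] p) F) = polyMul p (slice m F) := by
  refine polyMul_comp (κ := Fin 2) ![1, 2] (fun e => ![m, e 0, e 1]) (fun e i => ?_) p F
  funext l; fin_cases i <;> fin_cases l <;> simp [bv_apply]

theorem slice_diff (m : ℤ) (F : FSeries (Fin 3) V) :
    slice m (polyMul (X 1 - X 2) F) = polyMul (X 0 - X 1) (slice m F) := by
  rw [← slice_rename]; simp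

omit [Module ℂ V] in
theorem deg_vec (m : ℤ) (e : Fin 2 → ℤ) : deg ![m, e 0, e 1] = m + deg e := by
  simp [deg, Fin.sum_univ_three, Fin.sum_univ_two]; ring

/-- The power series `∑ₙ φ_{n+l} (n+l choose l) sˡ tⁿ`, that is, `sˡ φ⁽ˡ⁾(t) / l!`. -/
def taylorCoeff (s : ℂ) (l : ℕ) (φ : PowerSeries ℂ) : PowerSeries ℂ :=
  PowerSeries.mk fun n => PowerSeries.coeff (n + l) φ * (((n + l).choose l : ℕ) : ℂ) * s ^ l

theorem sum_triangle_eq_sum_box {M : Type*} [AddCommMonoid M] (g : ℕ × ℕ → M) (L J : ℕ)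
    (h : ∀ q : ℕ × ℕ, (L ≤ q.1 ∨ J ≤ q.2) → g q = 0) :
    ∑ n ∈ Finset.range (L + J), ∑ q ∈ Finset.HasAntidiagonal.antidiagonal n, g q =
      ∑ l ∈ Finset.range L, ∑ n ∈ Finset.range J, g (l, n) := by
  rw [← Finset.sum_product']
  have h1 : ∀ n ∈ Finset.range (L + J), ∑ q ∈ Finset.HasAntidiagonal.antidiagonal n, g q =
      ∑ q ∈ Finset.range L ×ˢ Finset.range J with q.1 + q.2 = n, g q := by
    intro n _
    symm
    refine Finset.sum_subset (fun q hq => ?_) fun q hq hq' => h q ?_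
    · simp only [Finset.mem_filter] at hq
      simpa using hq.2
    · simp only [Finset.mem_filter, Finset.mem_product, Finset.mem_range, not_and,
        Finset.HasAntidiagonal.mem_antidiagonal] at hq hq'
      by_contra hc
      push Not at hc
      exact hq' hc hq
  rw [Finset.sum_congr rfl h1, Finset.sum_fiberwise_of_maps_to]
  intro q hq
  simp only [Finset.mem_product, Finset.mem_range] at hq ⊢
  omega

/-- Expansion of `φ(x₂ - x₁ + s x₀)` in powers of `x₀`. -/
theorem slice_psMul (s : ℂ) (φ : PowerSeries ℂ) {H : FSeries (Fin 3) V} {N : ℤ} (hN : DegBdd N H)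
    (h0 : BddAt 0 0 H) (m : ℤ) :
    slice m (psMul φ (X 2 - X 1 + C s * X 0) H) =
      ∑ l ∈ Finset.range (m + 1).toNat,
        psMul (taylorCoeff s l φ) (X 1 - X 0) (slice (m - l) H) := by
  funext e
  -- H has no negative powers of x₀, so at most m factors x₀ can be split off; J bounds the powers
  -- of x₂ - x₁ through the total degree.
  set L := (m + 1).toNat with hL
  set J := (m + deg e - N).toNat + 1 with hJ
  set δ : MvPolynomial (Fin 3) ℂ := X 2 - X 1 with hδ
  have hδ1 : δ = rename ![1, 2] (X 1 - X 0 : MvPolynomial (Fin 2) ℂ) := by simp [hδ]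
  have hh : (δ + C s * X 0).IsHomogeneous 1 := by
    refine (isHomogeneous_diff _ _).add ?_
    simpa using (isHomogeneous_C (Fin 3) s).mul (isHomogeneous_X ℂ (0 : Fin 3))
  -- The first index counts factors s x₀ and the second counts factors x₂ - x₁ in the binomial
  -- expansion of their sum.
  let g : ℕ × ℕ → V := fun q => PowerSeries.coeff (q.2 + q.1) φ •
    ((((q.2 + q.1).choose q.1 : ℕ) : ℂ) * s ^ q.1) •
      polyMul ((X 1 - X 0) ^ q.2) (slice (m - q.1) H) e
  have hg : ∀ q : ℕ × ℕ, (L ≤ q.1 ∨ J ≤ q.2) → g q = 0 := by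
    rintro ⟨l, n⟩ hq
    suffices h : polyMul ((X 1 - X 0) ^ n) (slice (m - l) H) e = 0 by simp only [g, h, smul_zero]
    rw [← slice_rename, map_pow, ← hδ1]
    rcases hq with hq | hq
    · exact h0.polyMul _ _ (by simp only [Matrix.cons_val_zero]; simp only at hq; omega)
    · refine hN.polyMul_pow_eq_zero (isHomogeneous_diff _ _) ?_
      rw [deg_vec]
      simp only at hq
      omega
  have hlhs : slice m (psMul φ (δ + C s * X 0) H) e =
      ∑ n ∈ Finset.range (L + J), ∑ q ∈ Finset.HasAntidiagonal.antidiagonal n, g q := by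
    rw [slice, psMul_eq_sum φ (J := L + J) (fun n hn => hN.polyMul_pow_eq_zero hh
      (by rw [deg_vec]; omega))]
    refine Finset.sum_congr rfl fun n _ => ?_
    rw [add_comm δ, Commute.add_pow' (Commute.all _ _), polyMul_sum_left, Finset.sum_apply,
      Finset.smul_sum]
    refine Finset.sum_congr rfl fun q hq => ?_
    have hq' : q.2 + q.1 = n := by rw [add_comm]; simpa using hq
    simp only [g, hq']
    congr 1
    have e1 : n.choose q.1 • ((C s * X 0) ^ q.1 * δ ^ q.2) =
        C (((n.choose q.1 : ℕ) : ℂ) * s ^ q.1) * (X 0 ^ q.1 * δ ^ q.2) := by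
      rw [nsmul_eq_mul, mul_pow, map_mul, map_pow, map_natCast]; ring
    have e2 : polyMul (X 0 ^ q.1 * δ ^ q.2) H ![m, e 0, e 1] =
        polyMul ((X 1 - X 0) ^ q.2) (slice (m - q.1) H) e := by
      rw [← slice_rename, map_pow, ← hδ1, polyMul_mul, polyMul_X_pow, slice]
      congr 1
      funext l; fin_cases l <;> simp [bv_apply]
    rw [e1, polyMul_C_mul, Pi.smul_apply, e2]
  rw [hlhs, sum_triangle_eq_sum_box g L J hg, Finset.sum_apply]
  refine Finset.sum_congr rfl fun l _ => ?_
  have hfin : ∀ n ≥ J, polyMul ((X 1 - X 0) ^ n) (slice (m - l) H) e = 0 := by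
    intro n hn
    rw [← slice_rename, map_pow, ← hδ1]
    refine hN.polyMul_pow_eq_zero (isHomogeneous_diff _ _) ?_
    rw [deg_vec]
    omega
  rw [psMul_eq_sum _ hfin]
  refine Finset.sum_congr rfl fun n _ => ?_
  simp only [g, taylorCoeff, PowerSeries.coeff_mk, smul_smul, mul_assoc]

/-- Polynomials of degree one that are combinations of `x₀` and `x₁ - x₂`. -/
def IsElementary (p : MvPolynomial (Fin 3) ℂ) : Prop :=
  (∃ t : ℂ, t ≠ 0 ∧ p = C t * X 0) ∨ ∃ t s : ℂ, t ≠ 0 ∧ p = C t * (X 1 - X 2) + C s * X 0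

/-- These are the forms that clearing factors take after x₀ ↦ x₀ + x_j. They can be divided out:
each is a multiple of x₀, or has a nonzero multiple of x₁ - x₂ as its constant term in x₀. -/
theorem isElementary_substPoly {j : Fin 3} (hj : j ≠ 0) {i i' : Fin 3} (hi : i ≠ i') :
    IsElementary (substPoly 0 j (X i - X i')) := by
  have key : ∀ t s : ℂ, (t ≠ 0 ∨ s ≠ 0) → ∀ p : MvPolynomial (Fin 3) ℂ,
      p = C t * (X 1 - X 2) + C s * X 0 → IsElementary p := by
    intro t s hts p hp
    by_cases ht : t = 0
    · exact Or.inl ⟨s, hts.resolve_left (not_not.mpr ht), by simp [hp, ht]⟩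
    · exact Or.inr ⟨t, s, ht, hp⟩
  obtain rfl | rfl : j = 1 ∨ j = 2 := by omega
  all_goals
    fin_cases i <;> fin_cases i' <;>
    first
    | exact absurd rfl hi
    | (refine key 0 1 (by simp) _ ?_; simp [substPoly]; done)
    | (refine key 0 (-1) (by simp) _ ?_; simp [substPoly]; done)
    | (refine key 1 0 (by simp) _ ?_; simp [substPoly]; done)
    | (refine key (-1) 0 (by simp) _ ?_; simp [substPoly]; done)
    | (refine key 1 1 (by simp) _ ?_; simp [substPoly]; ring; done)
    | (refine key (-1) 1 (by simp) _ ?_; simp [substPoly]; ring; done)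
    | (refine key 1 (-1) (by simp) _ ?_; simp [substPoly]; ring; done)
    | (refine key (-1) (-1) (by simp) _ ?_; simp [substPoly]; ring)

/-- All coefficients of powers of `x₀` in the family lie in `R`. -/
def SlicesIn (R : Submodule ℂ (W → FSeries (Fin 2) V)) (Z : W → FSeries (Fin 3) V) : Prop :=
  ∀ m : ℤ, (fun w => slice m (Z w)) ∈ R

variable {R : Submodule ℂ (W → FSeries (Fin 2) V)}

theorem SlicesIn.famMul (hR : DiagStable R) {Z : W → FSeries (Fin 3) V} (hZ : SlicesIn R Z)
    {p : MvPolynomial (Fin 3) ℂ} (hp : IsElementary p) : SlicesIn R (famMul p Z) := by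
  have h0 : ∀ m, (fun w => slice m (polyMul (X 0) (Z w))) ∈ R := fun m => by
    simp only [slice_X_zero]; exact hZ (m - 1)
  rcases hp with ⟨t, -, rfl⟩ | ⟨t, s, -, rfl⟩
  · intro m
    simp only [famMul_apply, polyMul_C_mul, slice_smul]
    exact R.smul_mem t (h0 m)
  · intro m
    simp only [famMul_apply, polyMul_add_left, polyMul_C_mul, slice_add, slice_smul]
    refine R.add_mem (R.smul_mem t ?_) (R.smul_mem s (h0 m))
    simp only [slice_diff]
    exact hR.mul _ (hZ m)

/-- The coefficient of x₀^m in (t(x₁ - x₂) + s x₀)Z is t(x₁ - x₂)Z_m + s Z_{m-1}. Starting below the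
bound N, membership of Z_{m-1} and division by x₁ - x₂ inside R give membership of Z_m. -/
theorem SlicesIn.of_famMul (hR : DiagStable R) {Z : W → FSeries (Fin 3) V} {N : ℤ}
    (hN : ∀ w, BddAt 0 N (Z w)) {p : MvPolynomial (Fin 3) ℂ} (hp : IsElementary p)
    (hZ : SlicesIn R (Vtx.famMul p Z)) : SlicesIn R Z := by
  rcases hp with ⟨t, ht, rfl⟩ | ⟨t, s, ht, rfl⟩
  · intro m
    have h1 := hZ (m + 1)
    simp only [famMul_apply, polyMul_C_mul, slice_smul, slice_X_zero, add_sub_cancel_right] at h1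
    exact (R.smul_mem_iff ht).mp h1
  · have key : ∀ n : ℕ, ∀ m < N + n, (fun w => slice m (Z w)) ∈ R := by
      intro n
      induction n with
      | zero =>
        intro m hm
        have : (fun w => slice m (Z w)) = 0 := by
          funext w e
          exact hN w _ (by simp; omega)
        rw [this]
        exact zero_mem _
      | succ n ih =>
        intro m hm
        have h1 := hZ m
        simp only [famMul_apply, polyMul_add_left, polyMul_C_mul, slice_add, slice_smul,
          slice_X_zero, slice_diff] at h1
        have h2 := R.smul_mem s (ih (m - 1) (by push_cast at hm; omega))
        have h3 := R.sub_mem h1 h2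
        have h4 : ((fun w => t • polyMul (X 0 - X 1) (slice m (Z w)) + s • slice (m - 1) (Z w)) -
            s • fun w => slice (m - 1) (Z w)) =
            t • Vtx.famMul (X 0 - X 1) (fun w => slice m (Z w)) := by
          funext w
          simp [famMul_apply]
        rw [h4] at h3
        exact hR.div _ ((R.smul_mem_iff ht).mp h3)
    exact fun m => key (m - N + 1).toNat m (by omega)

theorem SlicesIn.substPoly_famMul (hR : DiagStable R) {Z : W → FSeries (Fin 3) V}
    {j : Fin 3} (hj : j ≠ 0) {q : MvPolynomial (Fin 3) ℂ} (hq : q ∈ diffMonoid (Fin 3))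
    (hZ : SlicesIn R Z) : SlicesIn R (Vtx.famMul (substPoly 0 j q) Z) := by
  induction hq using Submonoid.closure_induction generalizing Z with
  | mem q hq =>
    obtain ⟨i, i', hi, rfl⟩ := hq
    exact hZ.famMul hR (isElementary_substPoly hj hi)
  | one => rwa [map_one, famMul_one]
  | mul p q _ _ hp hq => rw [map_mul, famMul_mul]; exact hp (hq hZ)

theorem SlicesIn.of_substPoly_famMul (hR : DiagStable R) {Z : W → FSeries (Fin 3) V} {N : ℤ}
    (hN : ∀ w, BddAt 0 N (Z w)) {j : Fin 3} (hj : j ≠ 0) {q : MvPolynomial (Fin 3) ℂ}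
    (hq : q ∈ diffMonoid (Fin 3))
    (hZ : SlicesIn R (Vtx.famMul (substPoly 0 j q) Z)) : SlicesIn R Z := by
  induction hq using Submonoid.closure_induction generalizing Z with
  | mem q hq =>
    obtain ⟨i, i', hi, rfl⟩ := hq
    exact hZ.of_famMul hR hN (isElementary_substPoly hj hi)
  | one => rwa [map_one, famMul_one] at hZ
  | mul p q _ _ hp hq =>
    rw [map_mul, famMul_mul] at hZ
    exact hq hN (hp (fun w => (hN w).polyMul _) hZ)

/-- Multiplication by `φ(δ)` preserves the property that the coefficients of powers of `x₀` after the
substitution `x₀ ↦ x₀ + x_j` lie in `R`. -/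
theorem SlicesIn.famPs {φ : PowerSeries ℂ} {T : W → FSeries (Fin 3) V} (hT : FamLaurent T)
    (hRφ : ∀ Q ∈ R, FamLaurent Q → ∀ χ, famPs χ (X 1 - X 0) Q ∈ R) {j : Fin 3} (hj : j ≠ 0)
    {i i' : Fin 3} {s : ℂ}
    (hδ : substPoly 0 j (X i - X i') = X 2 - X 1 + C s * X 0)
    (h : SlicesIn R fun w => substVar ibinom 0 j (T w))
    (hL : ∀ m, FamLaurent fun w => slice m (substVar ibinom 0 j (T w))) :
    SlicesIn R fun w => substVar ibinom 0 j (famPs φ (X i - X i') T w) := by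
  intro m
  -- Taylor expansion in x₀: each coefficient is a finite sum of power series in x₂ - x₁ applied to
  -- coefficients of T after substitution.
  have h1 : (fun w => slice m (substVar ibinom 0 j (Vtx.famPs φ (X i - X i') T w))) =
      ∑ l ∈ Finset.range (m + 1).toNat, Vtx.famPs (taylorCoeff s l φ) (X 1 - X 0)
        (fun w => slice (m - l) (substVar ibinom 0 j (T w))) := by
    funext w
    obtain ⟨N, hN⟩ := (hT w).degBdd
    have hN' : DegBdd N (substVar ibinom 0 j (T w)) := fun e he =>
      finsum_eq_zero_of_forall_eq_zero fun m => by rw [hN _ (by rwa [deg_line]), smul_zero]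
    rw [Vtx.famPs, substVar_psMul isPascal_ibinom hj.symm ((hT w).substFinite _ hj.symm) hN
      (isHomogeneous_diff _ _), hδ, slice_psMul s φ hN' (bddAt_substVar_ibinom _ _ _),
      Finset.sum_apply]
    rfl
  rw [h1]
  exact R.sum_mem fun l _ => hRφ _ (h (m - l)) (hL _) _

omit [Module ℂ V] in
-- If the new power of x₀ is m and the old one is k ≥ N, the new exponent of x_j equals the old one
-- plus k - m, hence is at least 2N - m.
theorem isLaurent_slice_substVar {F : FSeries (Fin 3) V} (hF : IsLaurent F) {j : Fin 3}
    (hj : j ≠ 0) (m : ℤ) : IsLaurent (slice m (substVar ibinom 0 j F)) := by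
  obtain ⟨N, hN⟩ := hF
  refine ⟨min N (2 * N - m), fun e he => ?_⟩
  refine finsum_eq_zero_of_forall_eq_zero fun k => ?_
  by_cases hk : k < N
  · rw [hN _ ⟨0, by rw [line_apply_left hj.symm]; simpa using hk⟩, smul_zero]
  have hij : ∃ l : Fin 3, l ≠ 0 ∧ (![m, e 0, e 1] : Fin 3 → ℤ) l < min N (2 * N - m) := by
    obtain ⟨i, hi⟩ := he
    exact ⟨i.succ, Fin.succ_ne_zero i, by fin_cases i <;> simpa using hi⟩
  obtain ⟨l, hl0, hl⟩ := hij
  rw [hN _ ⟨l, ?_⟩, smul_zero]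
  by_cases hlj : l = j
  · subst hlj
    rw [line_apply_right hj.symm]
    simp only [Matrix.cons_val_zero]
    omega
  · rw [line_apply_other hl0 hlj]
    omega

end Slices

/-! ### Closure of mutual locality under products -/

section Dong

variable {W : Type*} [AddCommGroup W] [Module ℂ W] {A B D : Submodule ℂ (VertexOperator ℂ W)}

/-- The product of the differences of three variables. -/
def disc : MvPolynomial (Fin 3) ℂ := (X 0 - X 1) * (X 0 - X 2) * (X 1 - X 2)

theorem disc_mem : disc ∈ diffMonoid (Fin 3) :=
  mul_mem (mul_mem (diff_mem (by decide)) (diff_mem (by decide))) (diff_mem (by decide))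

/-- The series `a(x₀) b(x₁) c(x₂) w`. -/
def tripleSeries (a b c : VertexOperator ℂ W) (w : W) : FSeries (Fin 3) W := fun e =>
  HVertexOperator.coeff a (e 0) (HVertexOperator.coeff b (e 1) (HVertexOperator.coeff c (e 2) w))

theorem tripleSeries_eq_prodSeries (a b c : VertexOperator ℂ W) (w : W) :
    tripleSeries a b c w = prodSeries (Fin.cons a (Fin.cons b (fun _ : Fin 1 => c) :
      Fin 2 → VertexOperator ℂ W) : Fin 3 → VertexOperator ℂ W) w := by
  funext e
  rw [prodSeries_cons, prodSeries_cons]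
  simp [tripleSeries, prodSeries]

/-- Clearing the poles of three fields, with the power of `x₀ - x₁` under control. -/
theorem exists_isLaurent_tripleSeries_of_mem (hAC : MutuallyLocal A D)
    (hBC : MutuallyLocal B D) {a b c : VertexOperator ℂ W} (hb : b ∈ B) (hc : c ∈ D)
    {k : ℕ} (hab : famMul ((X 0 - X 1) ^ k) (pairSeries a b) ∈ swapSpan A B) :
    ∃ n : ℕ, ∀ w, IsLaurent (polyMul ((X 0 - X 1) ^ k * ((X 0 - X 2) * (X 1 - X 2)) ^ n)
      (tripleSeries a b c w)) := by
  have h0 : ∀ v ∈ A, ClearsFirst v (fun _ : Fin 1 => c) := fun v hv => by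
    have := hAC.clearsFirst_cons (c := (Fin.elim0 : Fin 0 → VertexOperator ℂ W))
      (fun v _ => clearsFirst_zero v _) hv hc
    rwa [show (Fin.cons c Fin.elim0 : Fin 1 → VertexOperator ℂ W) = fun _ => c from
      funext fun i => by fin_cases i; rfl] at this
  obtain ⟨n, hn⟩ := clearsFirst_cons h0 hab
  obtain ⟨m, hm⟩ := hBC.diagCompat hb hc
  refine ⟨n + m, fun w => isLaurent_iff.mpr fun i => ?_⟩
  fin_cases i
  · obtain ⟨N, hN⟩ := hn w
    refine ⟨N, ?_⟩
    rw [← tripleSeries_eq_prodSeries] at hN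
    -- The exponent of x₀ - x₁ has to stay equal to k, so the reserve n + m is spent on the other
    -- two differences only.
    have h1 : (X 0 - X 1 : MvPolynomial (Fin 3) ℂ) ^ k * ((X 0 - X 2) * (X 1 - X 2)) ^ (n + m) =
        ((X 0 - X 2) ^ m * (X 1 - X 2) ^ (n + m)) *
          ((X 0 - X 1) ^ k * ∏ i : Fin 1, (X 0 - X i.succ.succ) ^ n) := by
      simp only [Finset.univ_unique, Fin.default_eq_zero, Fin.isValue, Finset.prod_singleton,
        show Fin.succ (Fin.succ (0 : Fin 1)) = 2 from rfl, mul_pow, pow_add]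
      ring
    rw [h1, polyMul_mul]
    exact hN.polyMul _
  · obtain ⟨N, hN⟩ := hm w
    refine ⟨N, ?_⟩
    have h1 : (X 0 - X 1 : MvPolynomial (Fin 3) ℂ) ^ k * ((X 0 - X 2) * (X 1 - X 2)) ^ (n + m) =
        ((X 0 - X 1) ^ k * (X 0 - X 2) ^ (n + m) * (X 1 - X 2) ^ n) *
          rename (Fin.succAbove 0) ((X 0 - X 1) ^ m) := by
      simp only [map_pow, map_sub, rename_X, Fin.succAbove_zero, Fin.succ_zero_eq_one,
        Fin.succ_one_eq_two, mul_pow, pow_add]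
      ring
    have h2 : tripleSeries a b c w = lift (Fin.succAbove 0) (fun e : Fin 3 → ℤ => e 0)
        (fun m => HVertexOperator.coeff a m) fun _ => pairSeries b c w := by
      funext e; rfl
    rw [h1, polyMul_mul, h2, polyMul_lift (indep_succAbove 0)]
    exact BddAt.polyMul
      (BddAt.lift_of_forall (f := Fin.succAbove 0) (k := 0) fun _ e he => hN e ⟨0, he⟩) _
  · obtain ⟨N, hN⟩ := coeff_lt_bound c w
    refine ⟨N, BddAt.polyMul (fun e he => ?_) _⟩
    have h1 : HVertexOperator.coeff c (e 2) w = 0 := hN (e 2) he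
    rw [tripleSeries, h1, map_zero, map_zero]

theorem exists_isLaurent_tripleSeries (hAB : MutuallyLocal A B) (hAC : MutuallyLocal A D)
    (hBC : MutuallyLocal B D) {a b c : VertexOperator ℂ W} (ha : a ∈ A) (hb : b ∈ B) (hc : c ∈ D) :
    ∃ n : ℕ, FamLaurent (famMul (disc ^ n) (tripleSeries a b c)) := by
  obtain ⟨k, hk⟩ := hAB a ha b hb
  obtain ⟨n, hn⟩ := exists_isLaurent_tripleSeries_of_mem hAC hBC hb hc hk
  refine ⟨k + n, fun w => ?_⟩
  have h1 : disc ^ (k + n) = ((X 0 - X 1) ^ n * ((X 0 - X 2) * (X 1 - X 2)) ^ k) *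
      ((X 0 - X 1) ^ k * ((X 0 - X 2) * (X 1 - X 2)) ^ n) := by
    simp only [disc, mul_pow, pow_add]; ring
  rw [famMul_apply, h1, polyMul_mul]
  exact (hn w).polyMul _

/-- Families of series in three variables, obtained from families in two variables by inserting
operators `α` from the left and transformations `β` from the right. -/
def famLift (f : Fin 2 → Fin 3) (g : Fin 3) (α : ℤ → W →ₗ[ℂ] W) (β : ℤ → W → W)
    (Q : W → FSeries (Fin 2) W) : W → FSeries (Fin 3) W :=
  fun w => lift f (fun e => e g) α fun m => Q (β m w)

variable {f : Fin 2 → Fin 3} {g : Fin 3} {α : ℤ → W →ₗ[ℂ] W} {β : ℤ → W → W}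

theorem famMul_famLift (h : Indep f fun e : Fin 3 → ℤ => e g) (p : MvPolynomial (Fin 2) ℂ)
    (Q : W → FSeries (Fin 2) W) :
    famMul (rename f p) (famLift f g α β Q) = famLift f g α β (famMul p Q) :=
  funext fun _ => polyMul_lift h α _ p

theorem famPs_famLift (h : Indep f fun e : Fin 3 → ℤ => e g) {δ : MvPolynomial (Fin 2) ℂ}
    (hδ : δ.IsHomogeneous 1) (φ : PowerSeries ℂ) {Q : W → FSeries (Fin 2) W} (hQ : FamLaurent Q) :
    famPs φ (rename f δ) (famLift f g α β Q) = famLift f g α β (famPs φ δ Q) :=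
  funext fun w => psMul_lift h α (fun m => (hQ (β m w)).psFinite hδ) φ

theorem famLift_add (Q Q' : W → FSeries (Fin 2) W) :
    famLift f g α β (Q + Q') = famLift f g α β Q + famLift f g α β Q' :=
  funext fun _ => lift_add α _ _

theorem famLift_smul (c : ℂ) (Q : W → FSeries (Fin 2) W) :
    famLift f g α β (c • Q) = c • famLift f g α β Q := funext fun _ => lift_smul α c _

theorem famLift_zero : famLift f g α β 0 = 0 := funext fun _ => lift_zero α

theorem exists_disc_mem_add {T : Submodule ℂ (W → FSeries (Fin 3) W)} (hcl : DiffClosed T)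
    {Q Q' : W → FSeries (Fin 3) W} (h : ∃ K : ℕ, famMul (disc ^ K) Q ∈ T)
    (h' : ∃ K : ℕ, famMul (disc ^ K) Q' ∈ T) : ∃ K : ℕ, famMul (disc ^ K) (Q + Q') ∈ T := by
  obtain ⟨K, hK⟩ := h
  obtain ⟨L, hL⟩ := h'
  refine ⟨K + L, ?_⟩
  rw [map_add]
  refine add_mem ?_ ?_
  · rw [add_comm, pow_add, famMul_mul]
    exact hcl _ (pow_mem disc_mem L) _ hK
  · rw [pow_add, famMul_mul]
    exact hcl _ (pow_mem disc_mem K) _ hL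

theorem exists_disc_mem_of_span {T : Submodule ℂ (W → FSeries (Fin 3) W)} (hcl : DiffClosed T)
    {G : Set (W → FSeries (Fin 2) W)}
    (h : ∀ Q ∈ G, ∃ K : ℕ, famMul (disc ^ K) (famLift f g α β Q) ∈ T)
    {Q : W → FSeries (Fin 2) W} (hQ : Q ∈ Submodule.span ℂ G) :
    ∃ K : ℕ, famMul (disc ^ K) (famLift f g α β Q) ∈ T := by
  induction hQ using Submodule.span_induction with
  | mem Q hQ => exact h Q hQ
  | zero => exact ⟨0, by rw [famLift_zero, map_zero]; exact zero_mem _⟩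
  | add Q Q' _ _ h h' => rw [famLift_add]; exact exists_disc_mem_add hcl h h'
  | smul c Q _ h =>
    obtain ⟨K, hK⟩ := h
    exact ⟨K, by rw [famLift_smul, map_smul]; exact T.smul_mem c hK⟩

/-- Exchanging two adjacent fields in a product of three fields. -/
theorem exists_disc_mem_psSpan (hind : Indep f fun e : Fin 3 → ℤ => e g)
    {r : MvPolynomial (Fin 3) ℂ} (hr : r ∈ diffMonoid (Fin 3))
    (hdisc : disc = r * (X (f 0) - X (f 1)))
    {T : Submodule ℂ (W → FSeries (Fin 3) W)} (hTL : ∀ t ∈ T, FamLaurent t) (hT : DiffClosed T)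
    (hbase : ∀ u ∈ B, ∀ v ∈ A,
      ∃ K : ℕ, famMul (disc ^ K) (famLift f g α β (pairSeriesSwap u v)) ∈ T)
    {a b : VertexOperator ℂ W} (hab : pairSeries a b ∈ swapFam A B) :
    ∃ K : ℕ, famMul (disc ^ K) (famLift f g α β (pairSeries a b)) ∈
      psSpan (X (f 1) - X (f 0)) T := by
  have hcl : DiffClosed (psSpan (X (f 1) - X (f 0)) T) := hT.psSpan (isHomogeneous_diff _ _) hTL
  have hf : f 1 ≠ f 0 := fun h => absurd (hind.injective h) (by decide)
  have hmem : (X (f 1) - X (f 0) : MvPolynomial (Fin 3) ℂ) ∈ diffMonoid (Fin 3) := diff_mem hf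
  have hren : rename f (X 1 - X 0 : MvPolynomial (Fin 2) ℂ) = X (f 1) - X (f 0) := by simp
  obtain ⟨N, hN⟩ := hab
  have h1 : ∃ K : ℕ, famMul (disc ^ K)
      (famLift f g α β (famMul ((X 0 - X 1) ^ N) (pairSeries a b))) ∈
        psSpan (X (f 1) - X (f 0)) T := by
    refine exists_disc_mem_of_span hcl ?_ hN
    rintro Q ⟨φ, t, ht, rfl⟩
    -- The clearing exponent is chosen for t before φ is applied, since the lifted family need not
    -- be Laurent before it is cleared.
    have h2 : ∃ K : ℕ, famMul (disc ^ K) (famLift f g α β t) ∈ T := by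
      refine exists_disc_mem_of_span hT ?_ ht
      rintro Q ⟨n, u, hu, v, hv, -, rfl⟩
      obtain ⟨K, hK⟩ := hbase u hu v hv
      refine ⟨K, ?_⟩
      rw [← famMul_famLift hind, famMul_comm, map_pow, hren]
      exact hT _ (pow_mem hmem n) _ hK
    obtain ⟨K, hK⟩ := h2
    refine ⟨K, ?_⟩
    rw [← famPs_famLift hind (isHomogeneous_diff _ _) φ (famLaurent_swapBase ht), hren]
    have h3 : famMul (disc ^ K) (famPs φ (X (f 1) - X (f 0)) (famLift f g α β t)) =
        famPs φ (X (f 1) - X (f 0)) (famMul (disc ^ K) (famLift f g α β t)) := by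
      funext w
      refine polyMul_psMul φ ?_ _
      rw [← hren]
      exact PSFinite.lift hind _ fun m =>
        (famLaurent_swapBase ht (β m w)).psFinite (isHomogeneous_diff _ _)
    rw [h3]
    exact famPs_mem_psSpan φ hK
  obtain ⟨K, hK⟩ := h1
  refine ⟨K + N, ?_⟩
  -- Of the last N factors `disc`, the difference of the two exchanged variables pays for locality.
  -- The rest r ^ N is harmless, as the target is stable under differences.
  have h4 : disc ^ (K + N) = r ^ N * (disc ^ K * rename f ((X 0 - X 1) ^ N)) := by
    rw [pow_add]
    nth_rewrite 2 [hdisc]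
    rw [mul_pow, map_pow, map_sub, rename_X, rename_X]
    ring
  rw [h4, famMul_mul, famMul_mul, famMul_famLift hind]
  exact hcl _ (pow_mem hr N) _ hK

/-- The lower bound -K does not depend on w, which gives the truncation of the products and the
start of the division argument. -/
theorem prodOpe_bddAt {a b : VertexOperator ℂ W} {K : ℕ}
    (hK : FamLaurent (famMul ((X 0 - X 1) ^ K) (pairSeries a b))) (w : W) :
    polyMul (X 0 ^ K) (prodOpe a b w) =
      substVar ibinom 0 1 (polyMul ((X 0 - X 1) ^ K) (pairSeries a b w)) ∧
    BddAt 0 (-K) (prodOpe a b w) := by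
  have h1 := ((isOpe_prodOpe ⟨K, hK⟩ w).eq_of_isLaurent (hK w)).symm
  refine ⟨h1, fun e he => ?_⟩
  have h2 := congrFun h1 (e + (K : ℤ) • bv 0)
  rw [polyMul_X_pow, add_sub_cancel_right] at h2
  rw [h2]
  exact bddAt_substVar_ibinom _ _ _ _ (by simp; omega)

variable {j : Fin 3}

/-- The substitution `x₀ ↦ x₀ + x_j` turns `a(x₀) b(x_j)` into the operator product expansion. -/
theorem substVar_famLift (hj : j ≠ 0) (hind : Indep ![0, j] fun e : Fin 3 → ℤ => e g)
    {a b : VertexOperator ℂ W} {K : ℕ}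
    (hK : FamLaurent (famMul ((X 0 - X 1) ^ K) (pairSeries a b))) (q : MvPolynomial (Fin 3) ℂ) :
    (fun w => substVar ibinom 0 j
      (famMul (q * (X 0 - X j) ^ K) (famLift ![0, j] g α β (pairSeries a b)) w)) =
    famMul (substPoly 0 j (q * (X 0 - X j) ^ K)) (famLift ![0, j] g α β (prodOpe a b)) := by
  have hren : (X 0 - X j : MvPolynomial (Fin 3) ℂ) ^ K =
      rename (![0, j] : Fin 2 → Fin 3) ((X 0 - X 1) ^ K) := by simp
  have hfin : ∀ w m, SubstFinite ibinom (0 : Fin 2) 1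
      (famMul ((X 0 - X 1) ^ K) (pairSeries a b) (β m w)) := fun w m =>
    (hK (β m w)).substFinite _ (by decide)
  funext w
  have h1 : famMul (q * (X 0 - X j) ^ K) (famLift ![0, j] g α β (pairSeries a b)) w =
      polyMul q (lift ![0, j] (fun e => e g) α
        fun m => famMul ((X 0 - X 1) ^ K) (pairSeries a b) (β m w)) := by
    rw [famMul_mul, hren, famMul_famLift hind]
    rfl
  have h2 := substVar_lift hind α (hfin w)
  have h3 := SubstFinite.lift hind α (hfin w)
  simp only [Matrix.cons_val_zero, Matrix.cons_val_one] at h2 h3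
  rw [h1, substVar_polyMul isPascal_ibinom hj.symm h3, h2, map_mul, map_pow,
    substPoly_sub hj.symm, famMul_mul, famMul_apply]
  congr 1
  have h4 : (X 0 : MvPolynomial (Fin 3) ℂ) ^ K =
      rename (![0, j] : Fin 2 → Fin 3) (X 0 ^ K) := by simp
  rw [h4, famMul_famLift hind]
  simp only [famMul_apply, (prodOpe_bddAt hK _).1.symm, famLift]

theorem famLift_prodOpe_bddAt {a b : VertexOperator ℂ W} {K : ℕ}
    (hK : FamLaurent (famMul ((X 0 - X 1) ^ K) (pairSeries a b))) (w : W) :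
    BddAt 0 (-K) (famLift ![0, j] g α β (prodOpe a b) w) :=
  BddAt.lift_of_forall (f := ![0, j]) (k := 0) fun m => (prodOpe_bddAt hK (β m w)).2

variable {R : Submodule ℂ (W → FSeries (Fin 2) W)}

/-- The substitution turns the clearing polynomial into a product of elementary factors, and these
are divided out one by one. -/
theorem slicesIn_prodOpe (hR : DiagStable R) (hj : j ≠ 0)
    (hind : Indep ![0, j] fun e : Fin 3 → ℤ => e g) {a b : VertexOperator ℂ W} {K : ℕ}
    (hK : FamLaurent (famMul ((X 0 - X 1) ^ K) (pairSeries a b))) {q : MvPolynomial (Fin 3) ℂ}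
    (hq : q ∈ diffMonoid (Fin 3))
    (h : SlicesIn R fun w => substVar ibinom 0 j
      (famMul (q * (X 0 - X j) ^ K) (famLift ![0, j] g α β (pairSeries a b)) w)) :
    SlicesIn R (famLift ![0, j] g α β (prodOpe a b)) := by
  rw [substVar_famLift hj hind hK] at h
  exact h.of_substPoly_famMul hR (famLift_prodOpe_bddAt hK) hj
    (mul_mem hq (pow_mem (diff_mem hj.symm) K))

/-- The Laurent families obtained from `α (a(x₀) b(x_j)) β` by multiplication by powers of the
differences of the variables, with `(a, b, α, β)` in a given set. -/
def clearedSpan (j g : Fin 3)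
    (𝒢 : Set (VertexOperator ℂ W × VertexOperator ℂ W × (ℤ → W →ₗ[ℂ] W) × (ℤ → W → W))) :
    Submodule ℂ (W → FSeries (Fin 3) W) :=
  Submodule.span ℂ {Q | ∃ a b α β, (a, b, α, β) ∈ 𝒢 ∧ ∃ q ∈ diffMonoid (Fin 3), ∃ K : ℕ,
    FamLaurent (famMul ((X 0 - X 1) ^ K) (pairSeries a b)) ∧ FamLaurent Q ∧
    Q = famMul (q * (X 0 - X j) ^ K) (famLift ![0, j] g α β (pairSeries a b))}

variable {𝒢 : Set (VertexOperator ℂ W × VertexOperator ℂ W × (ℤ → W →ₗ[ℂ] W) × (ℤ → W → W))}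

theorem famLaurent_clearedSpan : ∀ Q ∈ clearedSpan j g 𝒢, FamLaurent Q := fun Q hQ => by
  refine famLaurent_of_mem_span ?_ hQ
  rintro Q ⟨a, b, α, β, -, q, -, K, -, hL, -⟩
  exact hL

theorem diffClosed_clearedSpan : DiffClosed (clearedSpan j g 𝒢) := by
  refine diffClosed_span ?_
  rintro p hp Q ⟨a, b, α, β, hG, q, hq, K, hK, hL, rfl⟩
  have h1 : famMul p (famMul (q * (X 0 - X j) ^ K) (famLift ![0, j] g α β (pairSeries a b))) =
      famMul (p * q * (X 0 - X j) ^ K) (famLift ![0, j] g α β (pairSeries a b)) := by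
    rw [← famMul_mul, mul_assoc]
  exact Submodule.subset_span
    ⟨a, b, α, β, hG, p * q, mul_mem hp hq, K, hK, h1 ▸ hL.famMul p, h1⟩

theorem mem_clearedSpan (hj : j ≠ 0) {a b : VertexOperator ℂ W} (hG : (a, b, α, β) ∈ 𝒢)
    (hab : DiagCompat a b)
    (hL : ∃ n : ℕ, FamLaurent (famMul (disc ^ n) (famLift ![0, j] g α β (pairSeries a b)))) :
    ∃ n : ℕ, famMul (disc ^ n) (famLift ![0, j] g α β (pairSeries a b)) ∈ clearedSpan j g 𝒢 := by
  obtain ⟨n, hn⟩ := hL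
  obtain ⟨K, hK⟩ := hab
  obtain ⟨r, hr, hdisc⟩ : ∃ r ∈ diffMonoid (Fin 3), disc = r * (X 0 - X j) := by
    obtain rfl | rfl : j = 1 ∨ j = 2 := by omega
    · exact ⟨(X 0 - X 2) * (X 1 - X 2), mul_mem (diff_mem (by decide)) (diff_mem (by decide)),
        by rw [disc]; ring⟩
    · exact ⟨(X 0 - X 1) * (X 1 - X 2), mul_mem (diff_mem (by decide)) (diff_mem (by decide)),
        by rw [disc]; ring⟩
  have h1 : disc ^ (n + K) = disc ^ n * r ^ K * (X 0 - X j) ^ K := by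
    rw [pow_add]
    nth_rewrite 2 [hdisc]
    rw [mul_pow, mul_assoc]
  refine ⟨n + K, Submodule.subset_span ⟨a, b, α, β, hG, disc ^ n * r ^ K,
    mul_mem (pow_mem disc_mem n) (pow_mem hr K), K, hK, ?_, by rw [h1]⟩⟩
  rw [add_comm, pow_add, famMul_mul]
  exact hn.famMul _

theorem slicesIn_of_span (hj : j ≠ 0) {G : Set (W → FSeries (Fin 3) W)}
    (hG : ∀ Q ∈ G, FamLaurent Q) (h : ∀ Q ∈ G, SlicesIn R fun w => substVar ibinom 0 j (Q w))
    {Q : W → FSeries (Fin 3) W} (hQ : Q ∈ Submodule.span ℂ G) :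
    SlicesIn R fun w => substVar ibinom 0 j (Q w) := by
  induction hQ using Submodule.span_induction with
  | mem Q hQ => exact h Q hQ
  | zero =>
    intro m
    have : (fun w => slice m (substVar ibinom 0 j ((0 : W → FSeries (Fin 3) W) w))) = 0 := by
      funext w e
      simp [slice, substVar]
    rw [this]
    exact zero_mem _
  | add Q Q' hQ hQ' h h' =>
    intro m
    have : (fun w => slice m (substVar ibinom 0 j ((Q + Q') w))) =
        (fun w => slice m (substVar ibinom 0 j (Q w))) +
        (fun w => slice m (substVar ibinom 0 j (Q' w))) := by
      funext w
      rw [Pi.add_apply, Pi.add_apply, substVar_add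
        ((famLaurent_of_mem_span hG hQ w).substFinite _ hj.symm)
        ((famLaurent_of_mem_span hG hQ' w).substFinite _ hj.symm), slice_add]
    rw [this]
    exact add_mem (h m) (h' m)
  | smul c Q _ h =>
    intro m
    simp only [Pi.smul_apply, substVar_smul, slice_smul]
    exact R.smul_mem c (h m)

/-- A swapped product involving aₙb is a generator of a locality space only once its poles are known
to be cleared by a power of x₁ - x₂. Hence membership in `diagFam` is offered as a hypothesis to
`hG`. -/
theorem slicesIn_clearedSpan (hR : DiagStable R) (hj : j ≠ 0)
    (hind : Indep ![0, j] fun e : Fin 3 → ℤ => e g)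
    (hG : ∀ a b α β, (a, b, α, β) ∈ 𝒢 → ∀ m : ℤ,
      (fun w => slice m (famLift ![0, j] g α β (prodOpe a b) w)) ∈ diagFam W W →
      (fun w => slice m (famLift ![0, j] g α β (prodOpe a b) w)) ∈ R)
    {Q : W → FSeries (Fin 3) W} (hQ : Q ∈ clearedSpan j g 𝒢) :
    SlicesIn R fun w => substVar ibinom 0 j (Q w) := by
  refine slicesIn_of_span hj ?_ ?_ hQ
  · rintro Q ⟨a, b, α, β, -, q, -, K, -, hL, -⟩
    exact hL
  · rintro Q ⟨a, b, α, β, hab, q, hq, K, hK, hL, rfl⟩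
    -- The division argument is first run with `diagFam`, where the slices of a substituted Laurent
    -- series lie trivially.
    have h1 : SlicesIn (diagFam W W) (famLift ![0, j] g α β (prodOpe a b)) := by
      refine slicesIn_prodOpe diagStable_diagFam hj hind hK hq fun m => ⟨0, fun w => ?_⟩
      rw [pow_zero, famMul_one]
      exact isLaurent_slice_substVar (hL w) hj m
    have h2 : SlicesIn R (famLift ![0, j] g α β (prodOpe a b)) := fun m => hG a b α β hab m (h1 m)
    rw [substVar_famLift hj hind hK]
    exact h2.substPoly_famMul hR hj (mul_mem hq (pow_mem (diff_mem hj.symm) K))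

theorem slicesIn_psSpan (hj : j ≠ 0) {i i' : Fin 3} {s : ℂ}
    (hδ : substPoly 0 j (X i - X i') = X 2 - X 1 + C s * X 0)
    (hRφ : ∀ Q ∈ R, FamLaurent Q → ∀ χ, famPs χ (X 1 - X 0) Q ∈ R)
    {T : Submodule ℂ (W → FSeries (Fin 3) W)} (hTL : ∀ t ∈ T, FamLaurent t)
    (hT : ∀ t ∈ T, SlicesIn R fun w => substVar ibinom 0 j (t w))
    {Q : W → FSeries (Fin 3) W} (hQ : Q ∈ psSpan (X i - X i') T) :
    SlicesIn R fun w => substVar ibinom 0 j (Q w) := by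
  refine slicesIn_of_span hj ?_ ?_ hQ
  · rintro Q ⟨φ, t, ht, rfl⟩
    exact (hTL t ht).famPs _ _
  · rintro Q ⟨φ, t, ht, rfl⟩
    exact SlicesIn.famPs (hTL t ht) hRφ hj hδ (hT t ht) fun m w =>
      isLaurent_slice_substVar (hTL t ht w) hj m

/-- Permuting the variables of a Laurent triple product. -/
theorem exists_famLaurent_perm {F : W → FSeries (Fin 3) W}
    (h : ∃ n : ℕ, FamLaurent (famMul (disc ^ n) F)) (σ : Equiv.Perm (Fin 3)) {ε : ℂ}
    (hσ : rename σ.symm disc = C ε * disc) :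
    ∃ n : ℕ, FamLaurent (famMul (disc ^ n) fun w e => F w (e ∘ σ)) := by
  obtain ⟨n, hn⟩ := h
  refine ⟨n, fun w => ?_⟩
  have h1 := polyMul_comp (κ := Fin 3) σ.symm (fun e => e ∘ σ) (fun e i => by
    have : bv i ∘ σ = bv (σ.symm i) := by
      funext l; simp [bv_apply, Equiv.eq_symm_apply]
    rw [← this]; rfl) (disc ^ n) (F w)
  rw [famMul_apply, ← h1, map_pow, hσ, mul_pow, ← map_pow, polyMul_C_mul]
  obtain ⟨N, hN⟩ := (hn w).smul (ε ^ n)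
  exact ⟨N, fun e ⟨i, hi⟩ => hN _ ⟨σ.symm i, by simpa using hi⟩⟩

theorem indep_zero_two : Indep (![0, 2] : Fin 2 → Fin 3) fun e : Fin 3 → ℤ => e 1 where
  injective := by decide
  add_smul e k t := by fin_cases k <;> simp [bv_apply]

theorem indep_zero_one' : Indep (![0, 1] : Fin 2 → Fin 3) fun e : Fin 3 → ℤ => e 2 where
  injective := by decide
  add_smul e k t := by fin_cases k <;> simp [bv_apply]

theorem indep_one_two : Indep (![1, 2] : Fin 2 → Fin 3) fun e : Fin 3 → ℤ => e 0 where
  injective := by decide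
  add_smul e k t := by fin_cases k <;> simp [bv_apply]

theorem indep_one_zero : Indep (![1, 0] : Fin 2 → Fin 3) fun e : Fin 3 → ℤ => e 2 where
  injective := by decide
  add_smul e k t := by fin_cases k <;> simp [bv_apply]

/-- If `A` is local with respect to `B`, then so are the products of elements of `A`. -/
theorem MutuallyLocal.nthProd_left (hAA : MutuallyLocal A A) (hAB : MutuallyLocal A B)
    (hBA : MutuallyLocal B A) {A' : Submodule ℂ (VertexOperator ℂ W)}
    (hA' : ∀ a ∈ A, ∀ b ∈ A, ∀ n, nthProd a b n ∈ A') {a b c : VertexOperator ℂ W} (ha : a ∈ A)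
    (hb : b ∈ A) (hc : c ∈ B) (n : ℤ) : pairSeries (nthProd a b n) c ∈ swapFam A' B := by
  let 𝒢 : Set (VertexOperator ℂ W × VertexOperator ℂ W × (ℤ → W →ₗ[ℂ] W) × (ℤ → W → W)) :=
    {x | ∃ a ∈ A, ∃ b ∈ A, ∃ c ∈ B, x = (a, b, HVertexOperator.coeff c, fun _ w => w)}
  have h01 : (1 : Fin 3) ≠ 0 := by decide
  have hT0 := famLaurent_clearedSpan (j := 1) (g := 2) (𝒢 := 𝒢)
  have hD0 := diffClosed_clearedSpan (j := 1) (g := 2) (𝒢 := 𝒢)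
  -- Second exchange: in a(x₀)u(x₂)v(x₁) the field u is moved past a, which leaves c'(x₂)a'(x₀)v(x₁)
  -- with power series in x₂ - x₀.
  have hstep : ∀ u ∈ B, ∀ v ∈ A, ∃ K : ℕ, famMul (disc ^ K) (famLift ![1, 2] 0
      (HVertexOperator.coeff a) (fun _ w => w) (pairSeriesSwap u v)) ∈
        psSpan (X 2 - X 0) (clearedSpan 1 2 𝒢) := by
    intro u hu v hv
    have h1 := exists_disc_mem_psSpan (f := ![0, 2]) (g := 1) (α := fun _ => LinearMap.id)
      (β := fun m w => HVertexOperator.coeff v m w) indep_zero_two (r := (X 0 - X 1) * (X 1 - X 2))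
      (mul_mem (diff_mem (by decide)) (diff_mem (by decide)))
      (by simp only [disc, Matrix.cons_val_zero, Matrix.cons_val_one]; ring) hT0 hD0 ?_
      (hAB a ha u hu)
    · exact h1
    · intro c' hc' a' ha'
      have h2 : famLift ![0, 2] 1 (fun _ => LinearMap.id) (fun m w => HVertexOperator.coeff v m w)
          (pairSeriesSwap c' a') = famLift ![0, 1] 2 (HVertexOperator.coeff c') (fun _ w => w)
            (pairSeries a' v) := by
        funext w e
        simp [famLift, lift, pairSeries, pairSeriesSwap]
      -- The exchanged product is a triple product with its variables permuted, so its poles are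
      -- cleared by a power of `disc`, which the permutation preserves.
      have h3 : (fun w e => tripleSeries c' a' v w (e ∘ (finRotate 3).symm)) =
          famLift ![0, 1] 2 (HVertexOperator.coeff c') (fun _ w => w) (pairSeries a' v) := by
        funext w e
        simp only [famLift, lift, pairSeries, tripleSeries]
        rfl
      have hG : (a', v, HVertexOperator.coeff c', fun _ w => w) ∈ 𝒢 :=
        ⟨a', ha', v, hv, c', hc', rfl⟩
      have hσ := exists_famLaurent_perm (exists_isLaurent_tripleSeries hBA hBA hAA hc' ha' hv)
        ((finRotate 3).symm) (ε := 1) (by simp [disc]; ring)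
      rw [h2]
      rw [h3] at hσ
      exact mem_clearedSpan h01 hG (hAA.diagCompat ha' hv) hσ
  have hD1 := hD0.psSpan (isHomogeneous_diff 2 0) hT0
  have hT1 : ∀ t ∈ psSpan (X 2 - X 0) (clearedSpan 1 2 𝒢), FamLaurent t :=
    fun t ht => famLaurent_psSpan hT0 ht
  -- First exchange: c(x₂) moves past b(x₁), and the result is fed into the second exchange.
  obtain ⟨K, hK⟩ := exists_disc_mem_psSpan (f := ![1, 2]) (g := 0) (α := HVertexOperator.coeff a)
    (β := fun _ w => w) indep_one_two (r := (X 0 - X 1) * (X 0 - X 2))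
    (mul_mem (diff_mem (by decide)) (diff_mem (by decide)))
    (by simp only [disc, Matrix.cons_val_zero, Matrix.cons_val_one]) hT1 hD1 hstep (hAB b hb c hc)
  have hD2 := hD1.psSpan (isHomogeneous_diff 2 1) hT1
  obtain ⟨M, hM⟩ := hAA.diagCompat ha hb
  -- Substituting x₀ + x₁ for x₀ in c'(x₂)a'(x₀)b'(x₁) produces the swapped products of c' with the
  -- fields a'ₘb' in A'.
  have hS0 : ∀ t ∈ clearedSpan 1 2 𝒢,
      SlicesIn (swapFam A' B) fun w => substVar ibinom 0 1 (t w) := by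
    intro t ht
    refine slicesIn_clearedSpan diagStable_swapFam h01 indep_zero_one' ?_ ht
    rintro a₁ b₁ _ _ ⟨a', ha', b', hb', c', hc', hx⟩ m hm
    simp only [Prod.mk.injEq] at hx
    obtain ⟨rfl, rfl, rfl, rfl⟩ := hx
    have h3 : (fun w => slice m (famLift ![0, 1] 2 (HVertexOperator.coeff c')
        (fun _ w => w) (prodOpe a₁ b₁) w)) = pairSeriesSwap c' (nthProd a₁ b₁ (-m - 1)) := by
      funext w e
      simp [slice, famLift, lift, prodOpe, pairSeriesSwap]
    rw [h3] at hm ⊢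
    exact pairSeriesSwap_mem_swapFam hc' (hA' _ ha' _ hb' (-m - 1)) hm
  have hS1 : ∀ t ∈ psSpan (X 2 - X 0) (clearedSpan 1 2 𝒢),
      SlicesIn (swapFam A' B) fun w => substVar ibinom 0 1 (t w) := fun t ht =>
    -- Under the substitution x₂ - x₀ becomes (x₂ - x₁) - x₀, whereas x₂ - x₁ in the next step does
    -- not change.
    slicesIn_psSpan h01 (s := -1) (by simp [substPoly]; ring)
      (fun Q hQ hL χ => famPs_mem_swapFam hL hQ χ) hT0 hS0 ht
  have hS2 := slicesIn_psSpan h01 (i := 2) (i' := 1) (s := 0) (by simp [substPoly])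
      (fun Q hQ hL χ => famPs_mem_swapFam hL hQ χ) hT1 hS1
      (hD2 _ (pow_mem (diff_mem (show (0 : Fin 3) ≠ 1 by decide)) M) _ hK)
  rw [← famMul_mul, mul_comm] at hS2
  -- On the other side, the same substitution produces (aₙb)(x₁)c(x₂) times elementary factors. The
  -- extra M factors x₀ - x₁ clear the poles of a(x₀)b(x₁).
  have h1 := slicesIn_prodOpe (α := fun _ => LinearMap.id) (β := fun m w => HVertexOperator.coeff c m w)
    diagStable_swapFam h01 indep_zero_one' hM (pow_mem disc_mem K) hS2
  have h2 := h1 (-n - 1)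
  have h3 : (fun w => slice (-n - 1) (famLift ![0, 1] 2 (fun _ => LinearMap.id)
      (fun m w => HVertexOperator.coeff c m w) (prodOpe a b) w)) = pairSeries (nthProd a b n) c := by
    funext w e
    simp [slice, famLift, lift, prodOpe, pairSeries]
  rwa [h3] at h2

/-- If `D` is local with respect to `A`, then also with respect to the products of elements of
`A`. -/
theorem MutuallyLocal.nthProd_right (hAA : MutuallyLocal A A) (hCA : MutuallyLocal D A)
    (hAC : MutuallyLocal A D) {A' : Submodule ℂ (VertexOperator ℂ W)}
    (hA' : ∀ a ∈ A, ∀ b ∈ A, ∀ n, nthProd a b n ∈ A') {a b c : VertexOperator ℂ W} (ha : a ∈ D)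
    (hb : b ∈ A) (hc : c ∈ A) (n : ℤ) : pairSeries a (nthProd b c n) ∈ swapFam D A' := by
  let 𝒢 : Set (VertexOperator ℂ W × VertexOperator ℂ W × (ℤ → W →ₗ[ℂ] W) × (ℤ → W → W)) :=
    {x | ∃ b ∈ A, ∃ c ∈ A, ∃ a ∈ D, x = (b, c, (fun _ => LinearMap.id : ℤ → W →ₗ[ℂ] W),
      fun m w => HVertexOperator.coeff a m w)}
  have h02 : (2 : Fin 3) ≠ 0 := by decide
  have hT0 := famLaurent_clearedSpan (j := 2) (g := 1) (𝒢 := 𝒢)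
  have hD0 := diffClosed_clearedSpan (j := 2) (g := 1) (𝒢 := 𝒢)
  -- Here the product is a(x₁)b(x₀)c(x₂), so that b and c merge under x₀ ↦ x₀ + x₂. The field a
  -- moves past b first; this is its second exchange, past c.
  have hstep : ∀ u ∈ A, ∀ v ∈ D, ∃ K : ℕ, famMul (disc ^ K) (famLift ![1, 0] 2
      (fun _ => LinearMap.id) (fun m w => HVertexOperator.coeff c m w) (pairSeriesSwap u v)) ∈
        psSpan (X 2 - X 1) (clearedSpan 2 1 𝒢) := by
    intro u hu v hv
    have h1 := exists_disc_mem_psSpan (f := ![1, 2]) (g := 0) (α := HVertexOperator.coeff u)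
      (β := fun _ w => w) indep_one_two (r := (X 0 - X 1) * (X 0 - X 2))
      (mul_mem (diff_mem (by decide)) (diff_mem (by decide)))
      (by simp only [disc, Matrix.cons_val_zero, Matrix.cons_val_one]) hT0 hD0 ?_
      (hCA v hv c hc)
    · exact h1
    · intro c' hc' a' ha'
      have h2 : famLift ![1, 2] 0 (HVertexOperator.coeff u) (fun _ w => w)
          (pairSeriesSwap c' a') = famLift ![0, 2] 1 (fun _ => LinearMap.id)
            (fun m w => HVertexOperator.coeff a' m w) (pairSeries u c') := by
        funext w e
        simp [famLift, lift, pairSeries, pairSeriesSwap]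
      have h3 : (fun w e => tripleSeries u c' a' w (e ∘ Equiv.swap 1 2)) =
          famLift ![0, 2] 1 (fun _ => LinearMap.id)
            (fun m w => HVertexOperator.coeff a' m w) (pairSeries u c') := by
        funext w e
        simp only [famLift, lift, pairSeries, tripleSeries]
        rfl
      have hG : (u, c', (fun _ => LinearMap.id : ℤ → W →ₗ[ℂ] W),
          fun m w => HVertexOperator.coeff a' m w) ∈ 𝒢 := ⟨u, hu, c', hc', a', ha', rfl⟩
      have hσ := exists_famLaurent_perm (exists_isLaurent_tripleSeries hAA hAC hAC hu hc' ha')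
        (Equiv.swap 1 2) (ε := -1) (by
          simp only [disc, map_mul, map_sub, rename_X, Equiv.symm_swap, map_neg, map_one,
            Equiv.swap_apply_left, Equiv.swap_apply_right,
            Equiv.swap_apply_of_ne_of_ne (show (0 : Fin 3) ≠ 1 by decide)
              (show (0 : Fin 3) ≠ 2 by decide)]
          ring)
      rw [h2]
      rw [h3] at hσ
      exact mem_clearedSpan h02 hG (hAA.diagCompat hu hc') hσ
  have hD1 := hD0.psSpan (isHomogeneous_diff 2 1) hT0
  have hT1 : ∀ t ∈ psSpan (X 2 - X 1) (clearedSpan 2 1 𝒢), FamLaurent t :=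
    fun t ht => famLaurent_psSpan hT0 ht
  obtain ⟨K, hK⟩ := exists_disc_mem_psSpan (f := ![1, 0]) (g := 2) (α := fun _ => LinearMap.id)
    (β := fun m w => HVertexOperator.coeff c m w) indep_one_zero (r := (X 0 - X 2) * (X 2 - X 1))
    (mul_mem (diff_mem (by decide)) (diff_mem (by decide)))
    (by simp only [disc, Matrix.cons_val_zero, Matrix.cons_val_one]; ring) hT1 hD1 hstep
    (hCA a ha b hb)
  have hD2 := hD1.psSpan (isHomogeneous_diff 0 1) hT1
  obtain ⟨M, hM⟩ := hAA.diagCompat hb hc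
  have hS0 : ∀ t ∈ clearedSpan 2 1 𝒢,
      SlicesIn (swapFam D A') fun w => substVar ibinom 0 2 (t w) := by
    intro t ht
    refine slicesIn_clearedSpan diagStable_swapFam h02 indep_zero_two ?_ ht
    rintro b₁ c₁ _ _ ⟨b', hb', c', hc', a', ha', hx⟩ m hm
    simp only [Prod.mk.injEq] at hx
    obtain ⟨rfl, rfl, rfl, rfl⟩ := hx
    have h3 : (fun w => slice m (famLift ![0, 2] 1 (fun _ => LinearMap.id)
        (fun m w => HVertexOperator.coeff a' m w) (prodOpe b₁ c₁) w)) =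
        pairSeriesSwap (nthProd b₁ c₁ (-m - 1)) a' := by
      funext w e
      simp [slice, famLift, lift, prodOpe, pairSeriesSwap]
    rw [h3] at hm ⊢
    exact pairSeriesSwap_mem_swapFam (hA' _ hb' _ hc' (-m - 1)) ha' hm
  have hS1 : ∀ t ∈ psSpan (X 2 - X 1) (clearedSpan 2 1 𝒢),
      SlicesIn (swapFam D A') fun w => substVar ibinom 0 2 (t w) := fun t ht =>
    slicesIn_psSpan h02 (s := 0) (by simp [substPoly])
      (fun Q hQ hL χ => famPs_mem_swapFam hL hQ χ) hT0 hS0 ht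
  -- Exchanging a and b gave power series in x₀ - x₁, which becomes (x₂ - x₁) + x₀.
  have hS2 := slicesIn_psSpan h02 (i := 0) (i' := 1) (s := 1) (by simp [substPoly]; ring)
      (fun Q hQ hL χ => famPs_mem_swapFam hL hQ χ) hT1 hS1
      (hD2 _ (pow_mem (diff_mem (show (0 : Fin 3) ≠ 2 by decide)) M) _ hK)
  rw [← famMul_mul, mul_comm] at hS2
  have h1 := slicesIn_prodOpe (α := HVertexOperator.coeff a) (β := fun _ w => w)
    diagStable_swapFam h02 indep_zero_two hM (pow_mem disc_mem K) hS2
  have h2 := h1 (-n - 1)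
  have h3 : (fun w => slice (-n - 1) (famLift ![0, 2] 1 (HVertexOperator.coeff a)
      (fun _ w => w) (prodOpe b c) w)) = pairSeries a (nthProd b c n) := by
    funext w e
    simp [slice, famLift, lift, prodOpe, pairSeries]
  rwa [h3] at h2

end Dong

/-! ### From `𝒮`-locality to mutual locality -/

section Expansion

variable {V : Type*} [AddCommGroup V] [Module ℂ V]

theorem IsIterLaurent.support_finite {g : FSeries (Fin 2) ℂ} (hg : IsIterLaurent g)
    {E : FSeries (Fin 2) V} (hE : IsIterLaurent E) (e : Fin 2 → ℤ) :
    (Function.support fun d => g d • E (e - d)).Finite := by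
  obtain ⟨⟨N, hN⟩, h2⟩ := hE
  obtain ⟨⟨M, hM⟩, h3⟩ := hg
  choose K hK using h2
  choose k hk using h3
  refine ((Set.finite_Icc M (e 0 - N)).biUnion fun a _ =>
    Set.finite_Icc ![a, k a] ![a, e 1 - K (e 0 - a)]).subset fun d hd => ?_
  have h1 : M ≤ d 0 := by
    by_contra hc
    exact hd (by beta_reduce; rw [hM _ (not_le.mp hc), zero_smul])
  have h2 : d 0 ≤ e 0 - N := by
    by_contra hc
    exact hd (by beta_reduce; rw [hN _ (by simp; omega), smul_zero])
  have h3 : k (d 0) ≤ d 1 := by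
    by_contra hc
    exact hd (by beta_reduce; rw [hk _ _ rfl (not_le.mp hc), zero_smul])
  have h4 : d 1 ≤ e 1 - K (e 0 - d 0) := by
    by_contra hc
    exact hd (by beta_reduce; rw [hK (e 0 - d 0) _ (by simp) (by simp; omega), smul_zero])
  simp only [Set.mem_iUnion]
  refine ⟨d 0, ⟨h1, h2⟩, ?_⟩
  constructor <;> intro q <;> fin_cases q <;> first | exact le_rfl | simpa

theorem seriesMul_add_left {g h : FSeries (Fin 2) ℂ} (hg : IsIterLaurent g)
    (hh : IsIterLaurent h) {E : FSeries (Fin 2) V} (hE : IsIterLaurent E) :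
    seriesMul (g + h) E = seriesMul g E + seriesMul h E := by
  funext e
  simp only [seriesMul, Pi.add_apply, add_smul]
  exact finsum_add_distrib (hg.support_finite hE e) (hh.support_finite hE e)

theorem seriesMul_smul_left (c : ℂ) (g : FSeries (Fin 2) ℂ) (E : FSeries (Fin 2) V) :
    seriesMul (c • g) E = c • seriesMul g E := by
  funext e
  simp only [seriesMul, Pi.smul_apply, smul_finsum, smul_assoc]

theorem seriesMul_smul_right (c : ℂ) (g : FSeries (Fin 2) ℂ) (E : FSeries (Fin 2) V) :
    seriesMul g (c • E) = c • seriesMul g E := by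
  funext e
  simp only [seriesMul, Pi.smul_apply, smul_finsum]
  exact finsum_congr fun d => smul_comm _ _ _

theorem seriesMul_add_right {g : FSeries (Fin 2) ℂ} (hg : IsIterLaurent g)
    {E E' : FSeries (Fin 2) V} (hE : IsIterLaurent E) (hE' : IsIterLaurent E') :
    seriesMul g (E + E') = seriesMul g E + seriesMul g E' := by
  funext e
  simp only [seriesMul, Pi.add_apply, smul_add]
  exact finsum_add_distrib (hg.support_finite hE e) (hg.support_finite hE' e)

theorem IsIterLaurent.smul {E : FSeries (Fin 2) V} (h : IsIterLaurent E) (c : ℂ) :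
    IsIterLaurent (c • E) := by
  obtain ⟨⟨N, hN⟩, h2⟩ := h
  refine ⟨⟨N, fun e he => by rw [Pi.smul_apply, hN e he, smul_zero]⟩, fun m => ?_⟩
  obtain ⟨K, hK⟩ := h2 m
  exact ⟨K, fun e h1 h2 => by rw [Pi.smul_apply, hK e h1 h2, smul_zero]⟩

theorem seriesMul_polyMul_X_right (i : Fin 2) (g : FSeries (Fin 2) ℂ) (E : FSeries (Fin 2) V) :
    seriesMul g (polyMul (X i) E) = polyMul (X i) (seriesMul g E) := by
  funext e
  rw [polyMul_X]
  refine finsum_congr fun d => ?_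
  rw [polyMul_X, sub_right_comm]

theorem seriesMul_polyMul_X_left (i : Fin 2) (g : FSeries (Fin 2) ℂ) (E : FSeries (Fin 2) V) :
    seriesMul (polyMul (X i) g) E = polyMul (X i) (seriesMul g E) := by
  funext e
  rw [polyMul_X]
  simp only [seriesMul]
  rw [← finsum_comp_equiv (Equiv.addRight (bv i))
    (f := fun d => polyMul (X i) g d • E (e - d))]
  refine finsum_congr fun d => ?_
  rw [polyMul_X, Equiv.coe_addRight, add_sub_cancel_right, sub_right_comm, sub_sub]

theorem seriesMul_polyMul_diff_right {g : FSeries (Fin 2) ℂ} (hg : IsIterLaurent g)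
    {E : FSeries (Fin 2) V} (hE : IsIterLaurent E) :
    seriesMul g (polyMul (X 1 - X 0) E) = polyMul (X 1 - X 0) (seriesMul g E) := by
  rw [polyMul_sub_left, sub_eq_add_neg, ← neg_one_smul ℂ (polyMul (X 0) E),
    seriesMul_add_right hg (hE.polyMul _) ((hE.polyMul _).smul _), seriesMul_smul_right,
    seriesMul_polyMul_X_right, seriesMul_polyMul_X_right, neg_one_smul, ← sub_eq_add_neg,
    polyMul_sub_left]

theorem seriesMul_polyMul_diff_left {g : FSeries (Fin 2) ℂ} (hg : IsIterLaurent g)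
    {E : FSeries (Fin 2) V} (hE : IsIterLaurent E) :
    seriesMul (polyMul (X 1 - X 0) g) E = polyMul (X 1 - X 0) (seriesMul g E) := by
  rw [polyMul_sub_left, sub_eq_add_neg, ← neg_one_smul ℂ (polyMul (X 0) g),
    seriesMul_add_left (hg.polyMul _) ((hg.polyMul _).smul _) hE, seriesMul_smul_left,
    seriesMul_polyMul_X_left, seriesMul_polyMul_X_left, neg_one_smul, ← sub_eq_add_neg,
    polyMul_sub_left]

/-- `∑ₙ cₙ (x₂ - x₁)ⁿ`, expanded in nonnegative powers of `x₁`. -/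
def expandCoeff (c : ℤ → ℂ) : FSeries (Fin 2) ℂ :=
  fun e => c (e 0 + e 1) * ((ibinom (e 0 + e 1) (e 0) : ℤ) : ℂ) * (-1) ^ (e 0)

theorem expandDiff_eq_expandCoeff (f : LaurentSeries ℂ) :
    expandDiff f = expandCoeff f.coeff := rfl

theorem bddAt_expandCoeff (c : ℤ → ℂ) : BddAt 0 0 (expandCoeff c) := fun e he => by
  simp [expandCoeff, ibinom_of_neg _ he]

theorem isIterLaurent_expandCoeff {c : ℤ → ℂ} {B : ℤ} (hc : ∀ n < B, c n = 0) :
    IsIterLaurent (expandCoeff c) :=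
  ⟨⟨0, bddAt_expandCoeff c⟩, fun m => ⟨B - m, fun e h1 h2 => by
    simp [expandCoeff, hc (e 0 + e 1) (by omega)]⟩⟩

/-- The Pascal recursion makes the expansion compatible with multiplication by x₂ - x₁. -/
theorem expandCoeff_shift (c : ℤ → ℂ) :
    expandCoeff (fun n => c (n - 1)) = polyMul (X 1 - X 0) (expandCoeff c) := by
  funext e
  rw [polyMul_sub_left, Pi.sub_apply, polyMul_X, polyMul_X]
  simp only [expandCoeff, Pi.sub_apply, bv_self, bv_ne (show (0 : Fin 2) ≠ 1 by decide),
    bv_ne (show (1 : Fin 2) ≠ 0 by decide), sub_zero]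
  have h1 := isPascal_ibinom (e 0 + e 1 - 1) (e 0)
  rw [sub_add_cancel] at h1
  rw [h1, show e 0 + (e 1 - 1) = e 0 + e 1 - 1 by ring, show e 0 - 1 + e 1 = e 0 + e 1 - 1 by ring,
    zpow_sub_one₀ (by norm_num)]
  push_cast
  ring

theorem expandCoeff_shift_pow (c : ℤ → ℂ) (n : ℕ) :
    expandCoeff (fun m => c (m - n)) = polyMul ((X 1 - X 0) ^ n) (expandCoeff c) := by
  induction n with
  | zero => simp
  | succ n ih =>
    rw [pow_succ', polyMul_mul, ← ih, ← expandCoeff_shift fun m => c (m - n)]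
    congr 1
    funext m
    congr 1
    push_cast
    ring

theorem ibinom_zero_left (c : ℤ) : ibinom 0 c = if c = 0 then 1 else 0 := by
  rcases lt_trichotomy c 0 with hc | rfl | hc
  · rw [ibinom_of_neg _ hc, if_neg hc.ne]
  · simp
  · obtain ⟨n, rfl⟩ := Int.eq_ofNat_of_zero_le hc.le
    have := ibinom_natCast_natCast 0 n
    rw [Nat.choose_eq_zero_of_lt (by omega)] at this
    rw [if_neg hc.ne']
    exact_mod_cast this

theorem seriesMul_expandCoeff_single_zero (E : FSeries (Fin 2) V) :
    seriesMul (expandCoeff (Pi.single 0 1)) E = E := by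
  funext e
  rw [seriesMul, finsum_eq_single _ 0]
  · simp [expandCoeff]
  · intro d hd
    have : expandCoeff (Pi.single 0 1) d = 0 := by
      by_cases h : d 0 + d 1 = 0
      · have h0 : d 0 ≠ 0 := fun h0 => hd (by funext i; fin_cases i; exacts [h0, by simpa [h0] using h])
        simp [expandCoeff, h, ibinom_zero_left, h0]
      · simp [expandCoeff, h]
    rw [this, zero_smul]

theorem seriesMul_polyMul_diff_pow_left {g : FSeries (Fin 2) ℂ} (hg : IsIterLaurent g)
    {E : FSeries (Fin 2) V} (hE : IsIterLaurent E) (n : ℕ) :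
    seriesMul (polyMul ((X 1 - X 0) ^ n) g) E = polyMul ((X 1 - X 0) ^ n) (seriesMul g E) := by
  induction n with
  | zero => simp
  | succ n ih =>
    rw [pow_succ', polyMul_mul, seriesMul_polyMul_diff_left (hg.polyMul _) hE, ih, polyMul_mul]

theorem seriesMul_polyMul_diff_pow_right {g : FSeries (Fin 2) ℂ} (hg : IsIterLaurent g)
    {E : FSeries (Fin 2) V} (hE : IsIterLaurent E) (n : ℕ) :
    seriesMul g (polyMul ((X 1 - X 0) ^ n) E) = polyMul ((X 1 - X 0) ^ n) (seriesMul g E) := by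
  induction n with
  | zero => simp
  | succ n ih =>
    rw [pow_succ', polyMul_mul, seriesMul_polyMul_diff_right hg (hE.polyMul _), ih, polyMul_mul]

theorem seriesMul_expandCoeff_single (n : ℕ) {E : FSeries (Fin 2) V} (hE : IsIterLaurent E) :
    seriesMul (expandCoeff (Pi.single (n : ℤ) 1)) E = polyMul ((X 1 - X 0) ^ n) E := by
  have h1 : (Pi.single (n : ℤ) 1 : ℤ → ℂ) = fun m => (Pi.single 0 1 : ℤ → ℂ) (m - n) := by
    funext m
    simp [Pi.single_apply, sub_eq_zero]
  have h2 : IsIterLaurent (expandCoeff (Pi.single 0 1)) :=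
    isIterLaurent_expandCoeff (B := 0) fun n hn => by simp [hn.ne]
  rw [h1, expandCoeff_shift_pow, seriesMul_polyMul_diff_pow_left h2 hE,
    seriesMul_expandCoeff_single_zero]

theorem expandCoeff_add (c c' : ℤ → ℂ) :
    expandCoeff (c + c') = expandCoeff c + expandCoeff c' := by
  funext e; simp [expandCoeff, add_mul]

theorem expandCoeff_smul (a : ℂ) (c : ℤ → ℂ) : expandCoeff (a • c) = a • expandCoeff c := by
  funext e; simp [expandCoeff, mul_assoc]

theorem seriesMul_expandCoeff_sum (φ : PowerSeries ℂ) (J : ℕ) {E : FSeries (Fin 2) V}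
    (hE : IsIterLaurent E) :
    seriesMul (expandCoeff (∑ n ∈ Finset.range J, PowerSeries.coeff n φ • Pi.single (n : ℤ) 1)) E =
      ∑ n ∈ Finset.range J, PowerSeries.coeff n φ • polyMul ((X 1 - X 0) ^ n) E := by
  have hs : ∀ n : ℕ, IsIterLaurent (expandCoeff (PowerSeries.coeff n φ • Pi.single (n : ℤ) 1)) :=
    fun n => isIterLaurent_expandCoeff (B := 0) fun m hm => by simp [show m ≠ n by omega]
  induction J with
  | zero =>
    funext e
    simp [seriesMul, expandCoeff]
  | succ J ih =>
    rw [Finset.sum_range_succ, Finset.sum_range_succ, expandCoeff_add,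
      seriesMul_add_left (isIterLaurent_expandCoeff (B := 0) fun m hm => ?_) (hs J) hE, ih,
      expandCoeff_smul, seriesMul_smul_left, seriesMul_expandCoeff_single J hE]
    rw [Finset.sum_apply]
    exact Finset.sum_eq_zero fun n _ => by simp [show m ≠ n by omega]

/-- For a power series `φ`, the expansion of `φ(x₂ - x₁)` acts as `psMul`. -/
theorem seriesMul_expandCoeff_eq_psMul (φ : PowerSeries ℂ) {c : ℤ → ℂ} (hc : ∀ n < 0, c n = 0)
    (hφ : ∀ n : ℕ, c n = PowerSeries.coeff n φ) {E : FSeries (Fin 2) V} (hE : IsLaurent E)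
    (hE' : IsIterLaurent E) :
    seriesMul (expandCoeff c) E = psMul φ (X 1 - X 0) E := by
  obtain ⟨N, hN⟩ := hE.degBdd
  funext e
  set J := (deg e - N).toNat + 1 with hJ
  rw [psMul_eq_sum φ (J := J) fun n hn =>
    hN.polyMul_pow_eq_zero (isHomogeneous_diff _ _) (by omega)]
  have h1 := congrFun (seriesMul_expandCoeff_sum φ J hE') e
  rw [Finset.sum_apply] at h1
  refine Eq.trans ?_ h1
  refine finsum_congr fun d => ?_
  -- Beyond this degree the factor from E vanishes. Up to it, the truncation of φ at J retains every
  -- coefficient that occurs.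
  by_cases hd : deg e - N < deg d
  · rw [hN _ (by rw [deg_sub]; omega), smul_zero, smul_zero]
  · congr 1
    have hdeg : deg d = d 0 + d 1 := by simp [deg, Fin.sum_univ_two]
    simp only [expandCoeff]
    congr 2
    rcases lt_or_ge (d 0 + d 1) 0 with h | h
    · rw [hc _ h, Finset.sum_apply, Finset.sum_eq_zero]
      exact fun n _ => by simp [show d 0 + d 1 ≠ n by omega]
    · obtain ⟨n, hn⟩ := Int.eq_ofNat_of_zero_le h
      rw [hn, hφ, Finset.sum_apply, Finset.sum_eq_single n]
      · simp
      · intro m _ hm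
        simp [hm.symm]
      · intro hm
        simp only [Finset.mem_range] at hm
        omega

/-- After multiplication by a high power of `x₂ - x₁`, a Laurent series in `x₂ - x₁` acts as a power
series. -/
theorem polyMul_seriesMul_expandDiff (ψ : LaurentSeries ℂ) (K : ℕ) :
    ∃ M : ℕ, ∀ n ≥ M, ∃ φ : PowerSeries ℂ, ∀ E : FSeries (Fin 2) V, IsIterLaurent E →
      IsLaurent (polyMul ((X 1 - X 0) ^ K) E) →
      polyMul ((X 1 - X 0) ^ n) (seriesMul (expandDiff ψ) E) =
        psMul φ (X 1 - X 0) (polyMul ((X 1 - X 0) ^ K) E) := by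
  have hB : ∀ n < ψ.order, ψ.coeff n = 0 := fun n hn => HahnSeries.coeff_eq_zero_of_lt_order hn
  -- K factors make E a Laurent series and the others cancel the pole of ψ at zero.
  refine ⟨K + (-ψ.order).toNat, fun n hn => ?_⟩
  obtain ⟨j, rfl⟩ := Nat.exists_eq_add_of_le (show K ≤ n by omega)
  refine ⟨PowerSeries.mk fun i => ψ.coeff (i - j), fun E hE hL => ?_⟩
  have h1 : IsIterLaurent (expandCoeff ψ.coeff) := isIterLaurent_expandCoeff hB
  rw [expandDiff_eq_expandCoeff, add_comm K j, pow_add, polyMul_mul,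
    ← seriesMul_polyMul_diff_pow_right h1 hE,
    ← seriesMul_polyMul_diff_pow_left h1 (hE.polyMul _), ← expandCoeff_shift_pow]
  exact seriesMul_expandCoeff_eq_psMul _ (fun m hm => hB _ (by omega)) (fun m => by simp) hL
    (hE.polyMul _)

theorem BddAt.seriesMul_expandDiff (ψ : LaurentSeries ℂ) {N : ℤ} {E : FSeries (Fin 2) V}
    (hE : BddAt 0 N E) : BddAt 0 N (seriesMul (expandDiff ψ) E) := fun e he => by
  refine finsum_eq_zero_of_forall_eq_zero fun d => ?_
  rcases lt_or_ge (d 0) 0 with h | h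
  · rw [expandDiff_eq_expandCoeff, bddAt_expandCoeff _ _ h, zero_smul]
  · rw [hE _ (by simp; omega), smul_zero]

end Expansion

/-! ### 𝒮-local sets, enlarged by the identity -/

section SLocal

variable {W : Type*} [AddCommGroup W] [Module ℂ W] {S : Set (VertexOperator ℂ W)}

theorem isIterLaurent_pairSeriesSwap (u v : VertexOperator ℂ W) (w : W) :
    IsIterLaurent (pairSeriesSwap u v w) := by
  refine ⟨?_, fun m => ?_⟩
  · obtain ⟨N, hN⟩ := coeff_lt_bound v w
    exact ⟨N, fun e he => by rw [pairSeriesSwap, hN _ he, map_zero]⟩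
  · obtain ⟨K, hK⟩ := coeff_lt_bound u (HVertexOperator.coeff v m w)
    exact ⟨K, fun e h1 h2 => by rw [pairSeriesSwap, h1, hK _ h2]⟩

theorem exists_bddAt_pairSeries (a b : VertexOperator ℂ W) (w : W) :
    ∃ N, BddAt 1 N (pairSeries a b w) := by
  obtain ⟨N, hN⟩ := coeff_lt_bound b w
  exact ⟨N, fun e he => by rw [pairSeries, hN _ he, map_zero]⟩

theorem exists_bddAt_sum {ι V : Type*} {s : Type*} [AddCommGroup V] (t : Finset s) (i : ι)
    (F : s → FSeries ι V) (h : ∀ j ∈ t, ∃ N, BddAt i N (F j)) : ∃ N, BddAt i N (∑ j ∈ t, F j) := by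
  classical
  induction t using Finset.induction_on with
  | empty => exact ⟨0, fun e _ => rfl⟩
  | insert j t hj ih =>
    obtain ⟨N, hN⟩ := ih fun l hl => h l (Finset.mem_insert_of_mem hl)
    obtain ⟨M, hM⟩ := h j (Finset.mem_insert_self j t)
    refine ⟨min M N, fun e he => ?_⟩
    rw [Finset.sum_insert hj, Pi.add_apply, hM e (by omega), hN e (by omega), add_zero]

/-- The powers of x₂ in a(x₁)b(x₂)w are bounded below in any case. Those of x₁ are bounded on the
other side of the locality relation, because ψᵢ(x₂ - x₁) is expanded in nonnegative powers of x₁. -/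
theorem IsSLocal.diagCompat (hS : IsSLocal S) {a b : VertexOperator ℂ W} (ha : a ∈ S)
    (hb : b ∈ S) : DiagCompat a b := by
  obtain ⟨k, r, ψ, u, v, -, h⟩ := hS a ha b hb
  refine ⟨k, fun w => isLaurent_iff.mpr fun i => ?_⟩
  fin_cases i
  · rw [h w]
    refine exists_bddAt_sum _ _ _ fun j _ => ?_
    obtain ⟨⟨N, hN⟩, -⟩ := isIterLaurent_pairSeriesSwap (u j) (v j) w
    exact ⟨N, (hN.seriesMul_expandDiff (ψ j)).polyMul _⟩
  · obtain ⟨N, hN⟩ := exists_bddAt_pairSeries a b w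
    exact ⟨N, hN.polyMul _⟩

theorem DiagCompat.exists_famLaurent_swap {u v : VertexOperator ℂ W} (h : DiagCompat u v) :
    ∃ K : ℕ, FamLaurent (famMul ((X 1 - X 0) ^ K) (pairSeriesSwap u v)) := by
  obtain ⟨K, hK⟩ := h
  refine ⟨K, fun w => ?_⟩
  have h1 := polyMul_comp (Equiv.swap (0 : Fin 2) 1) (fun e : Fin 2 → ℤ => e ∘ Equiv.swap 0 1)
    (fun e i => by
      funext l
      fin_cases i <;> fin_cases l <;> simp [bv_apply]) ((X 1 - X 0) ^ K) (pairSeries u v w)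
  have h2 : (fun e : Fin 2 → ℤ => pairSeries u v w (e ∘ Equiv.swap 0 1)) = pairSeriesSwap u v w := by
    funext e
    simp [pairSeries, pairSeriesSwap]
  rw [h2] at h1
  rw [famMul_apply, ← h1]
  obtain ⟨N, hN⟩ := hK w
  refine ⟨N, fun e ⟨i, hi⟩ => ?_⟩
  have h3 : rename (Equiv.swap (0 : Fin 2) 1) ((X 1 - X 0) ^ K : MvPolynomial (Fin 2) ℂ) =
      (X 0 - X 1) ^ K := by simp
  rw [h3]
  exact hN _ ⟨Equiv.swap 0 1 i, by simpa using hi⟩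

theorem coeff_idField (n : ℤ) (w : W) :
    HVertexOperator.coeff (idField W) n w = if n = 0 then w else 0 := by
  rw [show HVertexOperator.coeff (idField W) n = if n = 0 then 1 else 0 from rfl]
  split_ifs <;> rfl

theorem pairSeries_idField_left (a : VertexOperator ℂ W) :
    pairSeries (idField W) a = pairSeriesSwap a (idField W) := by
  funext w e
  rw [pairSeries, pairSeriesSwap, coeff_idField, coeff_idField]
  split_ifs <;> simp

theorem pairSeries_idField_right (a : VertexOperator ℂ W) :
    pairSeries a (idField W) = pairSeriesSwap (idField W) a := by
  funext w e
  rw [pairSeries, pairSeriesSwap, coeff_idField, coeff_idField]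
  split_ifs <;> simp

theorem famLaurent_pairSeries_idField_left (a : VertexOperator ℂ W) :
    FamLaurent (pairSeries (idField W) a) := fun w => by
  obtain ⟨N, hN⟩ := coeff_lt_bound a w
  refine isLaurent_iff.mpr fun i => ?_
  fin_cases i
  · exact ⟨0, fun e he => by rw [pairSeries, coeff_idField]; exact if_neg (ne_of_lt he)⟩
  · exact ⟨N, fun e he => by rw [pairSeries, show HVertexOperator.coeff a (e 1) w = 0 from hN _ he, map_zero]⟩

theorem famLaurent_pairSeries_idField_right (a : VertexOperator ℂ W) :
    FamLaurent (pairSeries a (idField W)) := fun w => by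
  obtain ⟨N, hN⟩ := coeff_lt_bound a w
  refine isLaurent_iff.mpr fun i => ?_
  fin_cases i
  · refine ⟨N, fun e he => ?_⟩
    rw [pairSeries, coeff_idField]
    split_ifs
    · exact hN _ he
    · exact map_zero _
  · exact ⟨0, fun e he => by
      have h0 : e 1 ≠ 0 := ne_of_lt he
      rw [pairSeries, coeff_idField, if_neg h0, map_zero]⟩

theorem IsSLocal.mutuallyLocal (hS : IsSLocal S) :
    MutuallyLocal (Submodule.span ℂ (insert (idField W) S))
      (Submodule.span ℂ (insert (idField W) S)) := by
  set A := Submodule.span ℂ (insert (idField W) S) with hA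
  have hSA : ∀ a ∈ S, a ∈ A := fun a ha => Submodule.subset_span (Or.inr ha)
  have h1A : idField W ∈ A := Submodule.subset_span (Or.inl rfl)
  have hbase : ∀ a ∈ S, ∀ b ∈ S, pairSeries a b ∈ swapFam A A := by
    intro a ha b hb
    obtain ⟨k, r, ψ, u, v, huv, h⟩ := hS a ha b hb
    have h1 : ∀ i, ∃ Q : ℕ, FamLaurent (famMul ((X 1 - X 0) ^ Q) (pairSeriesSwap (u i) (v i))) :=
      fun i => (hS.diagCompat (huv i).1 (huv i).2).exists_famLaurent_swap
    choose K hK using h1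
    choose M hM using fun i => polyMul_seriesMul_expandDiff (V := W) (ψ i) (K i)
    -- The summands have different thresholds; the sum exceeds all of them.
    set n := ∑ i, M i with hn
    have hle : ∀ i, M i ≤ n + k := fun i =>
      (Finset.single_le_sum (fun _ _ => Nat.zero_le _) (Finset.mem_univ i)).trans (Nat.le_add_right _ _)
    choose φ hφ using fun i => hM i (n + k) (hle i)
    refine ⟨n + k, ?_⟩
    have h2 : famMul ((X 0 - X 1) ^ (n + k)) (pairSeries a b) = ∑ i, (-1 : ℂ) ^ (n + k) •
        famPs (φ i) (X 1 - X 0) (famMul ((X 1 - X 0) ^ K i) (pairSeriesSwap (u i) (v i))) := by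
      funext w
      rw [famMul_apply, pow_add, polyMul_mul, h w, ← polyMul_sum, ← polyMul_mul, ← pow_add,
        polyMul_sum, Finset.sum_apply]
      refine Finset.sum_congr rfl fun i _ => ?_
      have h3 : (X 0 - X 1 : MvPolynomial (Fin 2) ℂ) ^ (n + k) =
          MvPolynomial.C ((-1) ^ (n + k)) * (X 1 - X 0) ^ (n + k) := by
        rw [map_pow, ← mul_pow]; simp
      rw [h3, polyMul_C_mul, hφ i _ (isIterLaurent_pairSeriesSwap _ _ _) (hK i w)]
      rfl
    rw [h2]
    exact Submodule.sum_mem _ fun i _ => Submodule.smul_mem _ _ (famPs_mem_psSpan _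
      (Submodule.subset_span ⟨K i, u i, hSA _ (huv i).1, v i, hSA _ (huv i).2, hK i, rfl⟩))
  have hdiag : ∀ {Q : W → FSeries (Fin 2) W}, FamLaurent Q → Q ∈ diagFam W W := fun h =>
    ⟨0, by simpa using h⟩
  -- The identity commutes with every field and the product has no poles, so the swapped product
  -- itself witnesses locality.
  have h1l : ∀ a ∈ A, pairSeries (idField W) a ∈ swapFam A A := fun a ha => by
    have := famLaurent_pairSeries_idField_left a
    rw [pairSeries_idField_left] at this ⊢
    exact pairSeriesSwap_mem_swapFam ha h1A (hdiag this)
  have h1r : ∀ a ∈ A, pairSeries a (idField W) ∈ swapFam A A := fun a ha => by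
    have := famLaurent_pairSeries_idField_right a
    rw [pairSeries_idField_right] at this ⊢
    exact pairSeriesSwap_mem_swapFam h1A ha (hdiag this)
  intro a ha b hb
  rw [hA] at ha hb
  induction ha using Submodule.span_induction with
  | zero => rw [pairSeries_zero_left]; exact zero_mem _
  | add a a' _ _ h h' => rw [pairSeries_add_left]; exact add_mem h h'
  | smul c a _ h => rw [pairSeries_smul_left]; exact Submodule.smul_mem _ c h
  | mem a ha =>
    induction hb using Submodule.span_induction with
    | zero => rw [pairSeries_zero_right]; exact zero_mem _
    | add b b' _ _ h h' => rw [pairSeries_add_right]; exact add_mem h h'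
    | smul c b _ h => rw [pairSeries_smul_right]; exact Submodule.smul_mem _ c h
    | mem b hb =>
      rcases ha with rfl | ha
      · exact h1l b (Submodule.subset_span hb)
      · rcases hb with rfl | hb
        · exact h1r a (hSA a ha)
        · exact hbase a ha b hb

end SLocal

/-! ### The subspace generated by an `𝒮`-local set -/

section Generated

variable {W : Type*} [AddCommGroup W] [Module ℂ W] {A B : Submodule ℂ (VertexOperator ℂ W)}
  {S : Set (VertexOperator ℂ W)}

/-- The span of `A` and of the products of elements of `A`. -/
def adjoinProducts (A : Submodule ℂ (VertexOperator ℂ W)) : Submodule ℂ (VertexOperator ℂ W) :=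
  A ⊔ Submodule.span ℂ {x | ∃ a ∈ A, ∃ b ∈ A, ∃ n, x = nthProd a b n}

theorem le_adjoinProducts (A : Submodule ℂ (VertexOperator ℂ W)) : A ≤ adjoinProducts A :=
  le_sup_left

theorem nthProd_mem_adjoinProducts {a b : VertexOperator ℂ W} (ha : a ∈ A) (hb : b ∈ A) (n : ℤ) :
    nthProd a b n ∈ adjoinProducts A :=
  Submodule.mem_sup_right (Submodule.subset_span ⟨a, ha, b, hb, n, rfl⟩)

theorem adjoinProducts_induction {p : VertexOperator ℂ W → Prop} (h1 : ∀ a ∈ A, p a)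
    (h2 : ∀ a ∈ A, ∀ b ∈ A, ∀ n, p (nthProd a b n)) (hadd : ∀ x y, p x → p y → p (x + y))
    (hsmul : ∀ (c : ℂ) x, p x → p (c • x)) {x : VertexOperator ℂ W} (hx : x ∈ adjoinProducts A) :
    p x := by
  obtain ⟨y, hy, z, hz, rfl⟩ := Submodule.mem_sup.mp hx
  refine hadd _ _ (h1 y hy) ?_
  clear hx
  induction hz using Submodule.span_induction with
  | mem z hz => obtain ⟨a, ha, b, hb, n, rfl⟩ := hz; exact h2 a ha b hb n
  | zero => exact h1 0 A.zero_mem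
  | add x y _ _ h h' => exact hadd x y h h'
  | smul c x _ h => exact hsmul c x h

theorem MutuallyLocal.adjoinProducts_left (hAA : MutuallyLocal A A) (hAB : MutuallyLocal A B)
    (hBA : MutuallyLocal B A) : MutuallyLocal (adjoinProducts A) B := by
  intro x hx c hc
  refine adjoinProducts_induction (p := fun x => pairSeries x c ∈ swapFam (adjoinProducts A) B)
    (fun a ha => swapFam_mono (le_adjoinProducts A) le_rfl (hAB a ha c hc))
    (fun a ha b hb n => hAA.nthProd_left hAB hBA (fun _ ha _ hb n =>
      nthProd_mem_adjoinProducts ha hb n) ha hb hc n) ?_ ?_ hx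
  · intro x y h h'
    rw [pairSeries_add_left]
    exact add_mem h h'
  · intro c x h
    rw [pairSeries_smul_left]
    exact Submodule.smul_mem _ c h

theorem MutuallyLocal.adjoinProducts_right (hAA : MutuallyLocal A A) :
    MutuallyLocal A (adjoinProducts A) := by
  intro c hc x hx
  refine adjoinProducts_induction (p := fun x => pairSeries c x ∈ swapFam A (adjoinProducts A))
    (fun a ha => swapFam_mono le_rfl (le_adjoinProducts A) (hAA c hc a ha))
    (fun a ha b hb n => hAA.nthProd_right hAA hAA (fun _ ha _ hb n =>
      nthProd_mem_adjoinProducts ha hb n) hc ha hb n) ?_ ?_ hx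
  · intro x y h h'
    rw [pairSeries_add_right]
    exact add_mem h h'
  · intro c x h
    rw [pairSeries_smul_right]
    exact Submodule.smul_mem _ c h

/-- Products are adjoined one side at a time: A is local with the enlarged space and conversely, and
these two facts are what enlarging the left factor requires. -/
theorem MutuallyLocal.adjoinProducts (hAA : MutuallyLocal A A) :
    MutuallyLocal (adjoinProducts A) (adjoinProducts A) :=
  hAA.adjoinProducts_left hAA.adjoinProducts_right (hAA.adjoinProducts_left hAA hAA)

/-- The ascending chain of subspaces obtained by adjoining products repeatedly. -/
def productChain (S : Set (VertexOperator ℂ W)) : ℕ → Submodule ℂ (VertexOperator ℂ W)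
  | 0 => Submodule.span ℂ (insert (idField W) S)
  | n + 1 => adjoinProducts (productChain S n)

theorem monotone_productChain (S : Set (VertexOperator ℂ W)) : Monotone (productChain S) :=
  monotone_nat_of_le_succ fun _ => le_adjoinProducts _

theorem IsSLocal.mutuallyLocal_productChain (hS : IsSLocal S) (n : ℕ) :
    MutuallyLocal (productChain S n) (productChain S n) := by
  induction n with
  | zero => exact hS.mutuallyLocal
  | succ n ih => exact ih.adjoinProducts

theorem mem_iSup_productChain {x : VertexOperator ℂ W} :
    x ∈ ⨆ n, productChain S n ↔ ∃ n, x ∈ productChain S n :=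
  Submodule.mem_iSup_of_directed _ (monotone_productChain S).directed_le

theorem exists_mem_productChain {a b : VertexOperator ℂ W} (ha : a ∈ ⨆ n, productChain S n)
    (hb : b ∈ ⨆ n, productChain S n) : ∃ n, a ∈ productChain S n ∧ b ∈ productChain S n := by
  obtain ⟨n, hn⟩ := mem_iSup_productChain.mp ha
  obtain ⟨m, hm⟩ := mem_iSup_productChain.mp hb
  exact ⟨max n m, monotone_productChain S (le_max_left _ _) hn,
    monotone_productChain S (le_max_right _ _) hm⟩

theorem IsSLocal.mutuallyLocal_iSup (hS : IsSLocal S) :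
    MutuallyLocal (⨆ n, productChain S n) (⨆ n, productChain S n) := by
  intro a ha b hb
  obtain ⟨n, han, hbn⟩ := exists_mem_productChain ha hb
  have h1 := le_iSup (productChain S) n
  exact swapFam_mono h1 h1 (hS.mutuallyLocal_productChain n a han b hbn)

/-- Two elements of the union lie in a common stage, and their products lie in the next one. -/
theorem IsSLocal.iSup_mem_closedQCContaining (hS : IsSLocal S) :
    ⨆ n, productChain S n ∈ closedQCContaining S := by
  have h0 := le_iSup (productChain S) 0
  refine ⟨⟨hS.mutuallyLocal_iSup.isQuasiCompatible, fun a ha b hb n => ?_⟩,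
    fun a ha => h0 (Submodule.subset_span (Or.inr ha)), h0 (Submodule.subset_span (Or.inl rfl))⟩
  obtain ⟨m, ham, hbm⟩ := exists_mem_productChain ha hb
  exact le_iSup (productChain S) (m + 1) (nthProd_mem_adjoinProducts ham hbm n)

theorem productChain_le {U : Submodule ℂ (VertexOperator ℂ W)} (hU : U ∈ closedQCContaining S)
    (n : ℕ) : productChain S n ≤ U := by
  induction n with
  | zero => exact Submodule.span_le.mpr (Set.insert_subset hU.2.2 hU.2.1)
  | succ n ih =>
    refine sup_le ih (Submodule.span_le.mpr ?_)
    rintro _ ⟨a, ha, b, hb, m, rfl⟩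
    exact hU.1.2 a (ih ha) b (ih hb) m

theorem IsSLocal.generated_eq (hS : IsSLocal S) : generated S = ⨆ n, productChain S n :=
  le_antisymm (sInf_le hS.iSup_mem_closedQCContaining)
    (le_sInf fun _ hU => iSup_le (productChain_le hU))

theorem IsSLocal.isLeast_generated (hS : IsSLocal S) :
    IsLeast (closedQCContaining S) (generated S) :=
  ⟨hS.generated_eq ▸ hS.iSup_mem_closedQCContaining, fun _ hU => sInf_le hU⟩

theorem IsSLocal.mutuallyLocal_generated (hS : IsSLocal S) :
    MutuallyLocal (generated S) (generated S) := hS.generated_eq ▸ hS.mutuallyLocal_iSup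

end Generated

/-! ### The vertex operator map -/

section VertexMap

variable {W : Type*} [AddCommGroup W] [Module ℂ W]

theorem coeff_nthProd (a b : VertexOperator ℂ W) (n m : ℤ) (w : W) :
    HVertexOperator.coeff (nthProd a b n) m w = prodOpe a b w ![-n - 1, m] := by
  simp [prodOpe]

/-- Uniqueness of expansions makes the products bilinear, although their definition chooses a
polynomial for each pair. -/
theorem nthProd_eq_of_isOpe {a b x : VertexOperator ℂ W} (h : DiagCompat a b) {n : ℤ}
    {E : W → FSeries (Fin 2) W} (hE : ∀ w, IsOpe (pairSeries a b w) (E w))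
    (hx : ∀ m w, HVertexOperator.coeff x m w = E w ![-n - 1, m]) : nthProd a b n = x :=
  vertexOperator_ext fun m w => by
    rw [coeff_nthProd, hx, (isOpe_prodOpe h w).unique (hE w)]

theorem nthProd_add_left {a a' b : VertexOperator ℂ W} (h : DiagCompat a b) (h' : DiagCompat a' b)
    (h'' : DiagCompat (a + a') b) (n : ℤ) :
    nthProd (a + a') b n = nthProd a b n + nthProd a' b n :=
  nthProd_eq_of_isOpe h'' (E := fun w => prodOpe a b w + prodOpe a' b w)
    (fun w => by
      rw [pairSeries_add_left]
      exact (isOpe_prodOpe h w).add (isOpe_prodOpe h' w))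
    fun m w => by rw [map_add, Pi.add_apply, LinearMap.add_apply, coeff_nthProd, coeff_nthProd]; rfl

theorem nthProd_smul_left {a b : VertexOperator ℂ W} (h : DiagCompat a b) (c : ℂ)
    (h'' : DiagCompat (c • a) b) (n : ℤ) : nthProd (c • a) b n = c • nthProd a b n :=
  nthProd_eq_of_isOpe h'' (E := fun w => c • prodOpe a b w)
    (fun w => by
      rw [pairSeries_smul_left]
      exact (isOpe_prodOpe h w).smul c)
    fun m w => by rw [map_smul, Pi.smul_apply, LinearMap.smul_apply, coeff_nthProd]; rfl

theorem nthProd_add_right {a b b' : VertexOperator ℂ W} (h : DiagCompat a b) (h' : DiagCompat a b')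
    (h'' : DiagCompat a (b + b')) (n : ℤ) :
    nthProd a (b + b') n = nthProd a b n + nthProd a b' n :=
  nthProd_eq_of_isOpe h'' (E := fun w => prodOpe a b w + prodOpe a b' w)
    (fun w => by
      rw [pairSeries_add_right]
      exact (isOpe_prodOpe h w).add (isOpe_prodOpe h' w))
    fun m w => by rw [map_add, Pi.add_apply, LinearMap.add_apply, coeff_nthProd, coeff_nthProd]; rfl

theorem nthProd_smul_right {a b : VertexOperator ℂ W} (h : DiagCompat a b) (c : ℂ)
    (h'' : DiagCompat a (c • b)) (n : ℤ) : nthProd a (c • b) n = c • nthProd a b n :=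
  nthProd_eq_of_isOpe h'' (E := fun w => c • prodOpe a b w)
    (fun w => by
      rw [pairSeries_smul_right]
      exact (isOpe_prodOpe h w).smul c)
    fun m w => by rw [map_smul, Pi.smul_apply, LinearMap.smul_apply, coeff_nthProd]; rfl

theorem DiagCompat.exists_nthProd_eq_zero {a b : VertexOperator ℂ W} (h : DiagCompat a b) :
    ∃ K : ℤ, ∀ n, K ≤ n → nthProd a b n = 0 := by
  obtain ⟨K, hK⟩ := h
  refine ⟨K, fun n hn => vertexOperator_ext fun m w => ?_⟩
  rw [coeff_nthProd, (prodOpe_bddAt hK w).2 _ (by simp; omega)]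
  simp

theorem diagCompat_idField_left (a : VertexOperator ℂ W) : DiagCompat (idField W) a :=
  ⟨0, fun w => by simpa using famLaurent_pairSeries_idField_left a w⟩

theorem diagCompat_idField_right (a : VertexOperator ℂ W) : DiagCompat a (idField W) :=
  ⟨0, fun w => by simpa using famLaurent_pairSeries_idField_right a w⟩

theorem prodOpe_idField_left (a : VertexOperator ℂ W) (w : W) :
    prodOpe (idField W) a w = pairSeries (idField W) a w := by
  refine (isOpe_prodOpe (diagCompat_idField_left a) w).unique ?_
  convert (famLaurent_pairSeries_idField_left a w).isOpe using 1
  funext e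
  rw [substVar, finsum_eq_single _ 0]
  · simp only [ibinom_zero_left, zero_sub, pairSeries, coeff_idField,
      line_apply_left (show (0 : Fin 2) ≠ 1 by decide),
      line_apply_right (show (0 : Fin 2) ≠ 1 by decide), sub_neg_eq_add, add_neg_cancel, if_true]
    split_ifs with h <;> simp [h]
  · intro m hm
    rw [pairSeries, coeff_idField, line_apply_left (by decide), if_neg (by omega), smul_zero]

/-- There are no poles, so the expansion is the Taylor series of a(x + x₀). The creation property is
read off from it. -/
theorem prodOpe_idField_right (a : VertexOperator ℂ W) (w : W) (e : Fin 2 → ℤ) :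
    prodOpe a (idField W) w e = ibinom (e 0 + e 1) (e 0) • HVertexOperator.coeff a (e 0 + e 1) w := by
  rw [(isOpe_prodOpe (diagCompat_idField_right a) w).unique
    (famLaurent_pairSeries_idField_right a w).isOpe, substVar, finsum_eq_single _ (e 0 + e 1)]
  · rw [pairSeries, coeff_idField, line_apply_right (by decide), line_apply_left (by decide),
      if_pos (by ring), add_sub_cancel]
  · intro m hm
    rw [pairSeries, coeff_idField, line_apply_right (by decide), if_neg (by omega), map_zero,
      smul_zero]

variable {A : Submodule ℂ (VertexOperator ℂ W)} (hA : MutuallyLocal A A)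
  (hcl : ∀ a ∈ A, ∀ b ∈ A, ∀ n, nthProd a b n ∈ A)

/-- The map `a(x) ↦ Y_ℰ(a(x), x₀)` on a closed mutually local subspace. -/
def vertexMap : A →ₗ[ℂ] VertexOperator ℂ A where
  toFun a := VertexOperator.of_coeff
    (fun n =>
      { toFun := fun b => ⟨nthProd a b (-n - 1), hcl a a.2 b b.2 _⟩
        map_add' := fun b b' => Subtype.ext (nthProd_add_right (hA.diagCompat a.2 b.2)
          (hA.diagCompat a.2 b'.2) (hA.diagCompat a.2 (b + b').2) _)
        map_smul' := fun c b => Subtype.ext (nthProd_smul_right (hA.diagCompat a.2 b.2) c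
          (hA.diagCompat a.2 (c • b).2) _) })
    (fun b => by
      obtain ⟨K, hK⟩ := (hA.diagCompat a.2 b.2).exists_nthProd_eq_zero
      refine ⟨-K - 1, fun n hn => ?_⟩
      by_contra hlt
      exact hn (Subtype.ext (hK _ (by omega))))
  map_add' a a' := vertexOperator_ext fun _ b => Subtype.ext
    (nthProd_add_left (hA.diagCompat a.2 b.2) (hA.diagCompat a'.2 b.2)
      (hA.diagCompat (a + a').2 b.2) _)
  map_smul' c a := vertexOperator_ext fun _ b => Subtype.ext
    (nthProd_smul_left (hA.diagCompat a.2 b.2) c (hA.diagCompat (c • a).2 b.2) _)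

theorem coe_coeff_vertexMap (a b : A) (n : ℤ) :
    ((HVertexOperator.coeff (vertexMap hA hcl a) n b : A) : VertexOperator ℂ W) =
      nthProd a b (-n - 1) := rfl

theorem coe_ncoeff_vertexMap (a b : A) (n : ℤ) :
    ((VertexOperator.ncoeff (vertexMap hA hcl a) n b : A) : VertexOperator ℂ W) =
      nthProd a b n := by
  have h := coe_coeff_vertexMap hA hcl a b (-n - 1)
  rwa [show -(-n - 1) - 1 = n by ring] at h

theorem hasVacuum_vertexMap (h1 : idField W ∈ A) :
    HasVacuum (vertexMap hA hcl) ⟨idField W, h1⟩ where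
  vacuum := vertexOperator_ext fun n b => Subtype.ext <| vertexOperator_ext fun m w => by
    rw [coe_coeff_vertexMap, coeff_nthProd, prodOpe_idField_left, coeff_idField, pairSeries,
      coeff_idField]
    simp only [Matrix.cons_val_zero, Matrix.cons_val_one, neg_sub, sub_neg_eq_add,
      add_sub_cancel_left]
    split_ifs <;> simp
  creation_regular a n hn := Subtype.ext <| vertexOperator_ext fun m w => by
    rw [coe_coeff_vertexMap, coeff_nthProd, prodOpe_idField_right, ibinom_of_neg _ (by simpa)]
    simp
  creation a := Subtype.ext <| vertexOperator_ext fun m w => by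
    rw [coe_coeff_vertexMap, coeff_nthProd, prodOpe_idField_right]
    simp

end VertexMap

/-! ### Relations between substitutions in three variables -/

section Braid

variable {V : Type*} [AddCommGroup V] [Module ℂ V]

/-- Both sides vanish unless 0 ≤ k ≤ s; the remaining case is trinomial revision. -/
theorem ibinom_mul_ibinom (m s k : ℤ) :
    ibinom m s * ibinom s k = ibinom m k * ibinom (m - k) (s - k) := by
  rcases lt_or_ge k 0 with hk | hk
  · rw [ibinom_of_neg s hk, ibinom_of_neg m hk]; ring
  rcases lt_or_ge s 0 with hs | hs
  · rw [ibinom_of_neg m hs, ibinom_of_neg (m - k) (by omega)]; ring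
  obtain ⟨k, rfl⟩ := Int.eq_ofNat_of_zero_le hk
  obtain ⟨s, rfl⟩ := Int.eq_ofNat_of_zero_le hs
  rcases lt_or_ge s k with h | h
  · rw [ibinom_natCast_natCast, Nat.choose_eq_zero_of_lt h, ibinom_of_neg (m - k) (by omega)]
    push_cast; ring
  · rw [ibinom_natCast_natCast, ibinom_natCast, ibinom_natCast,
      show (s : ℤ) - k = ((s - k : ℕ) : ℤ) by omega, ibinom_natCast]
    have := Ring.choose_smul_choose m h
    rw [nsmul_eq_mul] at this
    rw [mul_comm]
    exact_mod_cast this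

/-- The Chu-Vandermonde identity. -/
theorem sum_ibinom_mul_ibinom (r s a c : ℤ) {T : Finset ℤ}
    (hT : ∀ t, a ≤ t → t ≤ a + c → t ∈ T) :
    ∑ t ∈ T, ibinom r (t - a) * ibinom s (a + c - t) = ibinom (r + s) c := by
  rcases lt_or_ge c 0 with hc | hc
  · rw [ibinom_of_neg _ hc]
    refine Finset.sum_eq_zero fun t _ => ?_
    rcases lt_or_ge t a with h | h
    · rw [ibinom_of_neg r (by omega), zero_mul]
    · rw [ibinom_of_neg s (by omega), mul_zero]
  · obtain ⟨n, rfl⟩ := Int.eq_ofNat_of_zero_le hc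
    rw [ibinom_natCast, Ring.add_choose_eq n (Commute.all r s)]
    symm
    refine Finset.sum_of_injOn (fun ij : ℕ × ℕ => a + (ij.1 : ℤ)) ?_ ?_ ?_ ?_
    · rintro ⟨i, j⟩ h ⟨i', j'⟩ h' heq
      simp only [Finset.mem_coe, Finset.HasAntidiagonal.mem_antidiagonal] at h h' heq
      ext <;> simp <;> omega
    · rintro ⟨i, j⟩ h
      simp only [Finset.mem_coe, Finset.HasAntidiagonal.mem_antidiagonal] at h
      exact hT _ (by simp) (by simp; omega)
    · intro t _ ht
      rcases lt_or_ge t a with h | h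
      · rw [ibinom_of_neg r (by omega), zero_mul]
      rcases lt_or_ge (a + n) t with h' | h'
      · rw [ibinom_of_neg s (by omega), mul_zero]
      refine absurd ⟨((t - a).toNat, (a + n - t).toNat), ?_, ?_⟩ ht
      · simp only [Finset.mem_coe, Finset.HasAntidiagonal.mem_antidiagonal]; omega
      · simp only; omega
    · rintro ⟨i, j⟩ h
      simp only [Finset.HasAntidiagonal.mem_antidiagonal] at h
      rw [add_sub_cancel_left, show a + (n : ℤ) - (a + i) = j by omega, ibinom_natCast,
        ibinom_natCast]

omit [Module ℂ V] in
theorem finsum_eq_sum {f : ℤ → V} (s : Finset ℤ) (h : ∀ m, m ∉ s → f m = 0) :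
    ∑ᶠ m, f m = ∑ m ∈ s, f m :=
  finsum_eq_sum_of_support_subset _ fun m hm => by
    by_contra hc
    exact hm (h m hc)

omit [Module ℂ V] in
theorem substVar_zero_one_apply (F : FSeries (Fin 3) V) (e : Fin 3 → ℤ) :
    substVar ibinom 0 1 F e = ∑ᶠ m : ℤ, ibinom m (e 0) • F ![m, e 0 + e 1 - m, e 2] := by
  refine finsum_congr fun m => ?_
  congr 2
  funext l
  fin_cases l <;> (simp [bv_apply]; try ring)

omit [Module ℂ V] in
theorem substVar_zero_two_apply (F : FSeries (Fin 3) V) (e : Fin 3 → ℤ) :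
    substVar ibinom 0 2 F e = ∑ᶠ m : ℤ, ibinom m (e 0) • F ![m, e 1, e 0 + e 2 - m] := by
  refine finsum_congr fun m => ?_
  congr 2
  funext l
  fin_cases l <;> (simp [bv_apply]; try ring)

omit [Module ℂ V] in
theorem substVar_one_two_apply (F : FSeries (Fin 3) V) (e : Fin 3 → ℤ) :
    substVar ibinom 1 2 F e = ∑ᶠ m : ℤ, ibinom m (e 1) • F ![e 0, m, e 1 + e 2 - m] := by
  refine finsum_congr fun m => ?_
  congr 2
  funext l
  fin_cases l <;> (simp [bv_apply]; try ring)

omit [Module ℂ V] in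
theorem exists_finset_of_isLaurent {F : FSeries (Fin 3) V} (hF : IsLaurent F) (s : ℤ) :
    ∃ N M : ℤ, ∀ m l, (m < N ∨ M < m ∨ l < N ∨ M < l) → F ![m, l, s - m - l] = 0 := by
  obtain ⟨N, hN⟩ := hF
  refine ⟨N, s - 2 * N, fun m l h => ?_⟩
  by_cases h0 : m < N
  · exact hN _ ⟨0, h0⟩
  by_cases h1 : l < N
  · exact hN _ ⟨1, h1⟩
  · exact hN _ ⟨2, by simp only [Matrix.cons_val]; omega⟩

omit [Module ℂ V] in
-- Both orders give the same double sum, finite because the total degree is fixed. As a consequence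
-- the result has no negative powers of x₀ and none of x₁.
theorem substVar_comm {F : FSeries (Fin 3) V} (hF : IsLaurent F) :
    substVar ibinom 0 2 (substVar ibinom 1 2 F) = substVar ibinom 1 2 (substVar ibinom 0 2 F) := by
  funext e
  obtain ⟨N, M, h⟩ := exists_finset_of_isLaurent hF (e 0 + e 1 + e 2)
  have hI : ∀ m, m ∉ Finset.Icc N M → m < N ∨ M < m := fun m hm => by
    simp only [Finset.mem_Icc, not_and_or, not_le] at hm; exact hm
  have h1 : substVar ibinom 0 2 (substVar ibinom 1 2 F) e = ∑ m ∈ Finset.Icc N M,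
      ∑ l ∈ Finset.Icc N M, ibinom m (e 0) • ibinom l (e 1) • F ![m, l, e 0 + e 1 + e 2 - m - l] := by
    rw [substVar_zero_two_apply]
    simp only [substVar_one_two_apply, Matrix.cons_val_zero, Matrix.cons_val_one, Matrix.cons_val]
    have e1 : ∀ m l : ℤ, e 1 + (e 0 + e 2 - m) - l = e 0 + e 1 + e 2 - m - l := fun _ _ => by ring
    simp only [e1]
    rw [finsum_eq_sum (Finset.Icc N M)]
    · refine Finset.sum_congr rfl fun m _ => ?_
      rw [finsum_eq_sum (Finset.Icc N M), Finset.smul_sum]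
      intro l hl
      rw [h m l (by have := hI l hl; omega), smul_zero]
    · intro m hm
      rw [finsum_eq_zero_of_forall_eq_zero, smul_zero]
      intro l
      rw [h m l (by have := hI m hm; omega), smul_zero]
  have h2 : substVar ibinom 1 2 (substVar ibinom 0 2 F) e = ∑ l ∈ Finset.Icc N M,
      ∑ m ∈ Finset.Icc N M, ibinom l (e 1) • ibinom m (e 0) • F ![m, l, e 0 + e 1 + e 2 - m - l] := by
    rw [substVar_one_two_apply]
    simp only [substVar_zero_two_apply, Matrix.cons_val_zero, Matrix.cons_val_one, Matrix.cons_val]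
    have e1 : ∀ m l : ℤ, e 0 + (e 1 + e 2 - l) - m = e 0 + e 1 + e 2 - m - l := fun _ _ => by ring
    simp only [e1]
    rw [finsum_eq_sum (Finset.Icc N M)]
    · refine Finset.sum_congr rfl fun l _ => ?_
      rw [finsum_eq_sum (Finset.Icc N M), Finset.smul_sum]
      intro m hm
      rw [h m l (by have := hI m hm; omega), smul_zero]
    · intro l hl
      rw [finsum_eq_zero_of_forall_eq_zero, smul_zero]
      intro m
      rw [h m l (by have := hI l hl; omega), smul_zero]
  rw [h1, h2, Finset.sum_comm]
  exact Finset.sum_congr rfl fun l _ => Finset.sum_congr rfl fun m _ => smul_comm _ _ _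

omit [Module ℂ V] in
/-- The two ways to substitute `x₀ + x₁ + x₂` for `x₀` and `x₁ + x₂` for `x₁` agree. -/
theorem substVar_braid {F : FSeries (Fin 3) V} (hF : IsLaurent F) :
    substVar ibinom 0 1 (substVar ibinom 0 2 (substVar ibinom 1 2 F)) =
      substVar ibinom 1 2 (substVar ibinom 0 1 F) := by
  funext e
  obtain ⟨N, M, h⟩ := exists_finset_of_isLaurent hF (e 0 + e 1 + e 2)
  have hI : ∀ m, m ∉ Finset.Icc N M → m < N ∨ M < m := fun m hm => by
    simp only [Finset.mem_Icc, not_and_or, not_le] at hm; exact hm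
  have h1 : substVar ibinom 0 1 (substVar ibinom 0 2 (substVar ibinom 1 2 F)) e =
      ∑ t ∈ Finset.Icc 0 (e 0 + e 1), ∑ m ∈ Finset.Icc N M, ∑ l ∈ Finset.Icc N M,
        (ibinom t (e 0) * (ibinom m t * ibinom l (e 0 + e 1 - t))) •
          F ![m, l, e 0 + e 1 + e 2 - m - l] := by
    rw [substVar_zero_one_apply]
    simp only [substVar_zero_two_apply, substVar_one_two_apply, Matrix.cons_val_zero,
      Matrix.cons_val_one, Matrix.cons_val]
    have e1 : ∀ t m l : ℤ, e 0 + e 1 - t + (t + e 2 - m) - l = e 0 + e 1 + e 2 - m - l :=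
      fun _ _ _ => by ring
    simp only [e1]
    rw [finsum_eq_sum (Finset.Icc 0 (e 0 + e 1))]
    · refine Finset.sum_congr rfl fun t _ => ?_
      rw [finsum_eq_sum (Finset.Icc N M), Finset.smul_sum]
      · refine Finset.sum_congr rfl fun m _ => ?_
        rw [finsum_eq_sum (Finset.Icc N M), Finset.smul_sum, Finset.smul_sum]
        · exact Finset.sum_congr rfl fun l _ => by simp only [mul_smul]
        · intro l hl
          rw [h m l (by have := hI l hl; omega), smul_zero]
      · intro m hm
        rw [finsum_eq_zero_of_forall_eq_zero, smul_zero]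
        intro l
        rw [h m l (by have := hI m hm; omega), smul_zero]
    · intro t ht
      rw [finsum_eq_zero_of_forall_eq_zero, smul_zero]
      intro m
      rcases lt_or_ge t 0 with h0 | h0
      · rw [ibinom_of_neg _ h0, zero_smul]
      · rw [finsum_eq_zero_of_forall_eq_zero, smul_zero]
        intro l
        simp only [Finset.mem_Icc, not_and_or, not_le] at ht
        rw [ibinom_of_neg _ (by omega), zero_smul]
  have h2 : substVar ibinom 1 2 (substVar ibinom 0 1 F) e =
      ∑ m ∈ Finset.Icc N M, ∑ l ∈ Finset.Icc N M,
        (ibinom m (e 0) * ibinom (m - e 0 + l) (e 1)) • F ![m, l, e 0 + e 1 + e 2 - m - l] := by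
    rw [substVar_one_two_apply]
    simp only [substVar_zero_one_apply, Matrix.cons_val_zero, Matrix.cons_val_one, Matrix.cons_val]
    have e1 : ∀ m l : ℤ, e 1 + e 2 - l = e 0 + e 1 + e 2 - m - (e 0 + l - m) := fun _ _ => by ring
    have e2 : ∀ m l : ℤ, F ![m, e 0 + l - m, e 1 + e 2 - l] =
        F ![m, e 0 + l - m, e 0 + e 1 + e 2 - m - (e 0 + l - m)] := fun m l => by rw [← e1]
    simp only [e2]
    rw [finsum_eq_sum (Finset.Icc (2 * N - e 0) (2 * M - e 0))]
    · have e3 : ∀ l, ∑ᶠ m : ℤ, ibinom m (e 0) •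
          F ![m, e 0 + l - m, e 0 + e 1 + e 2 - m - (e 0 + l - m)] =
          ∑ m ∈ Finset.Icc N M, ibinom m (e 0) •
          F ![m, e 0 + l - m, e 0 + e 1 + e 2 - m - (e 0 + l - m)] := fun l => by
        refine finsum_eq_sum _ fun m hm => ?_
        rw [h m _ (by have := hI m hm; omega), smul_zero]
      simp only [e3, Finset.smul_sum]
      rw [Finset.sum_comm]
      refine Finset.sum_congr rfl fun m hm => ?_
      rw [Finset.mem_Icc] at hm
      symm
      refine Finset.sum_of_injOn (fun l => l + m - e 0) ?_ ?_ ?_ ?_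
      · intro l _ l' _ hl
        simp only at hl
        omega
      · intro l hl
        simp only [Finset.coe_Icc, Set.mem_Icc] at hl ⊢
        omega
      · intro l _ hl'
        rw [h m _ ?_, smul_zero, smul_zero]
        by_contra hc
        refine hl' ⟨e 0 + l - m, ?_, by simp only; ring⟩
        simp only [Finset.coe_Icc, Set.mem_Icc]
        omega
      · intro l _
        rw [show e 0 + (l + m - e 0) - m = l by ring, show l + m - e 0 = m - e 0 + l by ring,
          mul_comm, mul_smul]
    · intro l hl
      simp only [Finset.mem_Icc, not_and_or, not_le] at hl
      rw [finsum_eq_zero_of_forall_eq_zero, smul_zero]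
      intro m
      rw [h m _ (by omega), smul_zero]
  rw [h1, h2, Finset.sum_comm]
  refine Finset.sum_congr rfl fun m _ => ?_
  rw [Finset.sum_comm]
  refine Finset.sum_congr rfl fun l _ => ?_
  rw [← Finset.sum_smul]
  congr 1
  -- Trinomial revision takes `ibinom m (e 0)` out of the sum over t, and the rest is a Vandermonde
  -- sum.
  simp only [← mul_assoc, mul_comm (ibinom _ (e 0)) (ibinom m _), ibinom_mul_ibinom m _ (e 0)]
  simp only [mul_assoc, ← Finset.mul_sum]
  rcases lt_or_ge (e 0) 0 with h0 | h0
  · rw [ibinom_of_neg _ h0, zero_mul, zero_mul]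
  · rw [sum_ibinom_mul_ibinom (m - e 0) l (e 0) (e 1)]
    intro t ht ht'
    exact Finset.mem_Icc.mpr ⟨by omega, ht'⟩

end Braid

/-! ### Operator product expansions in three variables -/

section Along

variable {V V' : Type*} [AddCommGroup V] [Module ℂ V] [AddCommGroup V'] [Module ℂ V']

/-- The exponent vector with entries `e 0`, `e 1`, `m` at `i`, `j`, `g`. -/
def place (i j g : Fin 3) (m : ℤ) (e : Fin 2 → ℤ) : Fin 3 → ℤ :=
  e 0 • bv i + e 1 • bv j + m • bv g

/-- The coefficient of `x_g ^ m` of a series in three variables, as a series in `x_i`, `x_j`. -/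
def sliceAt (i j g : Fin 3) (m : ℤ) (F : FSeries (Fin 3) V) : FSeries (Fin 2) V :=
  fun e => F (place i j g m e)

/-- For each power of `x_g`, the coefficients are related by `IsOpe` in the variables
`x_i`, `x_j`. -/
def IsOpeAlong (i j g : Fin 3) (F E : FSeries (Fin 3) V) : Prop :=
  ∀ m, IsOpe (sliceAt i j g m F) (sliceAt i j g m E)

/-- The indices `i`, `j`, `g` are distinct. -/
structure IsTriple (i j g : Fin 3) : Prop where
  ij : i ≠ j
  ig : i ≠ g
  jg : j ≠ g

variable {i j g : Fin 3}

theorem IsTriple.cases (h : IsTriple i j g) (l : Fin 3) : l = i ∨ l = j ∨ l = g := by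
  obtain ⟨h1, h2, h3⟩ := h
  omega

theorem place_apply (m : ℤ) (e : Fin 2 → ℤ) (l : Fin 3) :
    place i j g m e l = e 0 * bv i l + e 1 * bv j l + m * bv g l := by simp [place]

theorem IsTriple.place_self (h : IsTriple i j g) (e : Fin 3 → ℤ) :
    place i j g (e g) ![e i, e j] = e := by
  funext l
  rw [place_apply]
  rcases h.cases l with rfl | rfl | rfl
  · simp [bv_ne h.ij, bv_ne h.ig]
  · simp [bv_ne h.ij.symm, bv_ne h.jg]
  · simp [bv_ne h.ig.symm, bv_ne h.jg.symm]

theorem sliceAt_polyMul (m : ℤ) (p : MvPolynomial (Fin 2) ℂ) (F : FSeries (Fin 3) V) :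
    sliceAt i j g m (polyMul (rename ![i, j] p) F) = polyMul p (sliceAt i j g m F) :=
  polyMul_comp ![i, j] (place i j g m) (fun e k => by
    fin_cases k <;> simp [place, sub_smul, bv_apply] <;> abel) p F

theorem sliceAt_X (m : ℤ) (F : FSeries (Fin 3) V) :
    sliceAt i j g m (polyMul (X g) F) = sliceAt i j g (m - 1) F := by
  funext e
  simp only [sliceAt, polyMul_X]
  congr 1
  simp only [place, sub_smul, one_smul]
  abel

omit [Module ℂ V] in
theorem sliceAt_substVar (b : ℤ → ℤ → ℤ) (h : IsTriple i j g) (m : ℤ) (F : FSeries (Fin 3) V) :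
    sliceAt i j g m (substVar b i j F) = substVar b 0 1 (sliceAt i j g m F) := by
  funext e
  have h1 : place i j g m e i = e 0 := by
    rw [place_apply]; simp [bv_ne h.ij, bv_ne h.ig]
  simp only [sliceAt, substVar, h1]
  refine finsum_congr fun t => ?_
  congr 2
  simp only [place, Pi.add_apply, Pi.smul_apply, Pi.sub_apply, bv_self,
    bv_ne (show (0 : Fin 2) ≠ 1 by decide), bv_ne (show (1 : Fin 2) ≠ 0 by decide), smul_sub,
    smul_eq_mul, add_smul, sub_smul, mul_one, mul_zero, sub_zero, zero_sub, neg_smul]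
  abel

omit [AddCommGroup V] [Module ℂ V] in
theorem sliceAt_injective (h : IsTriple i j g) {F G : FSeries (Fin 3) V}
    (hFG : ∀ m, sliceAt i j g m F = sliceAt i j g m G) : F = G := by
  funext e
  have := congrFun (hFG (e g)) ![e i, e j]
  simpa only [sliceAt, h.place_self] using this

theorem IsOpeAlong.polyMul (h : IsTriple i j g) {F E : FSeries (Fin 3) V}
    (hFE : IsOpeAlong i j g F E) (p : MvPolynomial (Fin 3) ℂ) :
    IsOpeAlong i j g (polyMul p F) (polyMul (substPoly i j p) E) := by
  induction p using MvPolynomial.induction_on generalizing F E with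
  | C c =>
    intro m
    rw [substPoly_C, polyMul_C, polyMul_C]
    exact (hFE m).smul c
  | add p q hp hq =>
    intro m
    rw [map_add, polyMul_add_left, polyMul_add_left]
    exact (hp hFE m).add (hq hFE m)
  | mul_X p l hp =>
    rw [map_mul, polyMul_mul, polyMul_mul]
    refine hp fun m => ?_
    have hX0 : (X i : MvPolynomial (Fin 3) ℂ) = rename ![i, j] (X 0) := by simp
    have hX1 : (X j : MvPolynomial (Fin 3) ℂ) = rename ![i, j] (X 1) := by simp
    rcases h.cases l with rfl | rfl | rfl
    · have h1 : (X l + X j : MvPolynomial (Fin 3) ℂ) = rename ![l, j] (X 0 + X 1) := by simp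
      rw [substPoly_X_self, h1, hX0, sliceAt_polyMul, sliceAt_polyMul]
      have := (hFE m).polyMul (X 0)
      rwa [substPoly_X_self] at this
    · rw [substPoly_X_of_ne h.ij.symm, hX1, sliceAt_polyMul, sliceAt_polyMul]
      have := (hFE m).polyMul (X 1)
      rwa [substPoly_X_of_ne (by decide)] at this
    · rw [substPoly_X_of_ne h.ig.symm, sliceAt_X, sliceAt_X]
      exact hFE (m - 1)

theorem IsOpeAlong.eq_substVar (h : IsTriple i j g) {F E : FSeries (Fin 3) V}
    (hFE : IsOpeAlong i j g F E) (hF : ∀ m, IsLaurent (sliceAt i j g m F)) :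
    E = substVar ibinom i j F := by
  refine sliceAt_injective h fun m => ?_
  rw [sliceAt_substVar _ h]
  exact (hFE m).unique (hF m).isOpe

theorem IsOpeAlong.substVar_polyMul (h : IsTriple i j g) {F E : FSeries (Fin 3) V}
    (hFE : IsOpeAlong i j g F E) {p : MvPolynomial (Fin 3) ℂ}
    (hF : ∀ m, IsLaurent (sliceAt i j g m (Vtx.polyMul p F))) :
    substVar ibinom i j (Vtx.polyMul p F) = Vtx.polyMul (substPoly i j p) E :=
  ((hFE.polyMul h p).eq_substVar h hF).symm

omit [Module ℂ V] in
theorem IsLaurent.sliceAt (h : IsTriple i j g) {F : FSeries (Fin 3) V} (hF : IsLaurent F) (m : ℤ) :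
    IsLaurent (sliceAt i j g m F) := by
  obtain ⟨N, hN⟩ := hF
  refine ⟨N, fun e ⟨k, hk⟩ => hN _ ?_⟩
  fin_cases k
  · exact ⟨i, by rw [place_apply]; simpa [bv_ne h.ij, bv_ne h.ig] using hk⟩
  · exact ⟨j, by rw [place_apply]; simpa [bv_ne h.ij.symm, bv_ne h.jg] using hk⟩

omit [Module ℂ V] in
-- After the first substitution the series need not be Laurent in all variables jointly, but it is
-- for each fixed power of x₁. This suffices for the second substitution.
theorem IsLaurent.sliceAt_substVar_one_two {F : FSeries (Fin 3) V} (hF : IsLaurent F) (m : ℤ) :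
    IsLaurent (Vtx.sliceAt 0 2 1 m (substVar ibinom 1 2 F)) := by
  obtain ⟨N, hN⟩ := hF
  refine ⟨min N (2 * N - m), fun e he => ?_⟩
  rw [Vtx.sliceAt, substVar_one_two_apply]
  refine finsum_eq_zero_of_forall_eq_zero fun k => ?_
  by_cases hk : k < N
  · rw [hN _ ⟨1, hk⟩, smul_zero]
  obtain ⟨l, hl⟩ := he
  fin_cases l
  · rw [hN _ ⟨0, ?_⟩, smul_zero]
    simp [place_apply, bv_apply] at hl ⊢
    omega
  · rw [hN _ ⟨2, ?_⟩, smul_zero]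
    simp [place_apply, bv_apply] at hl ⊢
    omega

omit [Module ℂ V] in
theorem IsLaurent.sliceAt_substVar_zero_one {F : FSeries (Fin 3) V} (hF : IsLaurent F) (m : ℤ) :
    IsLaurent (Vtx.sliceAt 1 2 0 m (substVar ibinom 0 1 F)) := by
  have h1 : Vtx.sliceAt 1 2 0 m (substVar ibinom 0 1 F) = slice m (substVar ibinom 0 1 F) := by
    funext e
    simp only [Vtx.sliceAt, slice]
    congr 1
    funext l
    fin_cases l <;> simp [place_apply, bv_apply]
  rw [h1]
  exact isLaurent_slice_substVar hF (by decide) m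

theorem substVar_map (L : V →ₗ[ℂ] V') {ι : Type*} [DecidableEq ι] {b : ℤ → ℤ → ℤ} {i j : ι}
    {F : FSeries ι V} (hF : SubstFinite b i j F) :
    substVar b i j (fun e => L (F e)) = fun e => L (substVar b i j F e) := by
  funext e
  simp only [substVar]
  rw [← LinearMap.toAddMonoidHom_coe, AddMonoidHom.map_finsum _ (hF.support _ _ _)]
  exact finsum_congr fun m => (map_zsmul _ _ _).symm

theorem IsOpe.map (L : V →ₗ[ℂ] V') {F E : FSeries (Fin 2) V} (h : IsOpe F E) :
    IsOpe (fun e => L (F e)) (fun e => L (E e)) := by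
  obtain ⟨N, h1, h2⟩ := h
  have h3 : Vtx.polyMul ((X 0 - X 1) ^ N) (fun e => L (F e)) =
      fun e => L (Vtx.polyMul ((X 0 - X 1) ^ N) F e) := by
    funext e; exact polyMul_map L _ F e
  refine ⟨N, ?_, ?_⟩
  · rw [h3]
    obtain ⟨M, hM⟩ := h1
    exact ⟨M, fun e he => by beta_reduce; rw [hM e he, map_zero]⟩
  · rw [h3, substVar_map L (h1.substFinite _ (by decide)), h2]
    funext e
    exact (polyMul_map L _ E e).symm

end Along

/-! ### Iterated products obtained from a product of three fields -/

section Associativity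

variable {W : Type*} [AddCommGroup W] [Module ℂ W]

/-- The series `Y_ℰ(a, x₀) Y_ℰ(b, x₁) c (x₂) w`. -/
def iterRight (a b c : VertexOperator ℂ W) (w : W) : FSeries (Fin 3) W := fun e =>
  HVertexOperator.coeff (nthProd a (nthProd b c (-e 1 - 1)) (-e 0 - 1)) (e 2) w

/-- The series `Y_ℰ(Y_ℰ(a, x₀) b, x₁) c (x₂) w`. -/
def iterLeft (a b c : VertexOperator ℂ W) (w : W) : FSeries (Fin 3) W := fun e =>
  HVertexOperator.coeff (nthProd (nthProd a b (-e 0 - 1)) c (-e 1 - 1)) (e 2) w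

variable {a b c : VertexOperator ℂ W}

/-- The inner substitution replaces b(x₁)c(x₂) by the fields bₙc. The outer one is then applied, for
each power of x₁, to a(x₀) and one such field. -/
theorem substVar_tripleSeries_right (hbc : DiagCompat b c)
    (habc : ∀ n, DiagCompat a (nthProd b c n)) {p : MvPolynomial (Fin 3) ℂ} {w : W}
    (hp : IsLaurent (polyMul p (tripleSeries a b c w))) :
    substVar ibinom 0 2 (substVar ibinom 1 2 (polyMul p (tripleSeries a b c w))) =
      polyMul (substPoly 0 2 (substPoly 1 2 p)) (iterRight a b c w) := by
  have t1 : IsTriple 1 2 0 := ⟨by decide, by decide, by decide⟩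
  have t2 : IsTriple 0 2 1 := ⟨by decide, by decide, by decide⟩
  have h1 : IsOpeAlong 1 2 0 (tripleSeries a b c w)
      (fun e => HVertexOperator.coeff a (e 0) (prodOpe b c w ![e 1, e 2])) := by
    intro m
    convert (isOpe_prodOpe hbc w).map (HVertexOperator.coeff a m) using 1 <;> funext e
    · simp [sliceAt, tripleSeries, place_apply, bv_apply, pairSeries]
    · simp [sliceAt, place_apply, bv_apply, prodOpe]
  have h2 : IsOpeAlong 0 2 1
      (fun e => HVertexOperator.coeff a (e 0) (prodOpe b c w ![e 1, e 2])) (iterRight a b c w) := by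
    intro m
    convert isOpe_prodOpe (habc (-m - 1)) w using 1 <;> funext e
    · simp [sliceAt, pairSeries, place_apply, bv_apply, prodOpe]
    · simp [sliceAt, place_apply, bv_apply, prodOpe, iterRight]
  have h3 := h1.substVar_polyMul t1 (p := p) fun m => hp.sliceAt t1 m
  rw [h3]
  exact h2.substVar_polyMul t2 fun m => h3 ▸ hp.sliceAt_substVar_one_two m

/-- Here a(x₀)b(x₁) is expanded first, and for each power of x₀ the resulting field is then
multiplied by c(x₂). -/
theorem substVar_tripleSeries_left (hab : DiagCompat a b)
    (habc : ∀ n, DiagCompat (nthProd a b n) c) {p : MvPolynomial (Fin 3) ℂ} {w : W}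
    (hp : IsLaurent (polyMul p (tripleSeries a b c w))) :
    substVar ibinom 1 2 (substVar ibinom 0 1 (polyMul p (tripleSeries a b c w))) =
      polyMul (substPoly 1 2 (substPoly 0 1 p)) (iterLeft a b c w) := by
  have t1 : IsTriple 0 1 2 := ⟨by decide, by decide, by decide⟩
  have t2 : IsTriple 1 2 0 := ⟨by decide, by decide, by decide⟩
  have h1 : IsOpeAlong 0 1 2 (tripleSeries a b c w)
      (fun e => prodOpe a b (HVertexOperator.coeff c (e 2) w) ![e 0, e 1]) := by
    intro m
    convert isOpe_prodOpe hab (HVertexOperator.coeff c m w) using 1 <;> funext e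
    · simp [sliceAt, tripleSeries, place_apply, bv_apply, pairSeries]
    · simp [sliceAt, place_apply, bv_apply, prodOpe]
  have h2 : IsOpeAlong 1 2 0
      (fun e => prodOpe a b (HVertexOperator.coeff c (e 2) w) ![e 0, e 1]) (iterLeft a b c w) := by
    intro m
    convert isOpe_prodOpe (habc (-m - 1)) w using 1 <;> funext e
    · simp [sliceAt, pairSeries, place_apply, bv_apply, prodOpe]
    · simp [sliceAt, place_apply, bv_apply, prodOpe, iterLeft]
  have h3 := h1.substVar_polyMul t1 (p := p) fun m => hp.sliceAt t1 m
  rw [h3]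
  exact h2.substVar_polyMul t2 fun m => h3 ▸ hp.sliceAt_substVar_zero_one m

end Associativity

/-! ### Operator product expansions on a closed mutually local subspace -/

section Expand

variable {W : Type*} [AddCommGroup W] [Module ℂ W] {A : Submodule ℂ (VertexOperator ℂ W)}

/-- The map `c(x) ↦ c_m w`, where `c_m` is the coefficient of `x ^ m`. -/
def evalAt (A : Submodule ℂ (VertexOperator ℂ W)) (w : W) (m : ℤ) : A →ₗ[ℂ] W where
  toFun c := HVertexOperator.coeff (c : VertexOperator ℂ W) m w
  map_add' c c' := by simp
  map_smul' r c := by simp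

/-- A series in `x₀`, `x₁` with coefficients in a space of fields in `x₂`, applied to `w`. -/
def expand (F : FSeries (Fin 2) A) (w : W) : FSeries (Fin 3) W :=
  lift ![0, 1] (fun e : Fin 3 → ℤ => e 2) (evalAt A w) fun _ => F

theorem expand_apply (F : FSeries (Fin 2) A) (w : W) (e : Fin 3 → ℤ) :
    expand F w e = HVertexOperator.coeff (F ![e 0, e 1] : VertexOperator ℂ W) (e 2) w := by
  have : e ∘ ![0, 1] = ![e 0, e 1] := by
    funext l; fin_cases l <;> rfl
  rw [expand, lift, this]
  rfl

theorem expand_injective {F G : FSeries (Fin 2) A} (h : ∀ w, expand F w = expand G w) : F = G := by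
  funext e
  refine Subtype.ext (vertexOperator_ext fun m w => ?_)
  have h1 := congrFun (h w) ![e 0, e 1, m]
  rw [expand_apply, expand_apply] at h1
  have h2 : ![e 0, e 1] = e := by
    funext l; fin_cases l <;> rfl
  simpa [h2] using h1

theorem polyMul_expand (p : MvPolynomial (Fin 2) ℂ) (F : FSeries (Fin 2) A) (w : W) :
    polyMul (rename ![0, 1] p) (expand F w) = expand (polyMul p F) w :=
  polyMul_lift indep_zero_one' _ _ p

theorem substVar_expand {b : ℤ → ℤ → ℤ} {F : FSeries (Fin 2) A} (hF : SubstFinite b 0 1 F) (w : W) :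
    substVar b 0 1 (expand F w) = expand (substVar b 0 1 F) w :=
  substVar_lift indep_zero_one' _ fun _ => hF

/-- The bound has to be uniform in w: only then do whole fields, and not just their values on single
vectors, vanish below it. -/
theorem isLaurent_of_expand {F : FSeries (Fin 2) A} {N : ℤ} (h0 : ∀ w, BddAt 0 N (expand F w))
    (h1 : ∀ w, BddAt 1 N (expand F w)) : IsLaurent F := by
  refine ⟨N, fun e he => Subtype.ext (vertexOperator_ext fun m w => ?_)⟩
  have h2 : ![e 0, e 1] = e := by
    funext l; fin_cases l <;> rfl
  have h3 : expand F w ![e 0, e 1, m] = HVertexOperator.coeff (F e : VertexOperator ℂ W) m w := by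
    rw [expand_apply]
    simp [h2]
  rw [← h3]
  obtain ⟨k, hk⟩ := he
  fin_cases k
  · rw [h0 w _ hk]; simp
  · rw [h1 w _ hk]; simp

variable (hA : MutuallyLocal A A) (hcl : ∀ a ∈ A, ∀ b ∈ A, ∀ n, nthProd a b n ∈ A)

theorem expand_pairSeries (a b c : A) (w : W) :
    expand (pairSeries (vertexMap hA hcl a) (vertexMap hA hcl b) c) w = iterRight a b c w := by
  funext e
  rw [expand_apply, pairSeries, coe_coeff_vertexMap, coe_coeff_vertexMap, iterRight]
  rfl

theorem expand_assoc (a b c : A) (w : W) :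
    expand (fun e : Fin 2 → ℤ => HVertexOperator.coeff
      (vertexMap hA hcl (HVertexOperator.coeff (vertexMap hA hcl a) (e 0) b)) (e 1) c) w =
      iterLeft a b c w := by
  funext e
  rw [expand_apply, coe_coeff_vertexMap, coe_coeff_vertexMap, iterLeft]
  rfl

theorem BddAt.of_polyMul_X {ι V : Type*} [DecidableEq ι] [AddCommGroup V] [Module ℂ V]
    {i l : ι} {n : ℕ} {N : ℤ} {F : FSeries ι V} (h : BddAt i N (Vtx.polyMul (X l ^ n) F)) :
    BddAt i (N - n) F := fun e he => by
  have h1 := h (e + (n : ℤ) • bv l) (by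
    by_cases hil : i = l
    · subst hil; simp; omega
    · simp [bv_ne hil]; omega)
  rwa [polyMul_X_pow, add_sub_cancel_right] at h1

theorem bddAt_substVar_comm {V : Type*} [AddCommGroup V] [Module ℂ V] {F : FSeries (Fin 3) V}
    (hF : IsLaurent F) :
    BddAt 0 0 (substVar ibinom 0 2 (substVar ibinom 1 2 F)) ∧
      BddAt 1 0 (substVar ibinom 0 2 (substVar ibinom 1 2 F)) :=
  ⟨bddAt_substVar_ibinom _ _ _, by rw [substVar_comm hF]; exact bddAt_substVar_ibinom _ _ _⟩

/-- Under the double substitution x₀ - x₂ and x₁ - x₂ become x₀ and x₁, and x₀ - x₁ is unchanged. As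
the result has nonnegative powers of x₀ and x₁, only the monomial factor bounds the poles, uniformly
in w. The exponent k is independent of c. -/
theorem isLaurent_polyMul_pairSeries_vertexMap {a b : A} {k : ℕ}
    (hk : famMul ((X 0 - X 1) ^ k) (pairSeries (a : VertexOperator ℂ W) b) ∈ swapSpan A A) (c : A) :
    IsLaurent (polyMul ((X 0 - X 1) ^ k)
      (pairSeries (vertexMap hA hcl a) (vertexMap hA hcl b) c)) := by
  obtain ⟨n, hn⟩ := exists_isLaurent_tripleSeries_of_mem hA hA b.2 c.2 hk
  have key : ∀ w, substVar ibinom 0 2 (substVar ibinom 1 2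
      (polyMul ((X 0 - X 1) ^ k * ((X 0 - X 2) * (X 1 - X 2)) ^ n) (tripleSeries a b c w))) =
      polyMul (X 0 ^ n) (polyMul (X 1 ^ n) (expand (polyMul ((X 0 - X 1) ^ k)
        (pairSeries (vertexMap hA hcl a) (vertexMap hA hcl b) c)) w)) := fun w => by
    rw [substVar_tripleSeries_right (hA.diagCompat b.2 c.2)
      (fun m => hA.diagCompat a.2 (hcl b b.2 c c.2 m)) (hn w), ← polyMul_expand,
      expand_pairSeries, ← polyMul_mul, ← polyMul_mul]
    congr 1
    simp [substPoly]
    ring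
  have h1 : ∀ w i, (i = 0 ∨ i = 1) → BddAt i (-n - n) (expand (polyMul ((X 0 - X 1) ^ k)
        (pairSeries (vertexMap hA hcl a) (vertexMap hA hcl b) c)) w) := fun w i hi => by
    have h2 := bddAt_substVar_comm (hn w)
    rw [key w] at h2
    have h3 : BddAt i 0 (polyMul (X 0 ^ n) (polyMul (X 1 ^ n) (expand (polyMul ((X 0 - X 1) ^ k)
        (pairSeries (vertexMap hA hcl a) (vertexMap hA hcl b) c)) w))) := by
      rcases hi with rfl | rfl
      exacts [h2.1, h2.2]
    have h4 := h3.of_polyMul_X.of_polyMul_X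
    rwa [zero_sub] at h4
  exact isLaurent_of_expand (fun w => h1 w 0 (Or.inl rfl)) fun w => h1 w 1 (Or.inr rfl)

/-- With powers of x₀ bounded below, x₀ + x₁ has the invertible leading term x₁, and coefficients
are determined by recursion on the power of x₀. -/
theorem polyMul_add_injective {V : Type*} [AddCommGroup V] [Module ℂ V] {F G : FSeries (Fin 2) V}
    {N : ℤ} (hF : BddAt 0 N F) (hG : BddAt 0 N G)
    (h : polyMul (X 0 + X 1) F = polyMul (X 0 + X 1) G) : F = G := by
  have key : ∀ n : ℕ, ∀ e : Fin 2 → ℤ, e 0 < N + n → F e = G e := by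
    intro n
    induction n with
    | zero => exact fun e he => by rw [hF e (by simpa using he), hG e (by simpa using he)]
    | succ n ih =>
      intro e he
      have h1 := congrFun h (e + bv 1)
      simp only [polyMul_add_left, Pi.add_apply, polyMul_X, add_sub_cancel_right] at h1
      rw [ih _ (by simp [bv_ne (show (0 : Fin 2) ≠ 1 by decide)]; push_cast at he; omega)] at h1
      exact add_left_cancel h1
  funext e
  exact key (e 0 - N + 1).toNat e (by omega)

theorem polyMul_add_pow_injective {V : Type*} [AddCommGroup V] [Module ℂ V]
    {F G : FSeries (Fin 2) V} {N : ℤ} (hF : BddAt 0 N F) (hG : BddAt 0 N G) (n : ℕ)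
    (h : polyMul ((X 0 + X 1) ^ n) F = polyMul ((X 0 + X 1) ^ n) G) : F = G := by
  induction n with
  | zero => simpa using h
  | succ n ih =>
    rw [pow_succ', polyMul_mul, polyMul_mul] at h
    exact ih (polyMul_add_injective (hF.polyMul _) (hG.polyMul _) h)

/-- `Y(Y(a, x₀) b, x₁) c` is the operator product expansion of `Y(a, x₀) Y(b, x₁) c`. -/
theorem isOpe_vertexMap (a b c : A) :
    IsOpe (pairSeries (vertexMap hA hcl a) (vertexMap hA hcl b) c)
      (fun e : Fin 2 → ℤ => HVertexOperator.coeff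
        (vertexMap hA hcl (HVertexOperator.coeff (vertexMap hA hcl a) (e 0) b)) (e 1) c) := by
  set E : FSeries (Fin 2) A := fun e : Fin 2 → ℤ => HVertexOperator.coeff
        (vertexMap hA hcl (HVertexOperator.coeff (vertexMap hA hcl a) (e 0) b)) (e 1) c with hE
  obtain ⟨k, hk⟩ := hA a a.2 b b.2
  have hL := isLaurent_polyMul_pairSeries_vertexMap hA hcl hk c
  refine ⟨k, hL, ?_⟩
  obtain ⟨n, hn⟩ := exists_isLaurent_tripleSeries_of_mem hA hA b.2 c.2 hk
  obtain ⟨N, hN⟩ := coeff_lt_bound (vertexMap hA hcl a) b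
  have hb : BddAt 0 N E := fun e he => by simp only [hE, hN _ he, map_zero]; simp
  -- The clearing factor x₀ⁿx₁ⁿ of the double substitution turns into (x₀ + x₁)ⁿx₁ⁿ when x₀ is
  -- replaced by x₀ + x₁.
  have h0 : polyMul ((X 0 + X 1) ^ n) (polyMul (X 1 ^ n)
      (substVar ibinom 0 1 (polyMul ((X 0 - X 1) ^ k)
        (pairSeries (vertexMap hA hcl a) (vertexMap hA hcl b) c)))) =
      polyMul ((X 0 + X 1) ^ n) (polyMul (X 1 ^ n) (polyMul (X 0 ^ k) E)) := by
    refine expand_injective fun w => ?_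
    have h1 : substVar ibinom 0 2 (substVar ibinom 1 2
        (polyMul ((X 0 - X 1) ^ k * ((X 0 - X 2) * (X 1 - X 2)) ^ n) (tripleSeries a b c w))) =
        expand (polyMul (X 0 ^ n * X 1 ^ n) (polyMul ((X 0 - X 1) ^ k)
          (pairSeries (vertexMap hA hcl a) (vertexMap hA hcl b) c))) w := by
      rw [substVar_tripleSeries_right (hA.diagCompat b.2 c.2)
        (fun m => hA.diagCompat a.2 (hcl b b.2 c c.2 m)) (hn w), ← polyMul_mul, ← polyMul_expand,
        expand_pairSeries]
      congr 1
      simp [substPoly]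
      ring
    -- One side of this identity leads to Y(a, x₀)Y(b, x₁)c with x₀ replaced by x₀ + x₁, the other
    -- to Y(Y(a, x₀)b, x₁)c.
    have h2 := substVar_braid (hn w)
    have h4 : expand E w = iterLeft a b c w := expand_assoc hA hcl a b c w
    clear_value E
    rw [h1, substVar_expand ((hL.polyMul _).substFinite _ (by decide)),
      substVar_polyMul isPascal_ibinom (by decide) (hL.substFinite _ (by decide)),
      substVar_tripleSeries_left (hA.diagCompat a.2 b.2)
        (fun m => hA.diagCompat (hcl a a.2 b b.2 m) c.2) (hn w), ← h4] at h2
    have h5 : ∀ F : FSeries (Fin 2) A, polyMul ((X 0 + X 1) ^ n) (polyMul (X 1 ^ n) F) =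
        polyMul ((X 0 + X 1) ^ n * X 1 ^ n) F := fun F => (polyMul_mul _ _ F).symm
    have h6 : ∀ F : FSeries (Fin 2) A, polyMul ((X 0 + X 1) ^ n) (polyMul (X 1 ^ n) F) =
        polyMul (substPoly 0 1 (X 0 ^ n * X 1 ^ n)) F := fun F => by
      rw [h5]
      simp [substPoly]
    have h7 : expand (polyMul ((X 0 + X 1) ^ n) (polyMul (X 1 ^ n) (polyMul (X 0 ^ k) E))) w =
        polyMul (rename ![0, 1] ((X 0 + X 1) ^ n * X 1 ^ n * X 0 ^ k)) (expand E w) := by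
      rw [polyMul_expand, polyMul_mul, polyMul_mul]
    refine (congrArg (fun F => expand F w) (h6 _)).trans ((h2.trans ?_).trans h7.symm)
    · congr 1
      simp [substPoly, mul_pow]
      ring
  have h3 := polyMul_add_pow_injective (N := min 0 N)
    (BddAt.polyMul ((bddAt_substVar_ibinom _ _ _).mono (by omega)) _)
    (BddAt.polyMul (BddAt.polyMul (hb.mono (by omega)) _) _) n h0
  exact polyMul_X_pow_injective 1 n h3

end Expand

/-! ### Weak associativity -/

section WeakAssociativity

variable {V W : Type*} [AddCommGroup V] [Module ℂ V] [AddCommGroup W] [Module ℂ W]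

omit [Module ℂ W] in
theorem substFinite_ibinom_sub {F : FSeries (Fin 2) W} {N : ℤ} (hF : BddAt 1 N F) :
    SubstFinite (fun m c => ibinom m (m - c)) 0 1 F := by
  intro e c
  refine (Set.finite_Icc c (e 1 - N)).subset fun m hm => ⟨?_, ?_⟩
  · by_contra h
    exact hm.1 (ibinom_of_neg _ (by omega))
  · by_contra h
    refine hm.2 (hF _ ?_)
    rw [line_apply_right (by decide)]
    omega

omit [Module ℂ W] in
theorem substVar_ibinom_sub_eq {F : FSeries (Fin 2) W} (hF : BddAt 0 0 F) :
    substVar (fun m c => ibinom m (m - c)) 0 1 F = substVar ibinom 0 1 F := by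
  funext e
  refine finsum_congr fun m => ?_
  rcases lt_or_ge m 0 with h | h
  · rw [hF _ (by rw [line_apply_left (by decide)]; omega), smul_zero, smul_zero]
  · beta_reduce; rw [ibinom_symm h]

/-- If `Y_W(Y(u, x₀) v, x₂) w` is the operator product expansion of `Y_W(u, x₁) Y_W(v, x₂) w`, then
weak associativity holds. -/
theorem weakAssoc_of_isOpe {Y : V →ₗ[ℂ] VertexOperator ℂ V} {YW : V →ₗ[ℂ] VertexOperator ℂ W}
    {u v : V} {w : W} (h : IsOpe (pairSeries (YW u) (YW v) w) (fun e : Fin 2 → ℤ =>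
      HVertexOperator.coeff (YW (HVertexOperator.coeff (Y u) (e 0) v)) (e 1) w)) :
    WeakAssoc Y YW u v w := by
  obtain ⟨k, ⟨N, hN⟩, h2⟩ := h
  obtain ⟨M, hM⟩ := exists_bddAt_pairSeries (YW u) (YW v) w
  -- This power removes all negative powers of the first variable after the poles along the diagonal
  -- have been cleared.
  set l := (-N).toNat with hl
  refine ⟨l, ?_⟩
  have h3 : (fun e : Fin 2 → ℤ =>
      ∑ᶠ t : ℤ, ibinom (e 0 + t) t • pairSeries (YW u) (YW v) w ![e 0 + t, e 1 - t]) =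
      substVar (fun m c => ibinom m (m - c)) 0 1 (pairSeries (YW u) (YW v) w) := by
    funext e
    rw [substVar, ← finsum_comp_equiv (Equiv.addLeft (e 0)) (f := fun m : ℤ =>
      ibinom m (m - e 0) • pairSeries (YW u) (YW v) w (e + (m - e 0) • (bv 0 - bv 1)))]
    refine finsum_congr fun t => ?_
    have h4 : e + (e 0 + t - e 0) • (bv 0 - bv 1) = ![e 0 + t, e 1 - t] := by
      funext i
      fin_cases i <;> simp [bv_apply]
      ring
    rw [Equiv.coe_addLeft, add_sub_cancel_left, ← h4, add_sub_cancel_left]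
  rw [h3]
  have hG : BddAt 0 0 (polyMul (X 0 ^ l) (polyMul ((X 0 - X 1) ^ k)
      (pairSeries (YW u) (YW v) w))) := fun e he => by
    rw [polyMul_X_pow]
    exact hN _ ⟨0, by simp; omega⟩
  -- Without negative powers of the first variable, both expansions of the substituted series agree.
  -- One yields Y(Y(u, x₀)v, x₂) and the other Y(u, x₀ + x₂)Y(v, x₂), each times x₀ᵏ(x₀ + x₂)ˡ.
  have h5 := substVar_ibinom_sub_eq hG
  rw [substVar_polyMul isPascal_ibinom (by decide) (IsLaurent.substFinite _ (by decide) ⟨N, hN⟩),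
    h2, substVar_polyMul isPascal_ibinom_sub (by decide) (substFinite_ibinom_sub (hM.polyMul _)),
    substVar_polyMul isPascal_ibinom_sub (by decide) (substFinite_ibinom_sub hM), map_pow, map_pow,
    substPoly_X_self, substPoly_sub (by decide), polyMul_comm, polyMul_comm _ (X 0 ^ k)] at h5
  exact polyMul_X_pow_injective 0 k h5

variable {A : Submodule ℂ (VertexOperator ℂ W)} (hA : MutuallyLocal A A)
  (hcl : ∀ a ∈ A, ∀ b ∈ A, ∀ n, nthProd a b n ∈ A)

theorem isNonlocalVA_vertexMap (h1 : idField W ∈ A) :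
    IsNonlocalVA (vertexMap hA hcl) ⟨idField W, h1⟩ where
  toHasVacuum := hasVacuum_vertexMap hA hcl h1
  weakAssoc a b c := weakAssoc_of_isOpe (isOpe_vertexMap hA hcl a b c)

/-- Compatibility by powers of x₁ - x₂ alone makes the defining expansion of the products an
instance of `IsOpe`, so no general polynomial is left over. -/
theorem isVAModule_vertexMap (h1 : idField W ∈ A) :
    IsVAModule (vertexMap hA hcl) ⟨idField W, h1⟩ A.subtype where
  vacuum := rfl
  weakAssoc a b w := weakAssoc_of_isOpe (isOpe_prodOpe (hA.diagCompat a.2 b.2) w)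

end WeakAssociativity

/-! ### Locality of the vertex operators -/

section Double

variable {V : Type*} [AddCommGroup V] [Module ℂ V]

/-- The substitution `x₀ ↦ x₀ + x₂`, `x₁ ↦ x₁ + x₂`. -/
def substDouble (F : FSeries (Fin 3) V) : FSeries (Fin 3) V :=
  substVar ibinom 0 2 (substVar ibinom 1 2 F)

omit [Module ℂ V] in
theorem IsLaurent.substFinite_substVar_one_two {F : FSeries (Fin 3) V} (hF : IsLaurent F) :
    SubstFinite ibinom 0 2 (substVar ibinom 1 2 F) := by
  obtain ⟨N, hN⟩ := hF
  refine substFinite_of_bound _ fun e => ⟨N - e 0, e 1 + e 2 - 2 * N, fun m hm => ?_⟩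
  rw [substVar_one_two_apply]
  refine finsum_eq_zero_of_forall_eq_zero fun l => ?_
  rw [line_apply_left (by decide), line_apply_right (by decide),
    line_apply_other (by decide) (by decide)]
  by_cases hl : l < N
  · rw [hN _ ⟨1, hl⟩, smul_zero]
  rcases hm with hm | hm
  · rw [hN _ ⟨0, by simp only [Matrix.cons_val_zero]; omega⟩, smul_zero]
  · rw [hN _ ⟨2, by simp only [Matrix.cons_val]; omega⟩, smul_zero]

omit [Module ℂ V] in
theorem substDouble_add {F G : FSeries (Fin 3) V} (hF : IsLaurent F) (hG : IsLaurent G) :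
    substDouble (F + G) = substDouble F + substDouble G := by
  rw [substDouble, substVar_add (hF.substFinite _ (by decide)) (hG.substFinite _ (by decide)),
    substVar_add hF.substFinite_substVar_one_two hG.substFinite_substVar_one_two]
  rfl

omit [Module ℂ V] in
theorem substDouble_sum {s : Type*} (t : Finset s) (F : s → FSeries (Fin 3) V)
    (hF : ∀ i, IsLaurent (F i)) :
    substDouble (∑ i ∈ t, F i) = ∑ i ∈ t, substDouble (F i) ∧ IsLaurent (∑ i ∈ t, F i) := by
  classical
  induction t using Finset.induction_on with
  | empty =>
    refine ⟨?_, isLaurent_zero⟩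
    funext e
    simp [substDouble, substVar]
  | insert i t hi ih =>
    rw [Finset.sum_insert hi, Finset.sum_insert hi]
    exact ⟨by rw [substDouble_add (hF i) ih.2, ih.1], (hF i).add ih.2⟩

omit [Module ℂ V] in
theorem DegBdd.substVar {ι : Type*} [Fintype ι] [DecidableEq ι] {N : ℤ} {F : FSeries ι V}
    (h : DegBdd N F) (b : ℤ → ℤ → ℤ) (i j : ι) : DegBdd N (substVar b i j F) := fun e he =>
  finsum_eq_zero_of_forall_eq_zero fun m => by rw [h _ (by rwa [deg_line]), smul_zero]

/-- The difference x₁ - x₀ is invariant under a common translation by x₂. -/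
theorem substDouble_psMul (φ : PowerSeries ℂ) {F : FSeries (Fin 3) V} (hF : IsLaurent F) :
    substDouble (psMul φ (X 1 - X 0) F) = psMul φ (X 1 - X 0) (substDouble F) := by
  obtain ⟨N, hN⟩ := hF.degBdd
  have h1 : substPoly 1 2 (X 1 - X 0 : MvPolynomial (Fin 3) ℂ) = X 1 + X 2 - X 0 := by
    simp [substPoly]
  have h2 : substPoly 0 2 (X 1 + X 2 - X 0 : MvPolynomial (Fin 3) ℂ) = X 1 - X 0 := by
    simp [substPoly]
  have h3 : (X 1 + X 2 - X 0 : MvPolynomial (Fin 3) ℂ).IsHomogeneous 1 :=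
    ((isHomogeneous_X ℂ 1).add (isHomogeneous_X ℂ 2)).sub (isHomogeneous_X ℂ 0)
  rw [substDouble, substVar_psMul isPascal_ibinom (by decide) (hF.substFinite _ (by decide)) hN
    (isHomogeneous_diff _ _), h1, substVar_psMul isPascal_ibinom (by decide)
    hF.substFinite_substVar_one_two (hN.substVar _ _ _) h3, h2]
  rfl

omit [Module ℂ V] in
theorem substVar_comp_equiv {ι : Type*} [DecidableEq ι] (σ : Equiv.Perm ι) (b : ℤ → ℤ → ℤ)
    (i j : ι) (F : FSeries ι V) (e : ι → ℤ) :
    substVar b i j (fun e => F (e ∘ σ)) e = substVar b (σ.symm i) (σ.symm j) F (e ∘ σ) := by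
  simp only [substVar, Function.comp_apply, Equiv.apply_symm_apply]
  refine finsum_congr fun m => ?_
  congr 2
  funext l
  simp [bv_apply, Equiv.eq_symm_apply]

omit [Module ℂ V] in
theorem substDouble_swap {F : FSeries (Fin 3) V} (hF : IsLaurent F) :
    substDouble (fun e => F (e ∘ Equiv.swap 0 1)) = fun e => substDouble F (e ∘ Equiv.swap 0 1) := by
  have h1 : substVar ibinom 1 2 (fun e => F (e ∘ Equiv.swap 0 1)) =
      fun e => substVar ibinom 0 2 F (e ∘ Equiv.swap 0 1) :=
    _root_.funext fun e => substVar_comp_equiv (Equiv.swap 0 1) ibinom 1 2 F e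
  have h2 : substVar ibinom 0 2 (fun e => substVar ibinom 0 2 F (e ∘ Equiv.swap 0 1)) =
      fun e => substVar ibinom 1 2 (substVar ibinom 0 2 F) (e ∘ Equiv.swap 0 1) :=
    _root_.funext fun e => substVar_comp_equiv (Equiv.swap 0 1) ibinom 0 2 (substVar ibinom 0 2 F) e
  rw [substDouble, h1, h2, substDouble, substVar_comm hF]

theorem polyMul_comp_equiv {ι : Type*} [DecidableEq ι] (σ : Equiv.Perm ι) (p : MvPolynomial ι ℂ)
    (F : FSeries ι V) :
    polyMul p (fun e => F (e ∘ σ)) = fun e => polyMul (rename σ.symm p) F (e ∘ σ) := by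
  refine (polyMul_comp σ.symm (fun e => e ∘ σ) (fun e i => ?_) p F).symm
  have : bv i ∘ σ = bv (σ.symm i) := by
    funext l; simp [bv_apply, Equiv.eq_symm_apply]
  rw [← this]; rfl

omit [Module ℂ V] in
theorem IsLaurent.comp_equiv {ι : Type*} {F : FSeries ι V} (hF : IsLaurent F) (σ : Equiv.Perm ι) :
    IsLaurent fun e => F (e ∘ σ) := by
  obtain ⟨N, hN⟩ := hF
  exact ⟨N, fun e ⟨i, hi⟩ => hN _ ⟨σ.symm i, by simpa using hi⟩⟩

end Double

/-! ### Transfer of the locality relation from fields to vertex operators -/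

section Relation

variable {W : Type*} [AddCommGroup W] [Module ℂ W] {A B : Submodule ℂ (VertexOperator ℂ W)}

theorem exists_sum_of_mem_swapSpan {Q : W → FSeries (Fin 2) W} (hQ : Q ∈ swapSpan A B) :
    ∃ (r : ℕ) (φ : Fin r → PowerSeries ℂ) (n : Fin r → ℕ) (u : Fin r → B) (v : Fin r → A),
      (∀ s, FamLaurent (famMul ((X 1 - X 0) ^ n s)
        (pairSeriesSwap (u s : VertexOperator ℂ W) (v s)))) ∧
      Q = ∑ s, famPs (φ s) (X 1 - X 0) (famMul ((X 1 - X 0) ^ n s)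
        (pairSeriesSwap (u s : VertexOperator ℂ W) (v s))) := by
  have h1 : Q ∈ Submodule.span ℂ {Q | ∃ (φ : PowerSeries ℂ) (n : ℕ) (u : B) (v : A),
      FamLaurent (famMul ((X 1 - X 0) ^ n) (pairSeriesSwap (u : VertexOperator ℂ W) v)) ∧
      Q = famPs φ (X 1 - X 0) (famMul ((X 1 - X 0) ^ n)
        (pairSeriesSwap (u : VertexOperator ℂ W) v))} := by
    refine Submodule.span_le.mpr ?_ hQ
    rintro _ ⟨φ, t, ht, rfl⟩
    refine famPs_mem_of_span (isHomogeneous_diff _ _) φ ?_ ?_ ht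
    · rintro _ ⟨n, u, _, v, _, hL, rfl⟩
      exact hL
    · rintro _ ⟨n, u, hu, v, hv, hL, rfl⟩
      exact Submodule.subset_span ⟨φ, n, ⟨u, hu⟩, ⟨v, hv⟩, hL, rfl⟩
  obtain ⟨r, f, g, rfl⟩ := Submodule.mem_span_set'.mp h1
  choose φ n u v hL hg using fun s => (g s).2
  refine ⟨r, fun s => f s • φ s, n, u, v, hL, Finset.sum_congr rfl fun s _ => ?_⟩
  rw [hg s]
  exact _root_.funext fun w => (smul_psMul _ _ _ _).symm

theorem famMul_diff_pow_comm (k : ℕ) (Q : W → FSeries (Fin 2) W) :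
    famMul ((X 0 - X 1) ^ k) Q = (-1 : ℂ) ^ k • famMul ((X 1 - X 0) ^ k) Q := by
  funext w
  rw [Pi.smul_apply, famMul_apply, famMul_apply, ← polyMul_C_mul, map_pow, ← mul_pow]
  congr 2
  simp

/-- The locality relation of two fields, with exponents that are large enough for all pairs of
fields that occur in it. -/
theorem MutuallyLocal.exists_relation (hA : MutuallyLocal A A) (a b : A) :
    ∃ (k r : ℕ) (φ : Fin r → PowerSeries ℂ) (n : Fin r → ℕ) (u v : Fin r → A),
      famMul ((X 0 - X 1) ^ k) (pairSeries (a : VertexOperator ℂ W) b) ∈ swapSpan A A ∧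
      (∀ s, famMul ((X 0 - X 1) ^ n s) (pairSeries (u s : VertexOperator ℂ W) (v s)) ∈
        swapSpan A A) ∧
      (∀ s, FamLaurent (famMul ((X 1 - X 0) ^ n s)
        (pairSeriesSwap (u s : VertexOperator ℂ W) (v s)))) ∧
      famMul ((X 0 - X 1) ^ k) (pairSeries (a : VertexOperator ℂ W) b) =
        ∑ s, famPs (φ s) (X 1 - X 0) (famMul ((X 1 - X 0) ^ n s)
          (pairSeriesSwap (u s : VertexOperator ℂ W) (v s))) := by
  obtain ⟨k, hk⟩ := hA a a.2 b b.2
  obtain ⟨r, φ, n, u, v, hL, h⟩ := exists_sum_of_mem_swapSpan hk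
  choose M hM using fun s => hA (u s) (u s).2 (v s) (v s).2
  set m := ∑ s, M s with hm
  have hle : ∀ s, M s ≤ m := fun s =>
    Finset.single_le_sum (fun _ _ => Nat.zero_le _) (Finset.mem_univ s)
  -- The relation is multiplied by (x₁ - x₂)^m, with m large enough for all pairs (u s, v s).
  -- Rewriting this factor in x₂ - x₁ costs a sign, which is put into φ.
  refine ⟨m + k, r, fun s => (-1 : ℂ) ^ m • φ s, fun s => m + n s, u, v, ?_, fun s => ?_,
    fun s => ?_, ?_⟩
  · rw [pow_add, famMul_mul]
    exact famMul_pow_swapSpan hk m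
  · obtain ⟨j, hj⟩ := Nat.exists_eq_add_of_le' (hle s)
    simp only []
    rw [show m + n s = (n s + j) + M s by omega, pow_add, famMul_mul]
    exact famMul_pow_swapSpan (hM s) _
  · rw [pow_add, famMul_mul]
    exact (hL s).famMul _
  · rw [pow_add, famMul_mul, h, map_sum]
    refine Finset.sum_congr rfl fun s _ => ?_
    rw [famMul_diff_pow_comm, famMul_famPs (isHomogeneous_diff _ _) _ (hL s), pow_add, famMul_mul]
    exact _root_.funext fun w => (smul_psMul _ _ _ _).symm

variable (hA : MutuallyLocal A A) (hcl : ∀ a ∈ A, ∀ b ∈ A, ∀ n, nthProd a b n ∈ A)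

theorem expand_pairSeriesSwap (u v c : A) (w : W) :
    expand (pairSeriesSwap (vertexMap hA hcl u) (vertexMap hA hcl v) c) w =
      fun e => iterRight u v c w (e ∘ Equiv.swap 0 1) := by
  funext e
  rw [expand_apply, pairSeriesSwap, coe_coeff_vertexMap, coe_coeff_vertexMap, iterRight]
  rfl

theorem expand_sum {s : Type*} (t : Finset s) (F : s → FSeries (Fin 2) A) (w : W) :
    expand (∑ i ∈ t, F i) w = ∑ i ∈ t, expand (F i) w := by
  classical
  induction t using Finset.induction_on with
  | empty => rw [Finset.sum_empty, Finset.sum_empty]; exact lift_zero _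
  | insert i t hi ih =>
    rw [Finset.sum_insert hi, Finset.sum_insert hi, ← ih]
    exact lift_add _ _ _

theorem psMul_expand (φ : PowerSeries ℂ) {F : FSeries (Fin 2) A} (hF : IsLaurent F) (w : W) :
    psMul φ (X 1 - X 0) (expand F w) = expand (psMul φ (X 1 - X 0) F) w := by
  have h1 := psMul_lift indep_zero_one' (evalAt A w) (Q := fun _ => F) (δ := X 1 - X 0)
    (fun _ => hF.psFinite (isHomogeneous_diff _ _)) φ
  rw [show rename (![0, 1] : Fin 2 → Fin 3) (X 1 - X 0 : MvPolynomial (Fin 2) ℂ) = X 1 - X 0 by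
    simp] at h1
  exact h1

theorem isLaurent_polyMul_pairSeriesSwap_vertexMap {u v : A} {n : ℕ}
    (hn : famMul ((X 0 - X 1) ^ n) (pairSeries (u : VertexOperator ℂ W) v) ∈ swapSpan A A)
    (c : A) : IsLaurent (polyMul ((X 1 - X 0) ^ n)
      (pairSeriesSwap (vertexMap hA hcl u) (vertexMap hA hcl v) c)) := by
  have h1 : pairSeriesSwap (vertexMap hA hcl u) (vertexMap hA hcl v) c =
      fun e => pairSeries (vertexMap hA hcl u) (vertexMap hA hcl v) c (e ∘ Equiv.swap 0 1) := by
    funext e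
    simp only [pairSeries, pairSeriesSwap, Function.comp_apply, Equiv.swap_apply_left,
      Equiv.swap_apply_right]
  rw [h1, polyMul_comp_equiv]
  have h2 : rename (Equiv.swap (0 : Fin 2) 1).symm ((X 1 - X 0) ^ n : MvPolynomial (Fin 2) ℂ) =
      (X 0 - X 1) ^ n := by simp
  rw [h2]
  exact (isLaurent_polyMul_pairSeries_vertexMap hA hcl hn c).comp_equiv _

/-- The series `a(x₁) b(x₀) c(x₂) w`. -/
def tripleSwap (a b c : VertexOperator ℂ W) (w : W) : FSeries (Fin 3) W := fun e =>
  tripleSeries a b c w (e ∘ Equiv.swap 0 1)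

/-- Families of series in two variables followed by `c(x₂)`. -/
abbrev withThird (c : VertexOperator ℂ W) (Q : W → FSeries (Fin 2) W) : W → FSeries (Fin 3) W :=
  famLift ![0, 1] 2 (fun _ => LinearMap.id) (fun m w => HVertexOperator.coeff c m w) Q

theorem withThird_pairSeries (a b c : VertexOperator ℂ W) :
    withThird c (pairSeries a b) = tripleSeries a b c := rfl

theorem withThird_pairSeriesSwap (a b c : VertexOperator ℂ W) :
    withThird c (pairSeriesSwap a b) = tripleSwap a b c := rfl

theorem withThird_sum {s : Type*} (t : Finset s) (c : VertexOperator ℂ W)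
    (Q : s → W → FSeries (Fin 2) W) : withThird c (∑ i ∈ t, Q i) = ∑ i ∈ t, withThird c (Q i) := by
  classical
  induction t using Finset.induction_on with
  | empty => rw [Finset.sum_empty, Finset.sum_empty]; exact famLift_zero
  | insert i t hi ih => rw [Finset.sum_insert hi, Finset.sum_insert hi, ← ih]; exact famLift_add _ _

theorem rename_diff_zero_one :
    rename (![0, 1] : Fin 2 → Fin 3) (X 1 - X 0 : MvPolynomial (Fin 2) ℂ) = X 1 - X 0 := by simp

theorem rename_diff_pow_zero_one (n : ℕ) :
    rename (![0, 1] : Fin 2 → Fin 3) ((X 1 - X 0) ^ n : MvPolynomial (Fin 2) ℂ) =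
      (X 1 - X 0) ^ n := by simp

theorem psFinite_tripleSwap {u v c : VertexOperator ℂ W} {n : ℕ}
    (hL : FamLaurent (famMul ((X 1 - X 0) ^ n) (pairSeriesSwap u v))) (w : W) :
    PSFinite (X 1 - X 0) (polyMul ((X 1 - X 0) ^ n) (tripleSwap u v c w)) := by
  have h1 := PSFinite.lift indep_zero_one' (fun _ : ℤ => (LinearMap.id : W →ₗ[ℂ] W))
    (Q := fun m => famMul ((X 1 - X 0) ^ n) (pairSeriesSwap u v) (HVertexOperator.coeff c m w))
    fun m => (hL _).psFinite (isHomogeneous_diff 1 0)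
  rw [rename_diff_zero_one] at h1
  have h2 := congrFun (famMul_famLift indep_zero_one' ((X 1 - X 0) ^ n) (pairSeriesSwap u v)
    (α := fun _ : ℤ => (LinearMap.id : W →ₗ[ℂ] W)) (β := fun m w => HVertexOperator.coeff c m w)) w
  rw [rename_diff_pow_zero_one] at h2
  rw [← withThird_pairSeriesSwap]
  exact (congrArg (PSFinite (X 1 - X 0)) h2).mpr h1

theorem tripleSeries_relation {a b c : VertexOperator ℂ W} {k r : ℕ} {φ : Fin r → PowerSeries ℂ}
    {n : Fin r → ℕ} {u v : Fin r → A}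
    (hL : ∀ s, FamLaurent (famMul ((X 1 - X 0) ^ n s)
        (pairSeriesSwap (u s : VertexOperator ℂ W) (v s))))
    (h : famMul ((X 0 - X 1) ^ k) (pairSeries a b) =
        ∑ s, famPs (φ s) (X 1 - X 0) (famMul ((X 1 - X 0) ^ n s)
          (pairSeriesSwap (u s : VertexOperator ℂ W) (v s)))) (w : W) :
    polyMul ((X 0 - X 1) ^ k) (tripleSeries a b c w) = ∑ s, psMul (φ s) (X 1 - X 0)
      (polyMul ((X 1 - X 0) ^ n s) (tripleSwap (u s) (v s) c w)) := by
  have h1 := congrArg (withThird c) h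
  rw [withThird_sum] at h1
  have h2 : ∀ s, withThird c (famPs (φ s) (X 1 - X 0) (famMul ((X 1 - X 0) ^ n s)
      (pairSeriesSwap (u s : VertexOperator ℂ W) (v s)))) = famPs (φ s) (X 1 - X 0)
      (famMul ((X 1 - X 0) ^ n s) (tripleSwap (u s) (v s) c)) := fun s => by
    rw [withThird, ← famPs_famLift indep_zero_one' (isHomogeneous_diff _ _) _ (hL s),
      ← famMul_famLift indep_zero_one', rename_diff_zero_one, rename_diff_pow_zero_one,
      ← withThird_pairSeriesSwap]
  have h3 : withThird c (famMul ((X 0 - X 1) ^ k) (pairSeries a b)) =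
      famMul ((X 0 - X 1) ^ k) (tripleSeries a b c) := by
    rw [withThird, ← famMul_famLift indep_zero_one', ← withThird_pairSeries]
    simp only [map_pow, map_sub, rename_X]
    rfl
  rw [h3, Finset.sum_congr rfl fun s _ => h2 s] at h1
  have h4 := congrFun h1 w
  rw [Finset.sum_apply] at h4
  exact h4

theorem polyMul_tripleSwap (u v c : VertexOperator ℂ W) (n m : ℕ) (w : W) :
    polyMul ((X 1 - X 0) ^ n * ((X 0 - X 2) * (X 1 - X 2)) ^ m) (tripleSwap u v c w) =
      fun e => polyMul ((X 0 - X 1) ^ n * ((X 0 - X 2) * (X 1 - X 2)) ^ m)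
        (tripleSeries u v c w) (e ∘ Equiv.swap 0 1) := by
  have h2 : rename (Equiv.swap (0 : Fin 3) 1).symm
      ((X 1 - X 0) ^ n * ((X 0 - X 2) * (X 1 - X 2)) ^ m : MvPolynomial (Fin 3) ℂ) =
      (X 0 - X 1) ^ n * ((X 0 - X 2) * (X 1 - X 2)) ^ m := by
    simp only [map_mul, map_pow, map_sub, rename_X, Equiv.symm_swap, Equiv.swap_apply_left,
      Equiv.swap_apply_right, Equiv.swap_apply_of_ne_of_ne (show (2 : Fin 3) ≠ 0 by decide)
        (show (2 : Fin 3) ≠ 1 by decide)]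
    ring
  have h3 := polyMul_comp_equiv (Equiv.swap (0 : Fin 3) 1)
    ((X 1 - X 0) ^ n * ((X 0 - X 2) * (X 1 - X 2)) ^ m) (tripleSeries u v c w)
  rw [h2] at h3
  exact h3

theorem substPoly_clearing (i m : ℕ) : substPoly 0 2 (substPoly 1 2
      ((X 0 - X 1) ^ i * ((X 0 - X 2) * (X 1 - X 2)) ^ m)) =
      (X 0 ^ m * X 1 ^ m * rename ![0, 1] ((X 0 - X 1) ^ i) : MvPolynomial (Fin 3) ℂ) := by
  simp [substPoly, mul_pow]
  ring

theorem substDouble_tripleSeries (a b c : A) (k m : ℕ) (w : W)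
    (hp : IsLaurent (polyMul ((X 0 - X 1) ^ k * ((X 0 - X 2) * (X 1 - X 2)) ^ m)
      (tripleSeries a b c w))) :
    substDouble (polyMul ((X 0 - X 1) ^ k * ((X 0 - X 2) * (X 1 - X 2)) ^ m)
      (tripleSeries a b c w)) =
      polyMul (X 0 ^ m * X 1 ^ m) (expand (polyMul ((X 0 - X 1) ^ k)
        (pairSeries (vertexMap hA hcl a) (vertexMap hA hcl b) c)) w) := by
  rw [substDouble, substVar_tripleSeries_right (hA.diagCompat b.2 c.2)
      (fun i => hA.diagCompat a.2 (hcl b b.2 c c.2 i)) hp, substPoly_clearing, polyMul_mul,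
    ← expand_pairSeries hA hcl, polyMul_expand]

theorem substDouble_tripleSwap (u v c : A) (n m : ℕ) (w : W)
    (hp : IsLaurent (polyMul ((X 0 - X 1) ^ n * ((X 0 - X 2) * (X 1 - X 2)) ^ m)
      (tripleSeries u v c w))) :
    substDouble (polyMul ((X 1 - X 0) ^ n * ((X 0 - X 2) * (X 1 - X 2)) ^ m)
      (tripleSwap u v c w)) =
      polyMul (X 0 ^ m * X 1 ^ m) (expand (polyMul ((X 1 - X 0) ^ n)
        (pairSeriesSwap (vertexMap hA hcl u) (vertexMap hA hcl v) c)) w) := by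
  have h1 : rename (Equiv.swap (0 : Fin 3) 1)
      (X 0 ^ m * X 1 ^ m * rename ![0, 1] ((X 1 - X 0) ^ n) : MvPolynomial (Fin 3) ℂ) =
      X 0 ^ m * X 1 ^ m * rename ![0, 1] ((X 0 - X 1) ^ n) := by
    simp [mul_comm (X 1 ^ m : MvPolynomial (Fin 3) ℂ)]
  have h2 := polyMul_comp_equiv (Equiv.swap (0 : Fin 3) 1)
    (X 0 ^ m * X 1 ^ m * rename ![0, 1] ((X 1 - X 0) ^ n)) (iterRight u v c w)
  rw [Equiv.symm_swap, h1] at h2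
  rw [polyMul_tripleSwap, substDouble_swap hp, substDouble_tripleSeries hA hcl _ _ _ _ _ _ hp,
    ← polyMul_expand, ← polyMul_expand, expand_pairSeriesSwap, expand_pairSeries,
    ← polyMul_mul (X 0 ^ m * X 1 ^ m) (rename ![0, 1] ((X 1 - X 0) ^ n)), h2,
    ← polyMul_mul (X 0 ^ m * X 1 ^ m) (rename ![0, 1] ((X 0 - X 1) ^ n))]

theorem isLaurent_clearing_mono {p q : MvPolynomial (Fin 3) ℂ} {i m : ℕ} {F : FSeries (Fin 3) W}
    (h : IsLaurent (polyMul (p * q ^ i) F)) (hi : i ≤ m) : IsLaurent (polyMul (p * q ^ m) F) := by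
  obtain ⟨j, rfl⟩ := Nat.exists_eq_add_of_le' hi
  rw [pow_add, mul_left_comm, polyMul_mul]
  exact h.polyMul _

theorem polyMul_psMul_polyMul {ι V : Type*} [DecidableEq ι] [AddCommGroup V] [Module ℂ V]
    {δ p : MvPolynomial ι ℂ} {F : FSeries ι V} (h : PSFinite δ (polyMul p F)) (φ : PowerSeries ℂ)
    (q : MvPolynomial ι ℂ) :
    polyMul q (psMul φ δ (polyMul p F)) = psMul φ δ (polyMul (p * q) F) := by
  rw [polyMul_psMul _ h, polyMul_mul, polyMul_comm]

theorem polyMul_clearing_relation {a b c : VertexOperator ℂ W} {k r : ℕ}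
    {φ : Fin r → PowerSeries ℂ} {n : Fin r → ℕ} {u v : Fin r → A}
    (hL : ∀ s, FamLaurent (famMul ((X 1 - X 0) ^ n s)
        (pairSeriesSwap (u s : VertexOperator ℂ W) (v s))))
    (h : famMul ((X 0 - X 1) ^ k) (pairSeries a b) =
        ∑ s, famPs (φ s) (X 1 - X 0) (famMul ((X 1 - X 0) ^ n s)
          (pairSeriesSwap (u s : VertexOperator ℂ W) (v s)))) (w : W) (q : MvPolynomial (Fin 3) ℂ) :
    polyMul ((X 0 - X 1) ^ k * q) (tripleSeries a b c w) = ∑ s, psMul (φ s) (X 1 - X 0)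
      (polyMul ((X 1 - X 0) ^ n s * q) (tripleSwap (u s) (v s) c w)) := by
  rw [polyMul_mul, polyMul_comm, tripleSeries_relation hL h, polyMul_sum]
  exact Finset.sum_congr rfl fun s _ => polyMul_psMul_polyMul (psFinite_tripleSwap (hL s) w) _ _

theorem polyMul_psMul_expand {F : FSeries (Fin 2) A} (hF : IsLaurent F) (φ : PowerSeries ℂ) (w : W)
    (q : MvPolynomial (Fin 3) ℂ) : psMul φ (X 1 - X 0) (polyMul q (expand F w)) =
      polyMul q (expand (psMul φ (X 1 - X 0) F) w) := by
  have h := PSFinite.lift indep_zero_one' (evalAt A w) (Q := fun _ => F) (δ := X 1 - X 0)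
    (fun _ => hF.psFinite (isHomogeneous_diff _ _))
  rw [rename_diff_zero_one] at h
  rw [← psMul_expand _ hF]
  exact (polyMul_psMul _ h _).symm

/-- The relation is applied in front of c(x₂), cleared by ((x₀ - x₂)(x₁ - x₂))^m and translated by
x₂. The coefficients φ(x₁ - x₀) do not change, and the clearing factors become the monomial x₀^m
x₁^m. -/
theorem expand_relation {a b : A} {k r : ℕ} {φ : Fin r → PowerSeries ℂ}
    {n : Fin r → ℕ} {u v : Fin r → A}
    (hL : ∀ s, FamLaurent (famMul ((X 1 - X 0) ^ n s)
        (pairSeriesSwap (u s : VertexOperator ℂ W) (v s))))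
    (h : famMul ((X 0 - X 1) ^ k) (pairSeries (a : VertexOperator ℂ W) b) =
        ∑ s, famPs (φ s) (X 1 - X 0) (famMul ((X 1 - X 0) ^ n s)
          (pairSeriesSwap (u s : VertexOperator ℂ W) (v s)))) {c : A} {w : W} {m : ℕ}
    (hS : ∀ s, IsLaurent (polyMul ((X 1 - X 0) ^ n s)
      (pairSeriesSwap (vertexMap hA hcl (u s)) (vertexMap hA hcl (v s)) c)))
    (hF0 : IsLaurent (polyMul ((X 0 - X 1) ^ k * ((X 0 - X 2) * (X 1 - X 2)) ^ m)
      (tripleSeries a b c w)))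
    (hFs : ∀ s, IsLaurent (polyMul ((X 0 - X 1) ^ n s * ((X 0 - X 2) * (X 1 - X 2)) ^ m)
      (tripleSeries (u s) (v s) c w))) :
    polyMul (X 0 ^ m * X 1 ^ m) (expand (polyMul ((X 0 - X 1) ^ k)
      (pairSeries (vertexMap hA hcl a) (vertexMap hA hcl b) c)) w) =
    polyMul (X 0 ^ m * X 1 ^ m) (expand (∑ s, psMul (φ s) (X 1 - X 0)
      (polyMul ((X 1 - X 0) ^ n s)
        (pairSeriesSwap (vertexMap hA hcl (u s)) (vertexMap hA hcl (v s)) c))) w) := by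
  have hTL : ∀ s, IsLaurent (polyMul ((X 1 - X 0) ^ n s * ((X 0 - X 2) * (X 1 - X 2)) ^ m)
        (tripleSwap (u s) (v s) c w)) := fun s => by
    rw [polyMul_tripleSwap]
    exact (hFs s).comp_equiv _
  have h1 := congrArg substDouble
    (polyMul_clearing_relation (c := c) hL h w (((X 0 - X 2) * (X 1 - X 2)) ^ m))
  rw [substDouble_tripleSeries hA hcl _ _ _ _ _ _ hF0,
    (substDouble_sum _ _ fun s => (hTL s).psMul _ _).1] at h1
  rw [h1, expand_sum, polyMul_sum]
  refine Finset.sum_congr rfl fun s _ => ?_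
  rw [substDouble_psMul _ (hTL s), substDouble_tripleSwap hA hcl _ _ _ _ _ _ (hFs s)]
  exact polyMul_psMul_expand (hS s) _ _ _

/-- The locality relation of two fields holds for the corresponding vertex operators. -/
theorem pairSeries_vertexMap_relation {a b : A} {k r : ℕ} {φ : Fin r → PowerSeries ℂ}
    {n : Fin r → ℕ} {u v : Fin r → A}
    (hk : famMul ((X 0 - X 1) ^ k) (pairSeries (a : VertexOperator ℂ W) b) ∈ swapSpan A A)
    (hn : ∀ s, famMul ((X 0 - X 1) ^ n s) (pairSeries (u s : VertexOperator ℂ W) (v s)) ∈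
      swapSpan A A)
    (hL : ∀ s, FamLaurent (famMul ((X 1 - X 0) ^ n s)
        (pairSeriesSwap (u s : VertexOperator ℂ W) (v s))))
    (h : famMul ((X 0 - X 1) ^ k) (pairSeries (a : VertexOperator ℂ W) b) =
        ∑ s, famPs (φ s) (X 1 - X 0) (famMul ((X 1 - X 0) ^ n s)
          (pairSeriesSwap (u s : VertexOperator ℂ W) (v s)))) (c : A) :
    polyMul ((X 0 - X 1) ^ k) (pairSeries (vertexMap hA hcl a) (vertexMap hA hcl b) c) =
      ∑ s, psMul (φ s) (X 1 - X 0) (polyMul ((X 1 - X 0) ^ n s)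
        (pairSeriesSwap (vertexMap hA hcl (u s)) (vertexMap hA hcl (v s)) c)) := by
  obtain ⟨m₀, hm₀⟩ := exists_isLaurent_tripleSeries_of_mem hA hA b.2 c.2 hk
  choose m hm using fun s => exists_isLaurent_tripleSeries_of_mem hA hA (v s).2 c.2 (hn s)
  -- One exponent for all triple products in the relation; it may depend on c, because the resulting
  -- monomial is cancelled.
  have hle : ∀ s, m s ≤ m₀ + ∑ s, m s := fun s =>
    (Finset.single_le_sum (fun _ _ => Nat.zero_le _) (Finset.mem_univ s)).trans (Nat.le_add_left _ _)
  refine expand_injective fun w => ?_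
  have h1 := expand_relation hA hcl hL h
    (fun s => isLaurent_polyMul_pairSeriesSwap_vertexMap hA hcl (hn s) c)
    (isLaurent_clearing_mono (hm₀ w) (Nat.le_add_right m₀ (∑ s, m s)))
    fun s => isLaurent_clearing_mono (hm s w) (hle s)
  rw [polyMul_mul, polyMul_mul] at h1
  exact polyMul_X_pow_injective 1 _ (polyMul_X_pow_injective 0 _ h1)

end Relation

/-! ### Sums along lines -/

section Signs

theorem neg_one_zpow_congr {a b : ℤ} (h : Even (a - b)) : (-1 : ℂ) ^ a = (-1) ^ b := by
  rw [← sub_add_cancel a b, zpow_add₀ (by norm_num), h.neg_one_zpow, one_mul]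

theorem neg_one_zpow_succ (a : ℤ) : (-1 : ℂ) ^ (a + 1) = -(-1) ^ a := by
  rw [zpow_add_one₀ (by norm_num), mul_neg_one]

theorem ibinom_neg (r c : ℤ) :
    ((ibinom (-r) c : ℤ) : ℂ) = (-1) ^ c * ((ibinom (r + c - 1) c : ℤ) : ℂ) := by
  rcases lt_or_ge c 0 with hc | hc
  · rw [ibinom_of_neg _ hc, ibinom_of_neg _ hc]
    simp
  · obtain ⟨n, rfl⟩ := Int.eq_ofNat_of_zero_le hc
    rw [ibinom_natCast, ibinom_natCast, Ring.choose_neg]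
    simp [Units.smul_def, Int.negOnePow_def]

/-- `x ^ d` is the difference of the expansions of a rational function in `x` and in `x⁻¹`, in
terms of binomial coefficients. -/
theorem ibinom_eq_sub (d M : ℤ) : ((ibinom d M : ℤ) : ℂ) =
    (-1) ^ (d - M) * ((ibinom (-M - 1) (d - M) : ℤ) : ℂ) -
      (-1) ^ (M + d) * ((ibinom (-M - 1) (-1 - d) : ℤ) : ℂ) := by
  have h0 : ∀ c : ℤ, ((ibinom (-M - 1) c : ℤ) : ℂ) =
      (-1) ^ c * ((ibinom (M + c) c : ℤ) : ℂ) := fun c => by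
    rw [show -M - 1 = -(M + 1) by ring, ibinom_neg, show M + 1 + c - 1 = M + c by ring]
  have hs : ∀ a : ℤ, (-1 : ℂ) ^ a * (-1) ^ a = 1 := fun a => by
    rw [← zpow_add₀ (by norm_num)]
    exact (Even.add_self a).neg_one_zpow
  -- For M < 0 the two terms on the right cancel by symmetry. For M ≥ 0 exactly the first of them
  -- vanishes if d < 0, and the second vanishes if d ≥ 0.
  rcases lt_or_ge M 0 with hM | hM
  · rw [ibinom_of_neg _ hM, ← ibinom_symm (m := -M - 1) (by omega) (d - M),
      show -M - 1 - (d - M) = -1 - d by ring, neg_one_zpow_congr (a := d - M) (b := M + d)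
        ⟨-M, by ring⟩]
    simp
  rcases lt_or_ge d 0 with hd | hd
  · rw [ibinom_of_neg _ (show d - M < 0 by omega), h0,
      show d = -(-d) by ring, ibinom_neg, ← ibinom_symm (m := M + (-1 - - -d)) (by omega),
      show M + (-1 - - -d) - (-1 - - -d) = M by ring, show -d + M - 1 = M + (-1 - - -d) by ring,
      ← mul_assoc, ← zpow_add₀ (by norm_num), show M + - -d + (-1 - - -d) = (M - 2) + 1 by ring,
      neg_one_zpow_succ, neg_one_zpow_congr (a := M - 2) (b := M) ⟨-1, by ring⟩]
    simp
  · rw [ibinom_of_neg _ (show -1 - d < 0 by omega), h0, ← mul_assoc, hs,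
      show M + (d - M) = d by ring, ibinom_symm hd]
    simp

/-- Up to sign, the coefficients of `(x₁ - x₂) ^ (-K)` in nonnegative powers of `x₂`. -/
def leftCoeff (a K m : ℤ) : ℂ := (-1) ^ (m - a - K) * ((ibinom (-K) (m - a - K) : ℤ) : ℂ)

/-- Up to sign, the coefficients of `(x₁ - x₂) ^ (-K)` in nonnegative powers of `x₁`. -/
def rightCoeff (a K m : ℤ) : ℂ := (-1) ^ (K + a - m) * ((ibinom (-K) (a - m) : ℤ) : ℂ)

theorem leftCoeff_of_lt {a K m : ℤ} (h : m < a + K) : leftCoeff a K m = 0 := by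
  rw [leftCoeff, ibinom_of_neg _ (by omega)]; simp

theorem rightCoeff_of_lt {a K m : ℤ} (h : a < m) : rightCoeff a K m = 0 := by
  rw [rightCoeff, ibinom_of_neg _ (by omega)]; simp

/-- Taking differences of weights corresponds to multiplying (x₁ - x₂)^(-K) by x₁ - x₂, whence K
drops by one. -/
theorem leftCoeff_succ_sub (a K m : ℤ) :
    leftCoeff a K (m + 1) - leftCoeff a K m = leftCoeff a (K - 1) m := by
  have h := isPascal_ibinom (-K) (m - a - K + 1)
  rw [add_sub_cancel_right] at h
  rw [leftCoeff, leftCoeff, leftCoeff, show m + 1 - a - K = m - a - K + 1 by ring,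
    show m - a - (K - 1) = m - a - K + 1 by ring, show -(K - 1) = -K + 1 by ring, h,
    neg_one_zpow_succ]
  push_cast
  ring

theorem rightCoeff_succ_sub (a K m : ℤ) :
    rightCoeff a K (m + 1) - rightCoeff a K m = rightCoeff a (K - 1) m := by
  have h := isPascal_ibinom (-K) (a - m)
  rw [rightCoeff, rightCoeff, rightCoeff, show a - (m + 1) = a - m - 1 by ring,
    show -(K - 1) = -K + 1 by ring, h, show K + a - (m + 1) = K - 1 + a - m by ring,
    show K + a - m = K - 1 + a - m + 1 by ring, neg_one_zpow_succ]
  push_cast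
  ring

/-- A derivative of the delta function is the difference of the two expansions of a negative power
of x₁ - x₂. The three weights are those of the three terms of the Jacobi identity. -/
theorem ibinom_eq_leftCoeff_sub (a K m : ℤ) :
    ((ibinom (m - 1 - a) (K - 1) : ℤ) : ℂ) = leftCoeff a K m - rightCoeff a K m := by
  rw [ibinom_eq_sub, leftCoeff, rightCoeff, show m - 1 - a - (K - 1) = m - a - K by ring,
    show -(K - 1) - 1 = -K by ring, show -1 - (m - 1 - a) = a - m by ring,
    neg_one_zpow_congr (a := K - 1 + (m - 1 - a)) (b := K + a - m) ⟨m - 1 - a, by ring⟩]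

end Signs

section Lines

variable {V : Type*} [AddCommGroup V] [Module ℂ V]

/-- The sum of the coefficients of total degree `S`, with weights. -/
def lineSum (c : ℤ → ℂ) (S : ℤ) (F : FSeries (Fin 2) V) : V := ∑ᶠ m : ℤ, c m • F ![m, S - m]

theorem lineSum_eq_sum {c : ℤ → ℂ} {S : ℤ} {F : FSeries (Fin 2) V} (T : Finset ℤ)
    (h : ∀ m, m ∉ T → c m = 0 ∨ F ![m, S - m] = 0) :
    lineSum c S F = ∑ m ∈ T, c m • F ![m, S - m] :=
  finsum_eq_sum _ fun m hm => by rcases h m hm with h | h <;> rw [h] <;> simp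

theorem polyMul_diff_apply (F : FSeries (Fin 2) V) (m n : ℤ) :
    polyMul (X 0 - X 1) F ![m, n] = F ![m - 1, n] - F ![m, n - 1] := by
  rw [polyMul_sub_left, Pi.sub_apply, polyMul_X, polyMul_X]
  congr 2 <;> funext i <;> fin_cases i <;> simp [bv_apply]

/-- Summation by parts; finiteness of both sums is required in order to separate them. -/
theorem lineSum_polyMul_diff {c : ℤ → ℂ} {S : ℤ} {F : FSeries (Fin 2) V}
    (h0 : (Function.support fun m => c m • F ![m, S - 1 - m]).Finite)
    (h1 : (Function.support fun m => c (m + 1) • F ![m, S - 1 - m]).Finite) :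
    lineSum c S (polyMul (X 0 - X 1) F) = lineSum (fun m => c (m + 1) - c m) (S - 1) F := by
  have e1 : ∀ m, c m • polyMul (X 0 - X 1) F ![m, S - m] =
      c m • F ![m - 1, S - m] - c m • F ![m, S - 1 - m] := fun m => by
    rw [polyMul_diff_apply, smul_sub, show S - m - 1 = S - 1 - m by ring]
  have e2 : ∀ m, c (m + 1) • F ![m + 1 - 1, S - (m + 1)] = c (m + 1) • F ![m, S - 1 - m] :=
    fun m => by rw [add_sub_cancel_right, show S - (m + 1) = S - 1 - m by ring]
  have h2 : (Function.support fun m => c m • F ![m - 1, S - m]).Finite := by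
    refine (h1.image (· + 1)).subset fun m hm => ⟨m - 1, ?_, sub_add_cancel m 1⟩
    rw [Function.mem_support, ← e2, sub_add_cancel]
    exact hm
  rw [lineSum, finsum_congr e1, finsum_sub_distrib h2 h0,
    ← finsum_comp_equiv (Equiv.addRight (1 : ℤ)) (f := fun m => c m • F ![m - 1, S - m])]
  simp only [Equiv.coe_addRight, e2]
  rw [← finsum_sub_distrib h1 h0]
  exact finsum_congr fun m => (sub_smul _ _ _).symm

/-- The weights vanish for small m and the series for large m. So a bound on the powers of the
second variable suffices, as is available for a(x₁)b(x₂)w. -/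
theorem lineSum_leftCoeff {F : FSeries (Fin 2) V} {N : ℤ} (hF : BddAt 1 N F) (a K S : ℤ) (k : ℕ) :
    lineSum (leftCoeff a K) S (polyMul ((X 0 - X 1) ^ k) F) =
      lineSum (leftCoeff a (K - k)) (S - k) F := by
  induction k generalizing K S with
  | zero => simp
  | succ k ih =>
    have hb := hF.polyMul ((X 0 - X 1) ^ k)
    rw [pow_succ', polyMul_mul, lineSum_polyMul_diff]
    · simp only [leftCoeff_succ_sub]
      rw [show (fun m => leftCoeff a (K - 1) m) = leftCoeff a (K - 1) from rfl, ih]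
      push_cast
      rw [sub_sub, sub_sub, add_comm (1 : ℤ)]
    all_goals
      refine (Set.finite_Icc (a + K - 1) (S - 1 - N)).subset fun m hm => ?_
      contrapose! hm
      rw [Set.mem_Icc, not_and_or, not_le, not_le] at hm
      rw [Function.notMem_support]
      rcases hm with hm | hm
      · rw [leftCoeff_of_lt (by omega), zero_smul]
      · rw [hb _ (by simp; omega), smul_zero]

/-- Here the weights vanish for large m and a bound in the first variable is needed, as is available
for u(x₂)v(x₁)w. -/
theorem lineSum_rightCoeff {F : FSeries (Fin 2) V} {N : ℤ} (hF : BddAt 0 N F) (a K S : ℤ) (k : ℕ) :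
    lineSum (rightCoeff a K) S (polyMul ((X 0 - X 1) ^ k) F) =
      lineSum (rightCoeff a (K - k)) (S - k) F := by
  induction k generalizing K S with
  | zero => simp
  | succ k ih =>
    have hb := hF.polyMul ((X 0 - X 1) ^ k)
    rw [pow_succ', polyMul_mul, lineSum_polyMul_diff]
    · simp only [rightCoeff_succ_sub]
      rw [show (fun m => rightCoeff a (K - 1) m) = rightCoeff a (K - 1) from rfl, ih]
      push_cast
      rw [sub_sub, sub_sub, add_comm (1 : ℤ)]
    all_goals
      refine (Set.finite_Icc N a).subset fun m hm => ?_
      contrapose! hm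
      rw [Set.mem_Icc, not_and_or, not_le, not_le] at hm
      rw [Function.notMem_support]
      rcases hm with hm | hm
      · rw [hb _ (by simpa using hm), smul_zero]
      · rw [rightCoeff_of_lt (by omega), zero_smul]

theorem lineSum_sub {c c' : ℤ → ℂ} {S : ℤ} {F : FSeries (Fin 2) V} (hF : IsLaurent F) :
    lineSum (fun m => c m - c' m) S F = lineSum c S F - lineSum c' S F := by
  obtain ⟨N, hN⟩ := hF
  have h : ∀ m, m ∉ Finset.Icc N (S - N) → F ![m, S - m] = 0 := fun m hm => by
    rw [Finset.mem_Icc, not_and_or, not_le, not_le] at hm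
    rcases hm with hm | hm
    · exact hN _ ⟨0, by simpa using hm⟩
    · exact hN _ ⟨1, by simp; omega⟩
  rw [lineSum_eq_sum _ fun m hm => Or.inr (h m hm), lineSum_eq_sum _ fun m hm => Or.inr (h m hm),
    lineSum_eq_sum _ fun m hm => Or.inr (h m hm), ← Finset.sum_sub_distrib]
  exact Finset.sum_congr rfl fun m _ => sub_smul _ _ _

theorem lineSum_sum {s : Type*} (t : Finset s) (c : ℤ → ℂ) (S : ℤ) (F : s → FSeries (Fin 2) V)
    (hF : ∀ i, IsLaurent (F i)) :
    lineSum c S (∑ i ∈ t, F i) = ∑ i ∈ t, lineSum c S (F i) := by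
  simp only [lineSum, Finset.sum_apply, Finset.smul_sum]
  refine finsum_sum_comm t _ fun i _ => ?_
  obtain ⟨N, hN⟩ := hF i
  refine (Set.finite_Icc N (S - N)).subset fun m hm => ?_
  contrapose! hm
  rw [Set.mem_Icc, not_and_or, not_le, not_le] at hm
  rw [Function.notMem_support]
  rcases hm with hm | hm
  · rw [hN _ ⟨0, by simpa using hm⟩, smul_zero]
  · rw [hN _ ⟨1, by simp; omega⟩, smul_zero]

theorem lineSum_psMul (c : ℤ → ℂ) (S : ℤ) (φ : PowerSeries ℂ) {F : FSeries (Fin 2) V}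
    (hF : IsLaurent F) :
    lineSum c S (psMul φ (X 1 - X 0) F) =
      ∑ᶠ j : ℕ, PowerSeries.coeff j φ • lineSum c S (polyMul ((X 1 - X 0) ^ j) F) := by
  obtain ⟨N, hN⟩ := hF
  set T := Finset.Icc N (S - N) with hT
  have h1 : ∀ (G : FSeries (Fin 2) V), (∀ i : Fin 2, BddAt i N G) →
      lineSum c S G = ∑ m ∈ T, c m • G ![m, S - m] := fun G hG =>
    lineSum_eq_sum _ fun m hm => by
      rw [hT, Finset.mem_Icc, not_and_or, not_le, not_le] at hm
      rcases hm with hm | hm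
      · exact Or.inr (hG 0 _ (by simpa using hm))
      · exact Or.inr (hG 1 _ (by simp; omega))
  have hb : ∀ i : Fin 2, BddAt i N F := fun i e he => hN e ⟨i, he⟩
  have hd : DegBdd (2 * N) F := fun e he => hN e (by
    by_contra! hc
    have h3 : deg e = e 0 + e 1 := by simp [deg, Fin.sum_univ_two]
    have := hc 0
    have := hc 1
    omega)
  set J := (S - 2 * N + 1).toNat with hJ
  have h2 : ∀ m, ∀ j ≥ J, polyMul ((X 1 - X 0) ^ j) F ![m, S - m] = 0 := fun m j hj =>
    hd.polyMul_of_isHomogeneous (by simpa using (isHomogeneous_diff (1 : Fin 2) 0).pow j) _ (by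
      have h3 : deg ![m, S - m] = S := by simp [deg, Fin.sum_univ_two]
      omega)
  have h3 : ∀ j, lineSum c S (polyMul ((X 1 - X 0) ^ j) F) =
      ∑ m ∈ T, c m • polyMul ((X 1 - X 0) ^ j) F ![m, S - m] := fun j =>
    h1 _ fun i => (hb i).polyMul _
  rw [h1 _ fun i => (hb i).psMul _ _, finsum_eq_sum_of_support_subset (s := Finset.range J)]
  · simp only [h3, Finset.smul_sum]
    rw [Finset.sum_comm]
    refine Finset.sum_congr rfl fun m _ => ?_
    rw [psMul_eq_sum φ (h2 m), Finset.smul_sum]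
    exact Finset.sum_congr rfl fun j _ => smul_comm _ _ _
  · intro j hj
    by_contra hc
    refine hj ?_
    beta_reduce
    rw [h3, Finset.sum_eq_zero, smul_zero]
    intro m _
    rw [h2 m j (by simpa using hc), smul_zero]

theorem polyMul_neg_diff_pow (F : FSeries (Fin 2) V) (j : ℕ) :
    polyMul ((X 1 - X 0) ^ j) F = (-1 : ℂ) ^ j • polyMul ((X 0 - X 1) ^ j) F := by
  rw [← polyMul_C_mul, map_pow, ← mul_pow]
  congr 2
  simp

theorem lineSum_smul (c : ℤ → ℂ) (S : ℤ) (t : ℂ) (F : FSeries (Fin 2) V) :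
    lineSum c S (t • F) = t • lineSum c S F := by
  rw [lineSum, lineSum, smul_finsum]
  exact finsum_congr fun m => by rw [Pi.smul_apply, smul_comm]

theorem lineSum_rightCoeff_psMul (a K S : ℤ) (φ : PowerSeries ℂ) {n : ℕ} {N : ℤ}
    {F : FSeries (Fin 2) V} (hF : IsLaurent (polyMul ((X 1 - X 0) ^ n) F)) (hb : BddAt 0 N F) :
    lineSum (rightCoeff a K) S (psMul φ (X 1 - X 0) (polyMul ((X 1 - X 0) ^ n) F)) =
      ∑ᶠ j : ℕ, PowerSeries.coeff j φ • (-1 : ℂ) ^ (j + n) •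
        lineSum (rightCoeff a (K - (j + n))) (S - (j + n)) F := by
  rw [lineSum_psMul _ _ _ hF]
  refine finsum_congr fun j => ?_
  rw [← polyMul_mul, ← pow_add, polyMul_neg_diff_pow, lineSum_smul, lineSum_rightCoeff hb]
  push_cast
  rfl

/-- The coefficients of the operator product expansion, multiplied by a delta function. -/
theorem finsum_ibinom_substVar {G : FSeries (Fin 2) V} (hG : IsLaurent G) (a b K : ℤ) :
    ∑ᶠ i : ℤ, (((ibinom (a + i) i : ℤ) : ℂ) * (-1) ^ i) •
      substVar ibinom 0 1 G ![K - 1 - i, b + i] =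
    lineSum (leftCoeff a K) (b + K - 1) G - lineSum (rightCoeff a K) (b + K - 1) G := by
  obtain ⟨N, hN⟩ := id hG
  set S := b + K - 1 with hS
  have hz : ∀ m, m ∉ Finset.Icc N (S - N) → G ![m, S - m] = 0 := fun m hm => by
    rw [Finset.mem_Icc, not_and_or, not_le, not_le] at hm
    rcases hm with hm | hm
    · exact hN _ ⟨0, by simpa using hm⟩
    · exact hN _ ⟨1, by simp; omega⟩
  have h1 : ∀ i, substVar ibinom 0 1 G ![K - 1 - i, b + i] =
      ∑ m ∈ Finset.Icc N (S - N), ((ibinom m (K - 1 - i) : ℤ) : ℂ) • G ![m, S - m] := fun i => by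
    have h2 : ∀ m : ℤ, ![K - 1 - i, b + i] + (m - (K - 1 - i)) • (bv 0 - bv 1) = ![m, S - m] :=
      fun m => by
        funext l
        fin_cases l <;> simp [bv_apply]
        omega
    rw [substVar]
    simp only [Matrix.cons_val_zero, h2]
    rw [finsum_eq_sum _ fun m hm => by rw [hz m hm, smul_zero]]
    exact Finset.sum_congr rfl fun m _ => (Int.cast_smul_eq_zsmul ℂ _ _).symm
  -- Upper negation brings the delta coefficients into the form needed for the Vandermonde sum with
  -- `ibinom m (K - 1 - i)`.
  have h3 : ∀ i, ((ibinom (a + i) i : ℤ) : ℂ) * (-1) ^ i = ((ibinom (-1 - a) i : ℤ) : ℂ) :=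
    fun i => by
      rw [show -1 - a = -(1 + a) by ring, ibinom_neg, show 1 + a + i - 1 = a + i by ring, mul_comm]
  rw [← lineSum_sub hG, lineSum_eq_sum _ fun m hm => Or.inr (hz m hm)]
  simp only [h1, h3, ← ibinom_eq_leftCoeff_sub]
  rw [finsum_eq_sum (Finset.Icc 0 (K - 1))]
  · simp only [Finset.smul_sum, smul_smul]
    rw [Finset.sum_comm]
    refine Finset.sum_congr rfl fun m _ => ?_
    rw [← Finset.sum_smul]
    congr 1
    have h4 := sum_ibinom_mul_ibinom (-1 - a) m 0 (K - 1) (T := Finset.Icc 0 (K - 1))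
      fun t ht ht' => by rw [Finset.mem_Icc]; omega
    simp only [sub_zero, zero_add] at h4
    rw [show m - 1 - a = -1 - a + m by ring, ← h4]
    push_cast
    rfl
  · intro i hi
    rw [Finset.mem_Icc, not_and_or, not_le, not_le] at hi
    rcases hi with hi | hi
    · rw [ibinom_of_neg _ hi]; simp
    · rw [Finset.sum_eq_zero, smul_zero]
      intro m _
      rw [ibinom_of_neg m (show K - 1 - i < 0 by omega)]; simp

end Lines

/-! ### The Jacobi identity -/

section Jacobi

variable {V : Type*} [AddCommGroup V] [Module ℂ V]

omit [Module ℂ V] in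
theorem finsum_eq_finsum_comp {α β : Type*} {θ : α → β} (hθ : Function.Injective θ) {g : β → V}
    (h : ∀ d, d ∉ Set.range θ → g d = 0) : ∑ᶠ d, g d = ∑ᶠ a, g (θ a) := by
  rw [← finsum_mem_range hθ, finsum_mem_def]
  refine finsum_congr fun d => ?_
  by_cases hd : d ∈ Set.range θ
  · rw [Set.indicator_of_mem hd]
  · rw [Set.indicator_of_notMem hd, h d hd]

/-- `x₀⁻¹ δ((x₁ - x₂) / x₀) F(x₁, x₂)`. -/
theorem seriesMul_delta_left (F : FSeries (Fin 2) V) (e : Fin 3 → ℤ) :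
    seriesMul (delta 0 1 2 1 (-1)) (fun e : Fin 3 → ℤ => if e 0 = 0 then F ![e 1, e 2] else 0) e =
      lineSum (leftCoeff (e 1) (1 + e 0)) (e 0 + e 1 + e 2 + 1) F := by
  set S := e 0 + e 1 + e 2 + 1 with hS
  -- F does not involve x₀ and the delta function is homogeneous of degree -1, so one free exponent
  -- m remains.
  rw [seriesMul, finsum_eq_finsum_comp (θ := fun m : ℤ => (![e 0, e 1 - m, e 2 - (S - m)] : Fin 3 → ℤ))]
  · refine finsum_congr fun m => ?_
    have h1 : e 1 - m + (e 2 - (S - m)) = -(1 + e 0) := by omega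
    have h2 : e 2 - (S - m) = m - e 1 - (1 + e 0) := by omega
    have h3 : e 0 + (e 1 - m) + (e 2 - (S - m)) = -1 := by omega
    simp only [delta, Matrix.cons_val_zero, Matrix.cons_val_one, Matrix.cons_val, Pi.sub_apply,
      sub_self, if_true, h3, h1, one_zpow, one_mul, sub_sub_cancel, leftCoeff]
    rw [h2, mul_comm]
  · intro m m' h
    have := congrFun h 1
    simpa using this
  · intro d hd
    by_cases h1 : d 0 + d 1 + d 2 = -1
    · have h2 : (e - d) 0 ≠ 0 := fun h2 => hd ⟨e 1 - d 1, by
        rw [Pi.sub_apply] at h2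
        funext i
        fin_cases i
        · simp; omega
        · simp
        · simp; omega⟩
      rw [if_neg h2, smul_zero]
    · rw [delta, if_neg h1, zero_smul]

/-- `x₂⁻¹ δ((x₁ - x₀) / x₂) E(x₀, x₂)` for an operator product expansion `E`. -/
theorem seriesMul_delta_assoc {G E : FSeries (Fin 2) V} {k : ℕ} (hG : IsLaurent G)
    (h : substVar ibinom 0 1 G = polyMul (X 0 ^ k) E) (e : Fin 3 → ℤ) :
    seriesMul (delta 2 1 0 1 (-1)) (fun e : Fin 3 → ℤ => if e 1 = 0 then E ![e 0, e 2] else 0) e =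
      lineSum (leftCoeff (e 1) (k + 1 + e 0)) (e 1 + e 2 + (k + 1 + e 0)) G -
      lineSum (rightCoeff (e 1) (k + 1 + e 0)) (e 1 + e 2 + (k + 1 + e 0)) G := by
  have h0 := finsum_ibinom_substVar hG (e 1) (e 2 + 1 + e 1) (k + 1 + e 0)
  rw [show e 2 + 1 + e 1 + (k + 1 + e 0) - 1 = e 1 + e 2 + (k + 1 + e 0) by ring] at h0
  rw [← h0, seriesMul, finsum_eq_finsum_comp (θ := fun i : ℤ => (![i, e 1, -1 - e 1 - i] : Fin 3 → ℤ))]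
  · refine finsum_congr fun i => ?_
    have h3 : -1 - e 1 - i + e 1 + i = -1 := by omega
    have h4 : (![(k : ℤ) + 1 + e 0 - 1 - i, e 2 + 1 + e 1 + i] : Fin 2 → ℤ) - (k : ℤ) • bv 0 =
        ![e 0 - i, e 2 - (-1 - e 1 - i)] := by
      funext l
      fin_cases l <;> simp [bv_apply] <;> ring
    rw [h, polyMul_X_pow, h4]
    simp only [delta, Matrix.cons_val_zero, Matrix.cons_val_one, Matrix.cons_val, Pi.sub_apply,
      sub_self, if_true, h3, one_zpow, one_mul]
  · intro m m' h
    have := congrFun h 0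
    simpa using this
  · intro d hd
    by_cases h1 : d 2 + d 1 + d 0 = -1
    · have h2 : (e - d) 1 ≠ 0 := fun h2 => hd ⟨d 0, by
        rw [Pi.sub_apply] at h2
        funext i
        fin_cases i
        · simp
        · simp; omega
        · simp; omega⟩
      rw [if_neg h2, smul_zero]
    · rw [delta, if_neg h1, zero_smul]

theorem seriesMul_evalNeg (f : LaurentSeries ℂ) (F : FSeries (Fin 2) V) :
    seriesMul (evalNeg f) (fun e : Fin 3 → ℤ => if e 0 = 0 then F ![e 1, e 2] else 0) =
      fun e => (f.coeff (e 0) * (-1) ^ (e 0)) • F ![e 1, e 2] := by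
  funext e
  rw [seriesMul, finsum_eq_single _ (![e 0, 0, 0] : Fin 3 → ℤ)]
  · simp [evalNeg]
  · intro d hd
    by_cases h1 : d 1 = 0 ∧ d 2 = 0
    · have h2 : (e - d) 0 ≠ 0 := fun h2 => hd (by
        rw [Pi.sub_apply] at h2
        funext i
        fin_cases i
        · simp; omega
        · simp [h1.1]
        · simp [h1.2])
      rw [if_neg h2, smul_zero]
    · rw [evalNeg, if_neg h1, zero_smul]

omit [Module ℂ V] in
theorem IsIterLaurent.exists_bound {F : FSeries (Fin 2) V} (h : IsIterLaurent F) (B : ℤ) :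
    ∃ L, ∀ m n, m ≤ B → n < L → F ![m, n] = 0 := by
  obtain ⟨⟨N, hN⟩, h2⟩ := h
  choose K hK using h2
  obtain ⟨L, hL⟩ := ((Set.finite_Icc N B).image K).bddBelow
  refine ⟨L, fun m n hm hn => ?_⟩
  rcases lt_or_ge m N with h | h
  · exact hN _ (by simpa using h)
  · exact hK m _ (by simp) (hn.trans_le (hL ⟨m, ⟨h, hm⟩, rfl⟩))

/-- `x₀⁻¹ δ((x₂ - x₁) / (-x₀)) f(-x₀) F(x₁, x₂)`, with the finiteness of the sums. -/
theorem seriesMul_delta_right {f : LaurentSeries ℂ} {p : ℤ} (hf : ∀ t < p, f.coeff t = 0)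
    {F : FSeries (Fin 2) V} (hF : IsIterLaurent F) (e : Fin 3 → ℤ) :
    (Function.support fun d : Fin 3 → ℤ => delta 0 2 1 (-1) (-1) d •
      ((f.coeff ((e - d) 0) * (-1) ^ ((e - d) 0)) • F ![(e - d) 1, (e - d) 2])).Finite ∧
    seriesMul (delta 0 2 1 (-1) (-1))
      (fun e : Fin 3 → ℤ => (f.coeff (e 0) * (-1) ^ (e 0)) • F ![e 1, e 2]) e =
      ∑ᶠ j : ℕ, (f.coeff (p + j) * (-1) ^ (p + j)) •
        lineSum (rightCoeff (e 1) (1 + e 0 - p - j)) (e 0 + e 1 + e 2 + 1 - p - j) F := by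
  set S := e 0 + e 1 + e 2 + 1 with hS
  set g : (Fin 3 → ℤ) → V := fun d => delta 0 2 1 (-1) (-1) d •
      ((f.coeff ((e - d) 0) * (-1) ^ ((e - d) 0)) • F ![(e - d) 1, (e - d) 2]) with hg
  -- The first index is the power of the argument of f, counted from its lowest possible power p;
  -- the second is the exponent of x₁ in F.
  set θ : ℕ × ℤ → Fin 3 → ℤ := fun q => ![e 0 - p - q.1, e 1 - q.2, e 2 - (S - p - q.1 - q.2)]
    with hθ
  have hinj : Function.Injective θ := fun q q' h => by
    have h0 := congrFun h 0
    have h1 := congrFun h 1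
    simp only [hθ, Matrix.cons_val_zero, Matrix.cons_val_one] at h0 h1
    exact Prod.ext (by omega) (by omega)
  have hrange : ∀ d, d ∉ Set.range θ → g d = 0 := fun d hd => by
    by_cases h1 : d 0 + d 2 + d 1 = -1
    · rcases lt_or_ge ((e - d) 0) p with h2 | h2
      · rw [hg]
        simp only [hf _ h2, zero_mul, zero_smul, smul_zero]
      · rw [Pi.sub_apply] at h2
        refine absurd ⟨((e 0 - d 0 - p).toNat, e 1 - d 1), ?_⟩ hd
        funext i
        fin_cases i
        · simp [hθ]; omega
        · simp [hθ]
        · simp [hθ]; omega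
    · rw [hg]
      simp only [delta, if_neg h1, zero_smul]
  have hval : ∀ q, g (θ q) = (f.coeff (p + q.1) * (-1) ^ (p + q.1)) •
      (rightCoeff (e 1) (1 + e 0 - p - q.1) q.2 • F ![q.2, S - p - q.1 - q.2]) := fun q => by
    have h1 : e 0 - p - q.1 + (e 2 - (S - p - q.1 - q.2)) + (e 1 - q.2) = -1 := by omega
    have h2 : e 2 - (S - p - q.1 - q.2) + (e 1 - q.2) = -(1 + e 0 - p - q.1) := by omega
    have h3 : e 0 - (e 0 - p - (q.1 : ℤ)) = p + q.1 := by ring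
    simp only [hg, hθ, delta, Matrix.cons_val_zero, Matrix.cons_val_one, Matrix.cons_val,
      Pi.sub_apply, h1, h2, h3, if_true, sub_sub_cancel, neg_neg]
    rw [smul_comm]
    congr 2
    rw [rightCoeff, show 1 + e 0 - p - (q.1 : ℤ) + e 1 - q.2 = 1 + e 0 - p - q.1 + (e 1 - q.2) by ring,
      zpow_add₀ (by norm_num)]
    ring
  obtain ⟨⟨N, hN⟩, -⟩ := id hF
  obtain ⟨L, hL⟩ := hF.exists_bound (e 1)
  have hfin : (Function.support fun q => g (θ q)).Finite := by
    refine ((Set.finite_Iic (S - p - N - L).toNat).prod (Set.finite_Icc N (e 1))).subset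
      fun q hq => ?_
    by_contra hc
    refine hq ?_
    beta_reduce
    rw [hval]
    rw [Set.mem_prod, Set.mem_Icc, Set.mem_Iic, not_and_or, not_and_or, not_le, not_le, not_le] at hc
    by_cases h1 : q.2 < N
    · rw [hN _ (by simpa using h1), smul_zero, smul_zero]
    by_cases h2 : e 1 < q.2
    · rw [rightCoeff_of_lt h2, zero_smul, smul_zero]
    · rw [hL _ _ (by omega) (by omega), smul_zero, smul_zero]
  refine ⟨(hfin.image θ).subset fun d hd => ?_, ?_⟩
  · obtain ⟨q, rfl⟩ : d ∈ Set.range θ := by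
      by_contra hc
      exact hd (hrange d hc)
    exact ⟨q, hd, rfl⟩
  · rw [seriesMul]
    change ∑ᶠ d, g d = _
    rw [finsum_eq_finsum_comp hinj hrange, finsum_curry _ hfin]
    refine finsum_congr fun j => ?_
    rw [lineSum, smul_finsum]
    exact finsum_congr fun m => hval (j, m)

/-- The Laurent series `(-1) ^ k * x ^ (n - k) * φ(x)`. -/
def shiftedLaurent (k n : ℕ) (φ : PowerSeries ℂ) : LaurentSeries ℂ :=
  HahnSeries.single ((n : ℤ) - k) ((-1) ^ k) * (φ : LaurentSeries ℂ)

theorem shiftedLaurent_coeff_add (k n : ℕ) (φ : PowerSeries ℂ) (j : ℕ) :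
    (shiftedLaurent k n φ).coeff ((n : ℤ) - k + j) = (-1) ^ k * PowerSeries.coeff j φ := by
  rw [shiftedLaurent, add_comm, HahnSeries.coeff_single_mul_add, PowerSeries.coeff_coe]
  simp

theorem shiftedLaurent_coeff_of_lt (k n : ℕ) (φ : PowerSeries ℂ) {t : ℤ} (ht : t < (n : ℤ) - k) :
    (shiftedLaurent k n φ).coeff t = 0 := by
  rw [shiftedLaurent, show t = (t - ((n : ℤ) - k)) + ((n : ℤ) - k) by ring,
    HahnSeries.coeff_single_mul_add, PowerSeries.coeff_coe, if_pos (by omega), mul_zero]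

theorem seriesMul_delta_shiftedLaurent (k n : ℕ) (φ : PowerSeries ℂ) {F : FSeries (Fin 2) V}
    (hF : IsIterLaurent F) (hL : IsLaurent (polyMul ((X 1 - X 0) ^ n) F)) (e : Fin 3 → ℤ) :
    seriesMul (delta 0 2 1 (-1) (-1)) (fun e : Fin 3 → ℤ =>
      ((shiftedLaurent k n φ).coeff (e 0) * (-1) ^ (e 0)) • F ![e 1, e 2]) e =
      lineSum (rightCoeff (e 1) (k + 1 + e 0)) (e 1 + e 2 + (k + 1 + e 0))
        (psMul φ (X 1 - X 0) (polyMul ((X 1 - X 0) ^ n) F)) := by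
  obtain ⟨⟨N, hN⟩, -⟩ := id hF
  rw [(seriesMul_delta_right (fun t => shiftedLaurent_coeff_of_lt k n φ) hF e).2,
    lineSum_rightCoeff_psMul _ _ _ _ hL hN]
  refine finsum_congr fun j => ?_
  rw [shiftedLaurent_coeff_add, smul_smul,
    show 1 + e 0 - ((n : ℤ) - k) - j = k + 1 + e 0 - (j + n) by ring,
    show e 0 + e 1 + e 2 + 1 - ((n : ℤ) - k) - j = e 1 + e 2 + (k + 1 + e 0) - (j + n) by ring]
  congr 1
  have h1 : ((-1 : ℂ) ^ k) * (-1) ^ ((n : ℤ) - k + j) = (-1) ^ (j + n) := by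
    rw [← zpow_natCast, ← zpow_natCast, ← zpow_add₀ (by norm_num)]
    congr 1
    push_cast
    ring
  rw [← h1]
  ring

/-- The Jacobi identity follows from the locality relation and the operator product expansion. -/
theorem jacobi_of_relation {r : ℕ} {P E : FSeries (Fin 2) V} {Q : Fin r → FSeries (Fin 2) V} {k : ℕ}
    {n : Fin r → ℕ} {φ : Fin r → PowerSeries ℂ} (hP : ∃ N, BddAt 1 N P)
    (hQ : ∀ s, IsIterLaurent (Q s)) (hG : IsLaurent (polyMul ((X 0 - X 1) ^ k) P))
    (hE : substVar ibinom 0 1 (polyMul ((X 0 - X 1) ^ k) P) = polyMul (X 0 ^ k) E)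
    (hL : ∀ s, IsLaurent (polyMul ((X 1 - X 0) ^ n s) (Q s)))
    (h : polyMul ((X 0 - X 1) ^ k) P =
      ∑ s, psMul (φ s) (X 1 - X 0) (polyMul ((X 1 - X 0) ^ n s) (Q s))) :
    seriesMul (delta 0 1 2 1 (-1)) (fun e : Fin 3 → ℤ => if e 0 = 0 then P ![e 1, e 2] else 0) -
      seriesMul (delta 0 2 1 (-1) (-1))
        (∑ s, seriesMul (evalNeg (shiftedLaurent k (n s) (φ s)))
          (fun e : Fin 3 → ℤ => if e 0 = 0 then Q s ![e 1, e 2] else 0)) =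
    seriesMul (delta 2 1 0 1 (-1)) (fun e : Fin 3 → ℤ => if e 1 = 0 then E ![e 0, e 2] else 0) := by
  funext e
  obtain ⟨N, hN⟩ := hP
  -- The locality relation recombines all exchanged products into (x₁ - x₂)ᵏP, now weighted by the
  -- expansion in nonnegative powers of x₁.
  have h1 : seriesMul (delta 0 2 1 (-1) (-1))
        (∑ s, seriesMul (evalNeg (shiftedLaurent k (n s) (φ s)))
          (fun e : Fin 3 → ℤ => if e 0 = 0 then Q s ![e 1, e 2] else 0)) e =
      lineSum (rightCoeff (e 1) (k + 1 + e 0)) (e 1 + e 2 + (k + 1 + e 0))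
        (polyMul ((X 0 - X 1) ^ k) P) := by
    rw [h, lineSum_sum _ _ _ _ fun s => (hL s).psMul _ _]
    simp only [seriesMul_evalNeg, ← seriesMul_delta_shiftedLaurent k _ _ (hQ _) (hL _) e]
    simp only [seriesMul, Finset.sum_apply, Finset.smul_sum]
    exact finsum_sum_comm _ _ fun s _ =>
      (seriesMul_delta_right (fun t => shiftedLaurent_coeff_of_lt k (n s) (φ s)) (hQ s) e).1
  -- Summation by parts puts the first term in terms of P itself; the right side is the difference
  -- of the two weighted sums of (x₁ - x₂)ᵏP.
  rw [Pi.sub_apply, h1, seriesMul_delta_left, seriesMul_delta_assoc hG hE, lineSum_leftCoeff hN,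
    show (k : ℤ) + 1 + e 0 - k = 1 + e 0 by ring,
    show e 1 + e 2 + ((k : ℤ) + 1 + e 0) - k = e 0 + e 1 + e 2 + 1 by ring]

theorem jacobi_of_pairSeries_relation {Y : V →ₗ[ℂ] VertexOperator ℂ V} {a b c : V} {k r : ℕ}
    {φ : Fin r → PowerSeries ℂ} {n : Fin r → ℕ} {u v : Fin r → V}
    (hG : IsLaurent (polyMul ((X 0 - X 1) ^ k) (pairSeries (Y a) (Y b) c)))
    (hE : IsOpe (pairSeries (Y a) (Y b) c) (fun e : Fin 2 → ℤ =>
      HVertexOperator.coeff (Y (HVertexOperator.coeff (Y a) (e 0) b)) (e 1) c))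
    (hL : ∀ s, IsLaurent (polyMul ((X 1 - X 0) ^ n s) (pairSeriesSwap (Y (u s)) (Y (v s)) c)))
    (h : polyMul ((X 0 - X 1) ^ k) (pairSeries (Y a) (Y b) c) = ∑ s, psMul (φ s) (X 1 - X 0)
      (polyMul ((X 1 - X 0) ^ n s) (pairSeriesSwap (Y (u s)) (Y (v s)) c))) :
    seriesMul (delta 0 1 2 1 (-1)) (fun e : Fin 3 → ℤ => if e 0 = 0 then
        HVertexOperator.coeff (Y a) (e 1) (HVertexOperator.coeff (Y b) (e 2) c) else 0) -
      seriesMul (delta 0 2 1 (-1) (-1))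
        (∑ s, seriesMul (evalNeg (shiftedLaurent k (n s) (φ s)))
          (fun e : Fin 3 → ℤ => if e 0 = 0 then HVertexOperator.coeff (Y (u s)) (e 2)
            (HVertexOperator.coeff (Y (v s)) (e 1) c) else 0)) =
    seriesMul (delta 2 1 0 1 (-1)) (fun e : Fin 3 → ℤ => if e 1 = 0 then
      HVertexOperator.coeff (Y (HVertexOperator.coeff (Y a) (e 0) b)) (e 2) c else 0) :=
  jacobi_of_relation (exists_bddAt_pairSeries (Y a) (Y b) c)
    (fun s => isIterLaurent_pairSeriesSwap (Y (u s)) (Y (v s)) c) hG (hE.eq_of_isLaurent hG) hL h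

end Jacobi

/-! ### The weak quantum vertex algebra structure -/

section WeakQuantum

variable {W : Type*} [AddCommGroup W] [Module ℂ W] {A : Submodule ℂ (VertexOperator ℂ W)}

/-- The data of the Jacobi identity come from the relation between the fields a and b, so they serve
all vectors c simultaneously. -/
theorem isWeakQVA_vertexMap (hA : MutuallyLocal A A)
    (hcl : ∀ a ∈ A, ∀ b ∈ A, ∀ n, nthProd a b n ∈ A) (h1 : idField W ∈ A) :
    IsWeakQVA (vertexMap hA hcl) ⟨idField W, h1⟩ := by
  refine ⟨hasVacuum_vertexMap hA hcl h1, fun a b => ?_⟩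
  obtain ⟨k, r, φ, n, u, v, hk, hn, hL, h⟩ := hA.exists_relation a b
  exact ⟨r, u, v, fun s => shiftedLaurent k (n s) (φ s), fun c =>
    jacobi_of_pairSeries_relation (isLaurent_polyMul_pairSeries_vertexMap hA hcl hk c)
      (isOpe_vertexMap hA hcl a b c)
      (fun s => isLaurent_polyMul_pairSeriesSwap_vertexMap hA hcl (hn s) c)
      (pairSeries_vertexMap_relation hA hcl hk hn hL h c)⟩

end WeakQuantum

end Vtx

end

/-! ### Conclusion for the subspace generated by an 𝒮-local set -/

theorem theorem5p8 {W : Type*} [AddCommGroup W] [Module ℂ W]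
    (S : Set (VertexOperator ℂ W)) (hS : Vtx.IsSLocal S) :
    IsLeast (Vtx.closedQCContaining S) (Vtx.generated S) ∧
    ∃ (Y : Vtx.generated S →ₗ[ℂ] VertexOperator ℂ (Vtx.generated S)) (vac : Vtx.generated S),
      (vac : VertexOperator ℂ W) = Vtx.idField W ∧
      (∀ (a b : Vtx.generated S) (n : ℤ),
        ((VertexOperator.ncoeff (Y a) n b : Vtx.generated S) : VertexOperator ℂ W) =
          Vtx.nthProd (a : VertexOperator ℂ W) (b : VertexOperator ℂ W) n) ∧
      Vtx.IsNonlocalVA Y vac ∧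
      Vtx.IsWeakQVA Y vac ∧
      Vtx.IsVAModule Y vac (Vtx.generated S).subtype ∧
      Function.Injective (Vtx.generated S).subtype := by
  have hL := hS.isLeast_generated
  have hA := hS.mutuallyLocal_generated
  have hcl := hL.1.1.2
  have h1 := hL.1.2.2
  exact ⟨hL, Vtx.vertexMap hA hcl, ⟨Vtx.idField W, h1⟩, rfl, Vtx.coe_ncoeff_vertexMap hA hcl,
    Vtx.isNonlocalVA_vertexMap hA hcl h1, Vtx.isWeakQVA_vertexMap hA hcl h1,
    Vtx.isVAModule_vertexMap hA hcl h1, Subtype.val_injective⟩
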